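/- Let $n\ge 2$, let $\mathbb{S}^{n-1}$ be the unit sphere of $\mathbb{R}^n$ with Laplace–Beltrami operator $\Delta_{\mathbf u}$, and let $\mathbb{Y}^{n+1}=\mathbb{S}^{n-1}\times\mathbb{R}\times\mathbb{R}_+$ with points $(\mathbf u,b,a)$, where $\mathbb{R}_+=(0,\infty)$. All functions are complex-valued. Let $\mathcal S(\mathbb{Y}^{n+1})$ be the space of all $\Phi\in C^\infty(\mathbb{Y}^{n+1})$ such that $$\rho^{l,m,k}_{s,r}(\Phi)=\sup_{(\mathbf u,b,a)\in\mathbb{Y}^{n+1}}\Bigl(a^s+\frac1{a^s}\Bigr)(1+b^2)^{r/2}\Bigl|\frac{\partial^l}{\partial a^l}\frac{\partial^m}{\partial b^m}\Delta_{\mathbf u}^k\Phi(\mathbf u,b,a)\Bigr|<\infty\qquad\text{for all } l,m,k,s,r\in\mathbb{N}_0,$$ with the topology defined by these seminorms. Let $\mathcal S(\mathbb{S}^{n-1}\times\mathbb{R})$ be the space of all $g\in C^\infty(\mathbb{S}^{n-1}\times\mathbb{R})$ such that $$\sup_{(\mathbf u,p)\in\mathbb{S}^{n-1}\times\mathbb{R}}(1+|p|)^N\Bigl|\frac{\partial^q}{\partial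 p^q}\Delta_{\mathbf u}^k g(\mathbf u,p)\Bigr|<\infty\qquad\text{for all } N,q,k\in\mathbb{N}_0,$$ with the topology defined by these seminorms. Let $\mathcal S(\mathbb{R})$ be the Schwartz space, let $\mathcal S_0(\mathbb{R})$ be the subspace of all $\psi\in\mathcal S(\mathbb{R})$ with $\int_{\mathbb R}x^m\psi(x)\,dx=0$ for all $m\in\mathbb{N}_0$, and let $\mathcal S_0(\mathbb{S}^{n-1}\times\mathbb{R})$ be the subspace of all $g\in\mathcal S(\mathbb{S}^{n-1}\times\mathbb{R})$ with $\int_{\mathbb R}p^m g(\mathbf u,p)\,dp=0$ for all $m\in\mathbb{N}_0$ and $\mathbf u\in\mathbb{S}^{n-1}$; both carry the subspace topology. Products of spaces carry the product topology. For functions $g$ on $\mathbb{S}^{n-1}\times\mathbb{R}$, $\Phi$ on $\mathbb{Y}^{n+1}$ and $\psi$ on $\mathbb{R}$, put $$\mathcal W(g,\psi)(\mathbf u,b,a)=\int_{-\infty}^{\infty}\frac1a\,\overline{\psi}\Bigl(\frac{p-b}{a}\Bigr)g(\mathbf u,p)\,dp,\qquad (\mathbf u,b,a)\in\mathbb{Y}^{n+1},$$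 $$\mathcal M(\Phi,\psi)(\mathbf u,p)=\int_0^\infty\!\int_{-\infty}^{\infty}\frac1a\,\psi\Bigl(\frac{p-b}{a}\Bigr)\Phi(\mathbf u,b,a)\,\frac{db\,da}{a},\qquad(\mathbf u,p)\in\mathbb{S}^{n-1}\times\mathbb{R}.$$ Then these integrals converge absolutely for $g$, $\Phi$, $\psi$ in the spaces below, and they define continuous mappings 1. $\mathcal W:\mathcal S_0(\mathbb{S}^{n-1}\times\mathbb{R})\times\mathcal S_0(\mathbb{R})\to\mathcal S(\mathbb{Y}^{n+1})$; 2. $\mathcal M:\mathcal S(\mathbb{Y}^{n+1})\times\mathcal S(\mathbb{R})\to\mathcal S(\mathbb{S}^{n-1}\times\mathbb{R})$; 3. $\mathcal M:\mathcal S(\mathbb{Y}^{n+1})\times\mathcal S_0(\mathbb{R})\to\mathcal S_0(\mathbb{S}^{n-1}\times\mathbb{R})$. -/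

import Mathlib

open scoped Manifold ContDiff SchwartzMap ComplexConjugate
open MeasureTheory

noncomputable section

set_option linter.unusedSectionVars false

namespace Ridgelet

/-! ### The sphere, the cylinder `𝕊^{n-1} × ℝ` and `𝕐^{n+1} = 𝕊^{n-1} × ℝ × ℝ₊` -/

/-- The Euclidean space `ℝⁿ`. -/
abbrev Euc (n : ℕ) : Type := EuclideanSpace ℝ (Fin n)

/-- The unit sphere `𝕊^{n-1}` of `ℝⁿ`. -/
abbrev Sph (n : ℕ) : Type := Metric.sphere (0 : Euc n) 1

/-- `ℝ₊ = (0, ∞)`, as an open subset of `ℝ`. -/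
def posReal : TopologicalSpace.Opens ℝ := ⟨Set.Ioi 0, isOpen_Ioi⟩

/-- `𝕊^{n-1} × ℝ`, with points `(u, p)`. -/
abbrev Cyl (n : ℕ) : Type := Sph n × ℝ

/-- `𝕐^{n+1} = 𝕊^{n-1} × ℝ × ℝ₊`, with points `(u, b, a)`. -/
abbrev YSp (n : ℕ) : Type := Sph n × ℝ × posReal

/-- Mathlib's manifold structure on the unit sphere of `ℝⁿ` asks for this. -/
instance factFinrank (n : ℕ) [n.AtLeastTwo] :
    Fact (Module.finrank ℝ (Euc n) = (n - 1) + 1) :=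
  ⟨by have := Nat.AtLeastTwo.prop (n := n); simp; omega⟩

/-- The radial projection `x ↦ x / ‖x‖` onto the sphere (an arbitrary value at `x = 0`). -/
def radial {n : ℕ} [n.AtLeastTwo] (x : Euc n) : Sph n :=
  if h : x = 0 then ⟨EuclideanSpace.single 0 1, by simp⟩
  else ⟨‖x‖⁻¹ • x, by simp [norm_smul, h]⟩

/-- A positive real, seen as a point of `ℝ₊` (an arbitrary value at nonpositive reals). -/
def toPos (t : ℝ) : posReal := if h : 0 < t then ⟨t, h⟩ else ⟨1, (one_pos : (0 : ℝ) < 1)⟩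

variable {n : ℕ} [n.AtLeastTwo]

/-- The Laplace–Beltrami operator of the unit sphere: `Δ_𝕊 f` is the restriction to the sphere of
the Euclidean Laplacian of the extension `x ↦ f (x / ‖x‖)` of `f`, homogeneous of degree `0`. -/
def sphereLaplacian (f : Sph n → ℂ) : Sph n → ℂ :=
  fun u => Laplacian.laplacian (fun x : Euc n => f (radial x)) (u : Euc n)

/-- Smooth functions on `𝕐^{n+1}`. -/
def SmoothY (Φ : YSp n → ℂ) : Prop :=
  ContMDiff ((𝓡 (n - 1)).prod (𝓘(ℝ, ℝ).prod 𝓘(ℝ, ℝ))) 𝓘(ℝ, ℂ) ∞ Φ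

/-- Smooth functions on `𝕊^{n-1} × ℝ`. -/
def SmoothCyl (g : Cyl n → ℂ) : Prop :=
  ContMDiff ((𝓡 (n - 1)).prod 𝓘(ℝ, ℝ)) 𝓘(ℝ, ℂ) ∞ g

/-- `Δ_u` on functions on `𝕐^{n+1}`. -/
def lapY (Φ : YSp n → ℂ) : YSp n → ℂ :=
  fun y => sphereLaplacian (fun v => Φ (v, y.2.1, y.2.2)) y.1

/-- `∂/∂b` on functions on `𝕐^{n+1}`. -/
def dbY (Φ : YSp n → ℂ) : YSp n → ℂ :=
  fun y => deriv (fun t : ℝ => Φ (y.1, t, y.2.2)) y.2.1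

/-- `∂/∂a` on functions on `𝕐^{n+1}`. -/
def daY (Φ : YSp n → ℂ) : YSp n → ℂ :=
  fun y => deriv (fun t : ℝ => Φ (y.1, y.2.1, toPos t)) (y.2.2 : ℝ)

/-- `Δ_u` on functions on `𝕊^{n-1} × ℝ`. -/
def lapCyl (g : Cyl n → ℂ) : Cyl n → ℂ :=
  fun z => sphereLaplacian (fun v => g (v, z.2)) z.1

/-- `∂/∂p` on functions on `𝕊^{n-1} × ℝ`. -/
def dpCyl (g : Cyl n → ℂ) : Cyl n → ℂ :=
  fun z => deriv (fun t : ℝ => g (z.1, t)) z.2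

/-- `∂_a^l ∂_b^m Δ_u^k`. -/
def mixedY (l m k : ℕ) (Φ : YSp n → ℂ) : YSp n → ℂ :=
  daY^[l] (dbY^[m] (lapY^[k] Φ))

/-- `∂_p^q Δ_u^k`. -/
def mixedCyl (q k : ℕ) (g : Cyl n → ℂ) : Cyl n → ℂ :=
  dpCyl^[q] (lapCyl^[k] g)

/-- The weight `(a^s + a^{-s}) (1 + b²)^{r/2}`. -/
def weightY (s r : ℕ) (y : YSp n) : ℝ :=
  ((y.2.2 : ℝ) ^ s + 1 / (y.2.2 : ℝ) ^ s) * (1 + y.2.1 ^ 2) ^ ((r : ℝ) / 2)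

/-- The weight `(1 + |p|)^N`. -/
def weightCyl (N : ℕ) (z : Cyl n) : ℝ := (1 + |z.2|) ^ N

/-! ### The differential operators preserve smoothness and are linear on smooth functions -/

lemma ne_zero_coe (u : Sph n) : (u : Euc n) ≠ 0 := by
  have h1 : ‖(u : Euc n)‖ = 1 := by simp
  intro h0
  rw [h0, norm_zero] at h1
  exact zero_ne_one h1

lemma radial_coe (u : Sph n) : radial (u : Euc n) = u := by
  have h := ne_zero_coe u
  apply Subtype.ext
  simp [radial, h]

lemma toPos_coe (a : posReal) : toPos (a : ℝ) = a := by
  have h : 0 < (a : ℝ) := a.2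
  apply Subtype.ext
  simp [toPos, h]

lemma coe_toPos {t : ℝ} (h : 0 < t) : (toPos t : ℝ) = t := by
  simp [toPos, h]

lemma contMDiffAt_radial {x : Euc n} (hx : x ≠ 0) :
    ContMDiffAt 𝓘(ℝ, Euc n) (𝓡 (n - 1)) ∞ (radial : Euc n → Sph n) x := by
  let U : TopologicalSpace.Opens (Euc n) := ⟨{x | x ≠ 0}, isOpen_ne⟩
  have hf : ContMDiff 𝓘(ℝ, Euc n) 𝓘(ℝ, Euc n) ∞
      (fun y : U => ‖(y : Euc n)‖⁻¹ • (y : Euc n)) := by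
    intro y
    have hy : (y : Euc n) ≠ 0 := y.2
    have h1 : ContDiffAt ℝ ∞ (fun z : Euc n => ‖z‖⁻¹ • z) (y : Euc n) :=
      ((contDiffAt_norm ℝ hy).inv (norm_ne_zero_iff.2 hy)).smul contDiffAt_id
    exact contMDiffAt_subtype_iff.2 h1.contMDiffAt
  have hs : ∀ y : U, ‖(y : Euc n)‖⁻¹ • (y : Euc n) ∈ Metric.sphere (0 : Euc n) 1 := by
    intro y
    have hy : (y : Euc n) ≠ 0 := y.2
    simp [norm_smul, hy]
  have h2 := hf.codRestrict_sphere (n := n - 1) hs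
  have h3 : (Set.codRestrict _ _ hs : U → Sph n) = fun y : U => radial (y : Euc n) := by
    funext y
    have hy : (y : Euc n) ≠ 0 := y.2
    apply Subtype.ext
    simp [radial, hy]
  rw [h3] at h2
  exact contMDiffAt_subtype_iff.1 (h2 (⟨x, hx⟩ : U))

lemma contMDiffAt_toPos {t : ℝ} (ht : 0 < t) :
    ContMDiffAt 𝓘(ℝ, ℝ) 𝓘(ℝ, ℝ) ∞ toPos t := by
  rw [← ContMDiffAt.subtypeVal_comp_iff]
  have : (Subtype.val ∘ toPos) =ᶠ[nhds t] id := by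
    filter_upwards [lt_mem_nhds ht] with s hs
    exact coe_toPos hs
  exact contMDiffAt_id.congr_of_eventuallyEq this

/-- The extension of a function on `𝕐^{n+1}` that is homogeneous of degree `0` in the first
variable. -/
def extY (Φ : YSp n → ℂ) (z : Euc n × ℝ × ℝ) : ℂ := Φ (radial z.1, z.2.1, toPos z.2.2)

lemma SmoothY.contDiffAt_extY {Φ : YSp n → ℂ} (h : SmoothY Φ) {z : Euc n × ℝ × ℝ}
    (hx : z.1 ≠ 0) (ha : 0 < z.2.2) : ContDiffAt ℝ ∞ (extY Φ) z := by
  rw [← contMDiffAt_iff_contDiffAt]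
  have h1 : ContMDiffAt 𝓘(ℝ, Euc n × ℝ × ℝ) 𝓘(ℝ, Euc n) ∞
      (fun z : Euc n × ℝ × ℝ => z.1) z := contDiffAt_fst.contMDiffAt
  have h2 : ContMDiffAt 𝓘(ℝ, Euc n × ℝ × ℝ) 𝓘(ℝ, ℝ) ∞
      (fun z : Euc n × ℝ × ℝ => z.2.1) z := contDiffAt_snd.fst.contMDiffAt
  have h3 : ContMDiffAt 𝓘(ℝ, Euc n × ℝ × ℝ) 𝓘(ℝ, ℝ) ∞
      (fun z : Euc n × ℝ × ℝ => z.2.2) z := contDiffAt_snd.snd.contMDiffAt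
  have h4 := ((contMDiffAt_radial hx).comp z h1).prodMk
    (h2.prodMk ((contMDiffAt_toPos ha).comp z h3))
  exact (h _).comp z h4

lemma smoothY_of_contDiffAt {G : Euc n × ℝ × ℝ → ℂ}
    (h : ∀ z : Euc n × ℝ × ℝ, z.1 ≠ 0 → 0 < z.2.2 → ContDiffAt ℝ ∞ G z) :
    SmoothY (fun y : YSp n => G ((y.1 : Euc n), y.2.1, (y.2.2 : ℝ))) := by
  intro y
  have hι : ContMDiffAt ((𝓡 (n - 1)).prod (𝓘(ℝ, ℝ).prod 𝓘(ℝ, ℝ))) 𝓘(ℝ, Euc n × ℝ × ℝ) ∞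
      (fun y : YSp n => ((y.1 : Euc n), y.2.1, (y.2.2 : ℝ))) y := by
    refine ContMDiffAt.prodMk_space ?_ (ContMDiffAt.prodMk_space ?_ ?_)
    · exact (contMDiff_coe_sphere (n := n - 1) _).comp y contMDiffAt_fst
    · exact contMDiffAt_fst.comp y contMDiffAt_snd
    · exact (contMDiff_subtype_val (I := 𝓘(ℝ, ℝ)) (U := posReal) _).comp y
        (contMDiffAt_snd.comp y contMDiffAt_snd)
  exact (h ((y.1 : Euc n), y.2.1, (y.2.2 : ℝ)) (ne_zero_coe y.1) y.2.2.2).contMDiffAt.comp y hι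

lemma extY_coe (Φ : YSp n → ℂ) (y : YSp n) :
    extY Φ ((y.1 : Euc n), y.2.1, (y.2.2 : ℝ)) = Φ y := by
  simp [extY, radial_coe, toPos_coe]

lemma SmoothY.daY {Φ : YSp n → ℂ} (h : SmoothY Φ) : SmoothY (daY Φ) := by
  have key := smoothY_of_contDiffAt (n := n)
    (G := fun z => deriv (fun t : ℝ => extY Φ (z.1, z.2.1, t)) z.2.2) (by
      intro z hx ha
      have h1 : ContDiffAt ℝ ∞ (fun z : Euc n × ℝ × ℝ =>
          fderiv ℝ (fun t : ℝ => extY Φ (z.1, z.2.1, t)) z.2.2) z := by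
        refine ContDiffAt.fderiv (n := ∞) ?_ contDiffAt_snd.snd (by simp)
        exact ContDiffAt.comp (f := fun q : (Euc n × ℝ × ℝ) × ℝ => (q.1.1, q.1.2.1, q.2))
          (z, z.2.2) (h.contDiffAt_extY (z := (z.1, z.2.1, z.2.2)) hx ha) (by fun_prop)
      exact h1.clm_apply contDiffAt_const)
  refine (congrArg SmoothY ?_).mp key
  funext y
  simp [Ridgelet.daY, extY, radial_coe]

lemma SmoothY.dbY {Φ : YSp n → ℂ} (h : SmoothY Φ) : SmoothY (dbY Φ) := by
  have key := smoothY_of_contDiffAt (n := n)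
    (G := fun z => deriv (fun t : ℝ => extY Φ (z.1, t, z.2.2)) z.2.1) (by
      intro z hx ha
      have h1 : ContDiffAt ℝ ∞ (fun z : Euc n × ℝ × ℝ =>
          fderiv ℝ (fun t : ℝ => extY Φ (z.1, t, z.2.2)) z.2.1) z := by
        refine ContDiffAt.fderiv (n := ∞) ?_ contDiffAt_snd.fst (by simp)
        exact ContDiffAt.comp (f := fun q : (Euc n × ℝ × ℝ) × ℝ => (q.1.1, q.2, q.1.2.2))
          (z, z.2.1) (h.contDiffAt_extY (z := (z.1, z.2.1, z.2.2)) hx ha) (by fun_prop)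
      exact h1.clm_apply contDiffAt_const)
  refine (congrArg SmoothY ?_).mp key
  funext y
  simp [Ridgelet.dbY, extY, radial_coe, toPos_coe]

lemma SmoothY.lapY {Φ : YSp n → ℂ} (h : SmoothY Φ) : SmoothY (lapY Φ) := by
  have key := smoothY_of_contDiffAt (n := n)
    (G := fun z => Laplacian.laplacian (fun x : Euc n => extY Φ (x, z.2)) z.1) (by
      intro z hx ha
      simp only [InnerProductSpace.laplacian_eq_iteratedFDeriv_stdOrthonormalBasis,
        iteratedFDeriv_two_apply]
      refine ContDiffAt.sum fun i _ => ?_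
      have h1 : ∀ z : Euc n × ℝ × ℝ, z.1 ≠ 0 → 0 < z.2.2 →
          ContDiffAt ℝ ∞ (fun z : Euc n × ℝ × ℝ =>
            fderiv ℝ (fun x : Euc n => extY Φ (x, z.2)) z.1) z := by
        intro z hx ha
        refine ContDiffAt.fderiv (n := ∞) ?_ contDiffAt_fst (by simp)
        exact ContDiffAt.comp (f := fun q : (Euc n × ℝ × ℝ) × Euc n => (q.2, q.1.2))
          (z, z.1) (h.contDiffAt_extY (z := (z.1, z.2)) hx ha) (by fun_prop)
      have h2 : ContDiffAt ℝ ∞ (fun z : Euc n × ℝ × ℝ =>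
            fderiv ℝ (fun x : Euc n => fderiv ℝ (fun x : Euc n => extY Φ (x, z.2)) x) z.1) z := by
        refine ContDiffAt.fderiv (n := ∞) ?_ contDiffAt_fst (by simp)
        exact ContDiffAt.comp (f := fun q : (Euc n × ℝ × ℝ) × Euc n => (q.2, q.1.2))
          (z, z.1) (h1 (z.1, z.2) hx ha) (by fun_prop)
      exact (h2.clm_apply contDiffAt_const).clm_apply contDiffAt_const)
  refine (congrArg SmoothY ?_).mp key
  funext y
  simp [Ridgelet.lapY, sphereLaplacian, extY, toPos_coe]

lemma SmoothY.add {Φ Ψ : YSp n → ℂ} (h : SmoothY Φ) (h' : SmoothY Ψ) : SmoothY (Φ + Ψ) :=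
  ContMDiff.add h h'

lemma SmoothY.smul {Φ : YSp n → ℂ} (h : SmoothY Φ) (c : ℂ) : SmoothY (c • Φ) := by
  have hc : ContDiff ℝ ∞ (fun w : ℂ => c * w) := contDiff_const.mul contDiff_id
  exact hc.contMDiff.comp h

/-- An operator on functions on `𝕐^{n+1}` preserves smoothness and is linear on smooth functions. -/
structure GoodY (T : (YSp n → ℂ) → (YSp n → ℂ)) : Prop where
  smooth : ∀ {Φ}, SmoothY Φ → SmoothY (T Φ)
  add : ∀ {Φ Ψ}, SmoothY Φ → SmoothY Ψ → T (Φ + Ψ) = T Φ + T Ψ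
  smul : ∀ (c : ℂ) {Φ}, SmoothY Φ → T (c • Φ) = c • T Φ

lemma GoodY.comp {T T' : (YSp n → ℂ) → (YSp n → ℂ)} (h : GoodY T) (h' : GoodY T') :
    GoodY (fun Φ => T (T' Φ)) where
  smooth hΦ := h.smooth (h'.smooth hΦ)
  add hΦ hΨ := by rw [h'.add hΦ hΨ, h.add (h'.smooth hΦ) (h'.smooth hΨ)]
  smul c _ hΦ := by rw [h'.smul c hΦ, h.smul c (h'.smooth hΦ)]

lemma GoodY.iterate {T : (YSp n → ℂ) → (YSp n → ℂ)} (h : GoodY T) (k : ℕ) :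
    GoodY (T^[k]) := by
  induction k with
  | zero => exact ⟨fun h => h, fun _ _ => rfl, fun _ _ _ => rfl⟩
  | succ k ih => exact ih.comp h

lemma goodY_daY : GoodY (daY (n := n)) where
  smooth h := h.daY
  add {Φ Ψ} h h' := by
    have hd : ∀ {Φ : YSp n → ℂ}, SmoothY Φ → ∀ y : YSp n,
        DifferentiableAt ℝ (fun t : ℝ => Φ (y.1, y.2.1, toPos t)) (y.2.2 : ℝ) := by
      intro Φ h y
      have h1 : ContDiffAt ℝ ∞ (fun t : ℝ => extY Φ ((y.1 : Euc n), y.2.1, t)) (y.2.2 : ℝ) :=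
        ContDiffAt.comp (f := fun t : ℝ => ((y.1 : Euc n), y.2.1, t)) _
          (h.contDiffAt_extY (ne_zero_coe y.1) y.2.2.2) (by fun_prop)
      simpa [extY, radial_coe] using h1.differentiableAt (by simp)
    funext y
    exact deriv_add (hd h y) (hd h' y)
  smul c Φ _ := by
    funext y
    exact deriv_const_mul_field c

lemma goodY_dbY : GoodY (dbY (n := n)) where
  smooth h := h.dbY
  add {Φ Ψ} h h' := by
    have hd : ∀ {Φ : YSp n → ℂ}, SmoothY Φ → ∀ y : YSp n,
        DifferentiableAt ℝ (fun t : ℝ => Φ (y.1, t, y.2.2)) y.2.1 := by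
      intro Φ h y
      have h1 : ContDiffAt ℝ ∞ (fun t : ℝ => extY Φ ((y.1 : Euc n), t, (y.2.2 : ℝ))) y.2.1 :=
        ContDiffAt.comp (f := fun t : ℝ => ((y.1 : Euc n), t, (y.2.2 : ℝ))) _
          (h.contDiffAt_extY (ne_zero_coe y.1) y.2.2.2) (by fun_prop)
      simpa [extY, radial_coe, toPos_coe] using h1.differentiableAt (by simp)
    funext y
    exact deriv_add (hd h y) (hd h' y)
  smul c Φ _ := by
    funext y
    exact deriv_const_mul_field c

lemma SmoothY.contDiffAt_slice {Φ : YSp n → ℂ} (h : SmoothY Φ) (y : YSp n) :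
    ContDiffAt ℝ 2 (fun x : Euc n => Φ (radial x, y.2.1, y.2.2)) (y.1 : Euc n) := by
  have h1 : ContDiffAt ℝ ∞ (fun x : Euc n => extY Φ (x, y.2.1, (y.2.2 : ℝ))) (y.1 : Euc n) :=
    ContDiffAt.comp (f := fun x : Euc n => (x, y.2.1, (y.2.2 : ℝ))) _
      (h.contDiffAt_extY (ne_zero_coe y.1) y.2.2.2) (by fun_prop)
  have h2 : ContDiffAt ℝ ∞ (fun x : Euc n => Φ (radial x, y.2.1, y.2.2)) (y.1 : Euc n) := by
    simpa [extY, toPos_coe] using h1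
  exact h2.of_le (WithTop.coe_le_coe.2 le_top)

lemma goodY_lapY : GoodY (lapY (n := n)) where
  smooth h := h.lapY
  add {Φ Ψ} h h' := by
    funext y
    exact (h.contDiffAt_slice y).laplacian_add (h'.contDiffAt_slice y)
  smul c Φ h := by
    funext y
    exact InnerProductSpace.laplacian_smul c (h.contDiffAt_slice y)

lemma goodY_mixedY (l m k : ℕ) : GoodY (mixedY (n := n) l m k) :=
  (goodY_daY.iterate l).comp ((goodY_dbY.iterate m).comp (goodY_lapY.iterate k))

/-- Pull-back of a function on `𝕊^{n-1} × ℝ` to `𝕐^{n+1}`. -/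
def pullY (g : Cyl n → ℂ) : YSp n → ℂ := fun y => g (y.1, y.2.1)

lemma smoothY_pullY_iff {g : Cyl n → ℂ} : SmoothY (pullY g) ↔ SmoothCyl g := by
  constructor
  · intro h
    have h1 : ContMDiff ((𝓡 (n - 1)).prod 𝓘(ℝ, ℝ))
        ((𝓡 (n - 1)).prod (𝓘(ℝ, ℝ).prod 𝓘(ℝ, ℝ))) ∞
        (fun z : Cyl n => ((z.1, z.2, toPos 1) : YSp n)) :=
      contMDiff_fst.prodMk (contMDiff_snd.prodMk contMDiff_const)
    have h2 : ContMDiff ((𝓡 (n - 1)).prod (𝓘(ℝ, ℝ).prod 𝓘(ℝ, ℝ))) 𝓘(ℝ, ℂ) ∞ (pullY g) := h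
    exact h2.comp h1
  · intro h
    have h1 : ContMDiff ((𝓡 (n - 1)).prod (𝓘(ℝ, ℝ).prod 𝓘(ℝ, ℝ)))
        ((𝓡 (n - 1)).prod 𝓘(ℝ, ℝ)) ∞
        (fun y : YSp n => ((y.1, y.2.1) : Cyl n)) :=
      contMDiff_fst.prodMk (contMDiff_fst.comp contMDiff_snd)
    exact ContMDiff.comp h h1

lemma pullY_injective : Function.Injective (pullY (n := n)) := by
  intro g g' h
  funext z
  exact congrFun h (z.1, z.2, toPos 1)

lemma pullY_mixedCyl (q k : ℕ) (g : Cyl n → ℂ) :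
    pullY (mixedCyl q k g) = mixedY 0 q k (pullY g) := by
  have h1 : ∀ k : ℕ, ∀ g : Cyl n → ℂ, pullY (lapCyl^[k] g) = lapY^[k] (pullY g) := by
    intro k
    induction k with
    | zero => intro g; rfl
    | succ k ih => intro g; exact ih (lapCyl g)
  have h2 : ∀ q : ℕ, ∀ g : Cyl n → ℂ, pullY (dpCyl^[q] g) = dbY^[q] (pullY g) := by
    intro k
    induction k with
    | zero => intro g; rfl
    | succ k ih => intro g; exact ih (dpCyl g)
  rw [mixedCyl, mixedY, h2, h1]
  rfl

lemma SmoothCyl.mixedCyl {g : Cyl n → ℂ} (h : SmoothCyl g) (q k : ℕ) :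
    SmoothCyl (mixedCyl q k g) := by
  rw [← smoothY_pullY_iff, pullY_mixedCyl]
  exact (goodY_mixedY 0 q k).smooth (smoothY_pullY_iff.2 h)

lemma mixedCyl_add {g g' : Cyl n → ℂ} (h : SmoothCyl g) (h' : SmoothCyl g') (q k : ℕ) :
    mixedCyl q k (g + g') = mixedCyl q k g + mixedCyl q k g' := by
  apply pullY_injective
  have := (goodY_mixedY 0 q k).add (smoothY_pullY_iff.2 h) (smoothY_pullY_iff.2 h')
  rw [← pullY_mixedCyl q k g, ← pullY_mixedCyl q k g'] at this
  rw [pullY_mixedCyl]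
  exact this

lemma mixedCyl_smul {g : Cyl n → ℂ} (h : SmoothCyl g) (c : ℂ) (q k : ℕ) :
    mixedCyl q k (c • g) = c • mixedCyl q k g := by
  apply pullY_injective
  have := (goodY_mixedY 0 q k).smul c (smoothY_pullY_iff.2 h)
  rw [← pullY_mixedCyl q k g] at this
  rw [pullY_mixedCyl]
  exact this

lemma SmoothCyl.add {g g' : Cyl n → ℂ} (h : SmoothCyl g) (h' : SmoothCyl g') :
    SmoothCyl (g + g') :=
  ContMDiff.add h h'

lemma SmoothCyl.smul {g : Cyl n → ℂ} (h : SmoothCyl g) (c : ℂ) : SmoothCyl (c • g) := by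
  have hc : ContDiff ℝ ∞ (fun w : ℂ => c * w) := contDiff_const.mul contDiff_id
  exact hc.contMDiff.comp h

lemma weightY_nonneg (s r : ℕ) (y : YSp n) : 0 ≤ weightY s r y := by
  have h : 0 < (y.2.2 : ℝ) := y.2.2.2
  unfold weightY
  positivity

lemma weightCyl_nonneg (N : ℕ) (z : Cyl n) : 0 ≤ weightCyl N z := by
  unfold weightCyl
  positivity

/-! ### Weighted suprema -/

section Sup

variable {X : Type*} {w : X → ℝ}

/-- `sup_x w(x) |f(x)|`. -/
def wsup (w : X → ℝ) (f : X → ℂ) : ℝ := ⨆ x, w x * ‖f x‖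

/-- `sup_x w(x) |f(x)| < ∞`. -/
def WBdd (w : X → ℝ) (f : X → ℂ) : Prop := BddAbove (Set.range fun x => w x * ‖f x‖)

lemma WBdd.add {f g : X → ℂ} (hw : ∀ x, 0 ≤ w x) (hf : WBdd w f) (hg : WBdd w g) :
    WBdd w (f + g) := by
  obtain ⟨A, hA⟩ := hf
  obtain ⟨B, hB⟩ := hg
  refine ⟨A + B, ?_⟩
  rintro _ ⟨x, rfl⟩
  have h1 := hA ⟨x, rfl⟩
  have h2 := hB ⟨x, rfl⟩
  have h3 := mul_le_mul_of_nonneg_left (norm_add_le (f x) (g x)) (hw x)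
  simp only [Pi.add_apply] at *
  linarith

lemma WBdd.smul {f : X → ℂ} (hf : WBdd w f) (c : ℂ) : WBdd w (c • f) := by
  obtain ⟨A, hA⟩ := hf
  refine ⟨‖c‖ * A, ?_⟩
  rintro _ ⟨x, rfl⟩
  have h1 := mul_le_mul_of_nonneg_left (hA ⟨x, rfl⟩) (norm_nonneg c)
  simp only [Pi.smul_apply, norm_smul] at *
  linarith

lemma wsup_add_le {f g : X → ℂ} (hw : ∀ x, 0 ≤ w x) (hf : WBdd w f) (hg : WBdd w g) :
    wsup w (f + g) ≤ wsup w f + wsup w g := by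
  refine Real.iSup_le (fun x => ?_) (add_nonneg
    (Real.iSup_nonneg fun x => mul_nonneg (hw x) (norm_nonneg _))
    (Real.iSup_nonneg fun x => mul_nonneg (hw x) (norm_nonneg _)))
  have h1 : w x * ‖f x‖ ≤ wsup w f := le_ciSup hf x
  have h2 : w x * ‖g x‖ ≤ wsup w g := le_ciSup hg x
  have h3 := mul_le_mul_of_nonneg_left (norm_add_le (f x) (g x)) (hw x)
  simp only [Pi.add_apply]
  linarith

lemma wsup_smul (c : ℂ) (f : X → ℂ) : wsup w (c • f) = ‖c‖ * wsup w f := by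
  simp only [wsup, Pi.smul_apply, norm_smul]
  rw [Real.mul_iSup_of_nonneg (norm_nonneg c)]
  congr 1
  funext x
  ring

end Sup

/-! ### The space `𝒮(𝕐^{n+1})` -/

/-- The smooth functions on `𝕐^{n+1}` for which all the weighted suprema
`sup (a^s + a^{-s}) (1 + b²)^{r/2} |∂_a^l ∂_b^m Δ_u^k Φ(u, b, a)|` are finite. -/
def schwartzYSubmodule (n : ℕ) [n.AtLeastTwo] : Submodule ℂ (YSp n → ℂ) where
  carrier := {Φ | SmoothY Φ ∧ ∀ s r l m k : ℕ, WBdd (weightY s r) (mixedY l m k Φ)}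
  zero_mem' := by
    have h0 : SmoothY (0 : YSp n → ℂ) := contMDiff_const
    refine ⟨h0, fun s r l m k => ?_⟩
    have h1 := (goodY_mixedY l m k).smul 0 h0
    rw [zero_smul, zero_smul] at h1
    rw [h1]
    refine ⟨0, ?_⟩
    rintro _ ⟨x, rfl⟩
    simp
  add_mem' := by
    rintro Φ Ψ ⟨h1, h2⟩ ⟨h1', h2'⟩
    refine ⟨h1.add h1', fun s r l m k => ?_⟩
    rw [(goodY_mixedY l m k).add h1 h1']
    exact (h2 s r l m k).add (weightY_nonneg s r) (h2' s r l m k)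
  smul_mem' := by
    rintro c Φ ⟨h1, h2⟩
    refine ⟨h1.smul c, fun s r l m k => ?_⟩
    rw [(goodY_mixedY l m k).smul c h1]
    exact (h2 s r l m k).smul c

/-- The space `𝒮(𝕐^{n+1})`. -/
def SchwartzY (n : ℕ) [n.AtLeastTwo] : Type := schwartzYSubmodule n

namespace SchwartzY

instance : AddCommGroup (SchwartzY n) := inferInstanceAs (AddCommGroup (schwartzYSubmodule n))

instance : Module ℂ (SchwartzY n) := inferInstanceAs (Module ℂ (schwartzYSubmodule n))

instance : CoeFun (SchwartzY n) (fun _ => YSp n → ℂ) := ⟨fun Φ => Φ.1⟩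

/-- The seminorm
`ρ_{s,r}^{l,m,k}(Φ) = sup (a^s + a^{-s}) (1 + b²)^{r/2} |∂_a^l ∂_b^m Δ_u^k Φ(u, b, a)|`,
indexed by `(s, r, l, m, k)`. -/
def rho (i : ℕ × ℕ × ℕ × ℕ × ℕ) : Seminorm ℂ (SchwartzY n) :=
  Seminorm.of
    (fun Φ => wsup (weightY i.1 i.2.1) (mixedY i.2.2.1 i.2.2.2.1 i.2.2.2.2 (Φ : YSp n → ℂ)))
    (fun Φ Ψ => by
      have h := (goodY_mixedY (n := n) i.2.2.1 i.2.2.2.1 i.2.2.2.2).add Φ.2.1 Ψ.2.1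
      exact (congrArg (wsup _) h).le.trans
        (wsup_add_le (weightY_nonneg _ _) (Φ.2.2 _ _ _ _ _) (Ψ.2.2 _ _ _ _ _)))
    (fun c Φ => by
      have h := (goodY_mixedY (n := n) i.2.2.1 i.2.2.2.1 i.2.2.2.2).smul c Φ.2.1
      exact (congrArg (wsup _) h).trans (wsup_smul c _))

/-- The family of all the seminorms `ρ_{s,r}^{l,m,k}`. -/
def rhoFamily (n : ℕ) [n.AtLeastTwo] : SeminormFamily ℂ (SchwartzY n) (ℕ × ℕ × ℕ × ℕ × ℕ) := rho

/-- The locally convex topology defined by the seminorms `ρ_{s,r}^{l,m,k}`. -/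
instance : TopologicalSpace (SchwartzY n) := (rhoFamily n).moduleFilterBasis.topology'

lemma withSeminorms : WithSeminorms (rhoFamily n) := ⟨rfl⟩

end SchwartzY

/-! ### The space `𝒮(𝕊^{n-1} × ℝ)` -/

/-- The smooth functions on `𝕊^{n-1} × ℝ` for which all the weighted suprema
`sup (1 + |p|)^N |∂_p^q Δ_u^k g(u, p)|` are finite. -/
def schwartzCylSubmodule (n : ℕ) [n.AtLeastTwo] : Submodule ℂ (Cyl n → ℂ) where
  carrier := {g | SmoothCyl g ∧ ∀ N q k : ℕ, WBdd (weightCyl N) (mixedCyl q k g)}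
  zero_mem' := by
    have h0 : SmoothCyl (0 : Cyl n → ℂ) := contMDiff_const
    refine ⟨h0, fun N q k => ?_⟩
    have h1 := mixedCyl_smul h0 0 q k
    rw [zero_smul, zero_smul] at h1
    rw [h1]
    refine ⟨0, ?_⟩
    rintro _ ⟨x, rfl⟩
    simp
  add_mem' := by
    rintro g g' ⟨h1, h2⟩ ⟨h1', h2'⟩
    refine ⟨h1.add h1', fun N q k => ?_⟩
    rw [mixedCyl_add h1 h1']
    exact (h2 N q k).add (weightCyl_nonneg N) (h2' N q k)
  smul_mem' := by
    rintro c g ⟨h1, h2⟩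
    refine ⟨h1.smul c, fun N q k => ?_⟩
    rw [mixedCyl_smul h1 c]
    exact (h2 N q k).smul c

/-- The space `𝒮(𝕊^{n-1} × ℝ)`. -/
def SchwartzCyl (n : ℕ) [n.AtLeastTwo] : Type := schwartzCylSubmodule n

namespace SchwartzCyl

instance : AddCommGroup (SchwartzCyl n) :=
  inferInstanceAs (AddCommGroup (schwartzCylSubmodule n))

instance : Module ℂ (SchwartzCyl n) := inferInstanceAs (Module ℂ (schwartzCylSubmodule n))

instance : CoeFun (SchwartzCyl n) (fun _ => Cyl n → ℂ) := ⟨fun g => g.1⟩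

/-- The seminorm `sup (1 + |p|)^N |∂_p^q Δ_u^k g(u, p)|`, indexed by `(N, q, k)`. -/
def rho (i : ℕ × ℕ × ℕ) : Seminorm ℂ (SchwartzCyl n) :=
  Seminorm.of
    (fun g => wsup (weightCyl i.1) (mixedCyl i.2.1 i.2.2 (g : Cyl n → ℂ)))
    (fun g g' => by
      have h := mixedCyl_add g.2.1 g'.2.1 i.2.1 i.2.2
      exact (congrArg (wsup _) h).le.trans
        (wsup_add_le (weightCyl_nonneg _) (g.2.2 _ _ _) (g'.2.2 _ _ _)))
    (fun c g => by
      have h := mixedCyl_smul g.2.1 c i.2.1 i.2.2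
      exact (congrArg (wsup _) h).trans (wsup_smul c _))

/-- The family of all these seminorms. -/
def rhoFamily (n : ℕ) [n.AtLeastTwo] : SeminormFamily ℂ (SchwartzCyl n) (ℕ × ℕ × ℕ) := rho

/-- The locally convex topology defined by these seminorms. -/
instance : TopologicalSpace (SchwartzCyl n) := (rhoFamily n).moduleFilterBasis.topology'

lemma withSeminorms : WithSeminorms (rhoFamily n) := ⟨rfl⟩

lemma integrable_moment (g : SchwartzCyl n) (u : Sph n) (m : ℕ) :
    Integrable (fun p : ℝ => (p : ℂ) ^ m * g (u, p)) := by
  obtain ⟨C, hC⟩ := g.2.2 (m + 2) 0 0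
  have hcont : Continuous fun p : ℝ => (p : ℂ) ^ m * g (u, p) := by
    have h1 : Continuous (g : Cyl n → ℂ) := ContMDiff.continuous g.2.1
    fun_prop
  have hi : Integrable (fun p : ℝ => C * (1 + ‖p‖) ^ (-(2 : ℝ))) :=
    (integrable_one_add_norm (by simp)).const_mul C
  refine hi.mono' hcont.aestronglyMeasurable (Filter.Eventually.of_forall fun p => ?_)
  have h1 : (1 + |p|) ^ (m + 2) * ‖g (u, p)‖ ≤ C := hC ⟨(u, p), rfl⟩
  have h0 : (0 : ℝ) < 1 + |p| := by positivity
  have h2 : ‖(p : ℂ) ^ m * g (u, p)‖ ≤ (1 + |p|) ^ m * ‖g (u, p)‖ := by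
    rw [norm_mul, norm_pow, Complex.norm_real, Real.norm_eq_abs]
    gcongr
    linarith
  have h3 : (1 + ‖p‖) ^ (-(2 : ℝ)) = ((1 + |p|) ^ 2)⁻¹ := by
    rw [Real.norm_eq_abs, Real.rpow_neg h0.le]
    norm_cast
  rw [h3, ← div_eq_mul_inv, le_div_iff₀ (by positivity)]
  calc ‖(p : ℂ) ^ m * g (u, p)‖ * (1 + |p|) ^ 2
      ≤ (1 + |p|) ^ m * ‖g (u, p)‖ * (1 + |p|) ^ 2 := by gcongr
    _ = (1 + |p|) ^ (m + 2) * ‖g (u, p)‖ := by ring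
    _ ≤ C := h1

end SchwartzCyl

/-! ### The Lizorkin spaces `𝒮₀(ℝ)` and `𝒮₀(𝕊^{n-1} × ℝ)`, with the subspace topologies -/

lemma integrable_moment (φ : 𝓢(ℝ, ℂ)) (m : ℕ) : Integrable (fun x : ℝ => (x : ℂ) ^ m * φ x) := by
  have h := φ.integrable_pow_mul volume m
  refine h.mono' (by fun_prop) (Filter.Eventually.of_forall fun x => ?_)
  simp

/-- `𝒮₀(ℝ)`: the Schwartz functions on `ℝ` all of whose moments vanish. -/
def LizorkinR : Submodule ℂ 𝓢(ℝ, ℂ) where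
  carrier := {φ | ∀ m : ℕ, ∫ x : ℝ, (x : ℂ) ^ m * φ x = 0}
  zero_mem' := by intro m; simp
  add_mem' := by
    intro φ φ' h h' m
    have := integral_add (integrable_moment φ m) (integrable_moment φ' m)
    rw [h m, h' m, add_zero] at this
    simpa [mul_add] using this
  smul_mem' := by
    intro c φ h m
    have := integral_const_mul (μ := volume) c (fun x : ℝ => (x : ℂ) ^ m * φ x)
    rw [h m, mul_zero] at this
    simpa [mul_left_comm] using this

/-- `𝒮₀(𝕊^{n-1} × ℝ)`: the elements `g` of `𝒮(𝕊^{n-1} × ℝ)` such that all the moments of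
`p ↦ g (u, p)` vanish, for every `u`. -/
def LizorkinCyl (n : ℕ) [n.AtLeastTwo] : Submodule ℂ (SchwartzCyl n) where
  carrier := {g | ∀ (u : Sph n) (m : ℕ), ∫ p : ℝ, (p : ℂ) ^ m * g (u, p) = 0}
  zero_mem' := by
    intro u m
    have : ∀ p : ℝ, (p : ℂ) ^ m * (0 : SchwartzCyl n) (u, p) = 0 := fun p => mul_zero _
    simp [this]
  add_mem' := by
    intro g g' h h' u m
    have := integral_add (g.integrable_moment u m) (g'.integrable_moment u m)
    rw [h u m, h' u m, add_zero] at this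
    rw [← this]
    exact integral_congr_ae (Filter.Eventually.of_forall fun p => mul_add _ _ _)
  smul_mem' := by
    intro c g h u m
    have := integral_const_mul (μ := volume) c (fun p : ℝ => (p : ℂ) ^ m * g (u, p))
    rw [h u m, mul_zero] at this
    rw [← this]
    exact integral_congr_ae (Filter.Eventually.of_forall fun p => mul_left_comm _ _ _)

/-! ### The wavelet transform in the variable `p` and the wavelet synthesis operator -/

/-- The integrand of the wavelet transform: `(1/a) conj(ψ((p - b)/a)) g(u, p)`. -/
def waveletIntegrand (ψ : ℝ → ℂ) (g : Cyl n → ℂ) (u : Sph n) (b : ℝ) (a : posReal) (p : ℝ) : ℂ :=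
  (1 / ((a : ℝ) : ℂ)) * conj (ψ ((p - b) / (a : ℝ))) * g (u, p)

/-- `𝒲_ψ g(u, b, a) = ∫_ℝ (1/a) conj(ψ((p - b)/a)) g(u, p) dp`. -/
def waveletTransform (ψ : ℝ → ℂ) (g : Cyl n → ℂ) (u : Sph n) (b : ℝ) (a : posReal) : ℂ :=
  ∫ p : ℝ, waveletIntegrand ψ g u b a p

/-- The integrand of the wavelet synthesis operator with respect to `db da`, for `a > 0`:
`(1/a) ψ((p - b)/a) Φ(u, b, a) (1/a)`. -/
def synthesisIntegrand (ψ : ℝ → ℂ) (Φ : YSp n → ℂ) (u : Sph n) (p b a : ℝ) : ℂ :=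
  (1 / (a : ℂ)) * ψ ((p - b) / a) * Φ (u, b, toPos a) * (1 / (a : ℂ))

/-- `ℳ_ψ Φ(u, p) = ∫_0^∞ ∫_ℝ (1/a) ψ((p - b)/a) Φ(u, b, a) db da / a`. -/
def waveletSynthesis (ψ : ℝ → ℂ) (Φ : YSp n → ℂ) (u : Sph n) (p : ℝ) : ℂ :=
  ∫ a in Set.Ioi (0 : ℝ), ∫ b : ℝ, synthesisIntegrand ψ Φ u p b a

end Ridgelet

end

noncomputable section

set_option linter.unusedSectionVars false

namespace Ridgelet

/-! ### Interior derivative estimates for the Laplacian -/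

section Interior

open Filter Topology Metric

/-! The substitutions `p = b + a t` in 𝒲 and `b = p - a t` in ℳ give 𝒲(g, ψ)(u, b, a) = ∫ conj ψ(t)
g(u, b + a t) dt and ℳ(Φ, ψ)(u, p) = ∫∫ ψ(t) Φ(u, p - a t, a) dt da/a. Derivatives now fall on g and
Φ alone, except that ∂_a produces a factor t, which is absorbed into ψ. Hence each derivative of a
transform is again a transform (`BddCyl.mixedY_waveletFn`, `BddY.mixedCyl_synthesisFn`), and each
seminorm reduces to a bound for the size of one integral.

Size of 𝒲 (`weighted_norm_integral_affine_le`): for `a ≤ 1`, the vanishing moments of ψ allow the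
Taylor polynomial of g at b to be subtracted, which leaves a high power of a. For `a ≥ 1`, changing
variables back exchanges the roles of the two functions and replaces a by 1/a, so that the vanishing
moments of g give a high power of 1/a. These moments survive ∂_p and Δ_u (`IsLizorkinCyl.mixedCyl`).

Size of ℳ (`pow_mul_norm_synthesisKernel_le`): the weights in a and b on Φ, together with the decay
of ψ, dominate the kernel by an integrable function of (t, a), with every power of `1 + |p|` to
spare. A moment of ℳ(Φ, ψ) becomes, after Fubini and the binomial formula, a sum of terms that each
contain a moment of ψ, so it vanishes when ψ is in 𝒮₀(ℝ) (`moment_synthesisFn`).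

Differentiation under the integral is the delicate point: it needs bounds for all derivatives,
uniform over a noncompact range, while the seminorms only see powers of Δ_u. Elliptic regularity
supplies them. If G extends g to ℝⁿ × ℝ homogeneously of degree 0 in x, the full Laplacian of G is
the extension of Δ_u g divided by `‖x‖²`, plus the extension of ∂_p² g. Interior estimates for the
Laplacian, whose first-order case follows from the maximum principle
(`fderiv_apply_le_of_sqSum_le`), then bound all derivatives of G on an annulus by the suprema of
∂_p^q Δ_u^k g (`exists_norm_iteratedFDeriv_cylExt_le`).

Finally, the bounds are products of a continuous function of each argument that vanishes at 0, and
both maps are biadditive, which gives joint continuity (`continuous_of_biadditive_of_le`). -/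

/-- If `t ↦ f t - c t - κ t²` has a local maximum at `0`, then `f'' 0 ≤ 2 κ`. -/
lemma deriv_deriv_le_of_isLocalMax {f : ℝ → ℝ} (hf : ContDiffAt ℝ 2 f 0) {c κ : ℝ}
    (h : IsLocalMax (fun t => f t - c * t - κ * t ^ 2) 0) : deriv (deriv f) 0 ≤ 2 * κ := by
  set k : ℝ → ℝ := fun t => f t - c * t - κ * t ^ 2 with hk
  have hd : ∀ᶠ t in 𝓝 (0 : ℝ), DifferentiableAt ℝ f t :=
    (hf.eventually (by simp)).mono fun t ht => ht.differentiableAt (by simp)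
  have hk1 : deriv k =ᶠ[𝓝 0] fun t => deriv f t - c - κ * (2 * t) := by
    filter_upwards [hd] with t ht
    have := ((ht.hasDerivAt.sub ((hasDerivAt_id t).const_mul c)).sub
      ((hasDerivAt_pow 2 t).const_mul κ)).deriv
    refine (this : deriv k t = _).trans ?_
    simp
  have hdf : DifferentiableAt ℝ (deriv f) 0 := by
    have h1 : ContDiffAt ℝ 1 (fun t => fderiv ℝ f t 1) 0 :=
      (hf.fderiv_right (m := 1) (by norm_num)).clm_apply contDiffAt_const
    exact h1.differentiableAt (by simp)
  have hk2 : deriv (deriv k) 0 = deriv (deriv f) 0 - 2 * κ := by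
    rw [hk1.deriv_eq]
    have := ((hdf.hasDerivAt.sub_const c).sub
      (((hasDerivAt_id (0 : ℝ)).const_mul 2).const_mul κ)).deriv
    refine (this : deriv (fun t => deriv f t - c - κ * (2 * t)) 0 = _).trans ?_
    ring
  by_contra! hlt
  have hpos : 0 < deriv (deriv k) 0 := by rw [hk2]; linarith
  have hcont : ContinuousAt k 0 := by
    have := hf.continuousAt
    simp only [hk]
    fun_prop
  -- A positive second derivative at a critical point also makes 0 a local minimum. Then `k` is
  -- constant near 0, so its second derivative is zero after all.
  have hmin := isLocalMin_of_deriv_deriv_pos hpos h.deriv_eq_zero hcont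
  have hconst : k =ᶠ[𝓝 0] fun _ => k 0 := by
    filter_upwards [h, hmin] with t h1 h2
    exact le_antisymm h1 h2
  have h0 : deriv (deriv k) 0 = 0 := by
    rw [hconst.deriv.deriv_eq]
    simp
  linarith

variable {V F : Type*} [NormedAddCommGroup V] [NormedSpace ℝ V]
  [NormedAddCommGroup F] [NormedSpace ℝ F]

lemma contDiffAt_comp_line {n : WithTop ℕ∞} {u : V → F} {x : V} (hu : ContDiffAt ℝ n u x) (v : V) :
    ContDiffAt ℝ n (fun t : ℝ => u (x + t • v)) 0 := by
  refine ContDiffAt.comp (f := fun t : ℝ => x + t • v) 0 ?_ (by fun_prop)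
  simpa using hu

lemma deriv_deriv_comp_line {u : V → F} {x : V} (hu : ContDiffAt ℝ 2 u x) (v : V) :
    deriv (deriv fun t : ℝ => u (x + t • v)) 0 = fderiv ℝ (fderiv ℝ u) x v v := by
  have hline : ∀ t : ℝ, HasDerivAt (fun t : ℝ => x + t • v) v t := fun t => by
    simpa using ((hasDerivAt_id t).smul_const v).const_add x
  have hc : Tendsto (fun t : ℝ => x + t • v) (𝓝 0) (𝓝 x) := by
    have := (hline 0).continuousAt.tendsto
    simpa using this
  have h1 : deriv (fun t : ℝ => u (x + t • v)) =ᶠ[𝓝 0] fun t => fderiv ℝ u (x + t • v) v := by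
    filter_upwards [hc.eventually (hu.eventually (by simp))] with t ht
    exact ((ht.differentiableAt (by simp)).hasFDerivAt.comp_hasDerivAt t (hline t)).deriv
  rw [h1.deriv_eq]
  have h2 : DifferentiableAt ℝ (fderiv ℝ u) x :=
    (hu.fderiv_right (m := 1) (by norm_num)).differentiableAt (by simp)
  have h3 : HasDerivAt (fun t : ℝ => fderiv ℝ u (x + t • v)) (fderiv ℝ (fderiv ℝ u) x v) 0 :=
    h2.hasFDerivAt.comp_hasDerivAt_of_eq 0 (hline 0) (by simp)
  have h4 : HasDerivAt (fun t : ℝ => fderiv ℝ u (x + t • v) v) (fderiv ℝ (fderiv ℝ u) x v v) 0 :=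
    (ContinuousLinearMap.apply ℝ F v).hasFDerivAt.comp_hasDerivAt 0 h3
  exact h4.deriv

/-- The second-order operator `∑ ∂_{e i}²`. -/
def sqSum {ι : Type*} [Fintype ι] (e : ι → V) (G : V → F) (x : V) : F :=
  ∑ i, fderiv ℝ (fderiv ℝ G) x (e i) (e i)

lemma nonpos_of_hasDerivAt_of_forall_pos {k : ℝ → ℝ} {k' R : ℝ} (hR : 0 < R)
    (hk : HasDerivAt k k' 0) (h0 : k 0 = 0) (h : ∀ s, 0 < s → s < R → k s ≤ 0) : k' ≤ 0 := by
  have h1 := hasDerivAt_iff_tendsto_slope.1 hk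
  have h2 : Tendsto (slope k 0) (𝓝[>] 0) (𝓝 k') :=
    h1.mono_left (nhdsWithin_mono _ fun x hx => ne_of_gt hx)
  refine le_of_tendsto h2 ?_
  filter_upwards [Ioo_mem_nhdsGT hR] with s hs
  rw [slope_def_field, h0]
  have := h s hs.1 hs.2
  exact div_nonpos_of_nonpos_of_nonneg (by linarith) (by linarith [hs.1])

/-! ### The interior gradient estimate, by reflection and a quadratic barrier -/

section Inner

variable {W : Type*} [NormedAddCommGroup W] [InnerProductSpace ℝ W] [FiniteDimensional ℝ W]
  {ι : Type*} [Fintype ι]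

lemma sqSum_orthonormalBasis (b : OrthonormalBasis ι ℝ W) (u : W → F) (x : W) :
    sqSum b u x = Laplacian.laplacian u x := by
  rw [InnerProductSpace.laplacian_eq_iteratedFDeriv_orthonormalBasis u b]
  simp [sqSum, iteratedFDeriv_two_apply]

lemma deriv_deriv_sub_div_two {f g : ℝ → ℝ} (hf : ContDiffAt ℝ 2 f 0) (hg : ContDiffAt ℝ 2 g 0) :
    deriv (deriv fun t => (f t - g t) / 2) 0 = (deriv (deriv f) 0 - deriv (deriv g) 0) / 2 := by
  have e1 : deriv (fun t : ℝ => (f t - g t) / 2)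
      =ᶠ[𝓝 0] fun t => (deriv f t - deriv g t) / 2 := by
    filter_upwards [hf.eventually (by simp), hg.eventually (by simp)] with t h1 h2
    exact (((h1.differentiableAt (by simp)).hasDerivAt.sub
      (h2.differentiableAt (by simp)).hasDerivAt).div_const 2).deriv
  rw [e1.deriv_eq]
  have dd : ∀ {f : ℝ → ℝ}, ContDiffAt ℝ 2 f 0 → DifferentiableAt ℝ (deriv f) 0 := by
    intro f hf
    have h1 : ContDiffAt ℝ 1 (fun t => fderiv ℝ f t 1) 0 :=
      (hf.fderiv_right (m := 1) (by norm_num)).clm_apply contDiffAt_const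
    exact h1.differentiableAt (by simp)
  exact (((dd hf).hasDerivAt.sub (dd hg).hasDerivAt).div_const 2).deriv

set_option maxHeartbeats 1000000 in
-- Maximum principle on the half ball `K`. The part `φ` of `u` that is odd under the reflection in
-- the hyperplane orthogonal to `e` vanishes on the flat face and is at most `M` on the sphere. It
-- is compared there with a quadratic barrier `q`; both vanish at 0, so `φ ≤ q` along the ray `s •
-- e` compares their derivatives at 0, and that of `φ` is `fderiv ℝ u x₀ e`.
lemma fderiv_apply_le_of_sqSum_le (b : OrthonormalBasis ι ℝ W) {u : W → ℝ} {x₀ : W} {R M N : ℝ}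
    (hR : 0 < R) (hu : ∀ x ∈ closedBall x₀ R, ContDiffAt ℝ 2 u x)
    (hM : ∀ x ∈ closedBall x₀ R, |u x| ≤ M) (hN : ∀ x ∈ closedBall x₀ R, |sqSum b u x| < N)
    {e : W} (he : ‖e‖ = 1) :
    fderiv ℝ u x₀ e ≤ Fintype.card ι * M / R + N * R / 2 := by
  have hM0 : 0 ≤ M := (abs_nonneg _).trans (hM x₀ (by simp [hR.le]))
  have hN0 : 0 ≤ N := (abs_nonneg _).trans (hN x₀ (by simp [hR.le])).le
  set d : ℝ := (Fintype.card ι : ℝ) with hd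
  set σ : W ≃ₗᵢ[ℝ] W := (ℝ ∙ e)ᗮ.reflection with hσ
  have hσe : σ e = -e := Submodule.reflection_orthogonalComplement_singleton_eq_neg e
  have hσn : ∀ x : W, ‖σ x‖ = ‖x‖ := σ.norm_map
  let y : W → ℝ := fun x => inner ℝ e x
  -- On `K`, `q` is nonnegative, and `q ≥ M` where `‖x‖ = R`. The Laplacian of `‖x‖ ^ 2` is `2 d`
  -- and that of `y (R - y)` is `-2`, so the first group is harmonic and the Laplacian of `q` is
  -- exactly `-N`.
  let q : W → ℝ := fun x => M / R ^ 2 * (‖x‖ ^ 2 + d * (y x * (R - y x))) + N / 2 * (y x * (R - y x))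
  let φ : W → ℝ := fun x => (u (x₀ + x) - u (x₀ + σ x)) / 2
  have hy : Continuous y := by fun_prop
  have hq : Continuous q := by fun_prop
  have hφ : ContinuousOn φ (closedBall 0 R) := by
    intro x hx
    have hx' : ‖x‖ ≤ R := by simpa using hx
    have h1 : ContinuousAt u (x₀ + x) := (hu _ (by simpa using hx')).continuousAt
    have h2 : ContinuousAt u (x₀ + σ x) := (hu _ (by simpa [hσn] using hx')).continuousAt
    refine ContinuousAt.continuousWithinAt ?_
    refine ContinuousAt.div_const (ContinuousAt.sub ?_ ?_) _
    · exact ContinuousAt.comp (f := fun x => x₀ + x) h1 (by fun_prop)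
    · exact ContinuousAt.comp (f := fun x => x₀ + σ x) h2 (by fun_prop)
  let K : Set W := closedBall 0 R ∩ {x | 0 ≤ y x}
  have hK : IsCompact K :=
    (isCompact_closedBall 0 R).inter_right (isClosed_le continuous_const hy)
  have hK0 : (0 : W) ∈ K := ⟨by simp [hR.le], by simp [y]⟩
  have key : ∀ x ∈ K, φ x - q x ≤ 0 := by
    obtain ⟨x, hxK, hmax⟩ := hK.exists_isMaxOn ⟨0, hK0⟩
      (f := fun x => φ x - q x) ((hφ.mono Set.inter_subset_left).sub hq.continuousOn)
    intro z hz
    refine (hmax hz).trans ?_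
    change φ x - q x ≤ 0
    have hxR : ‖x‖ ≤ R := by simpa using hxK.1
    have hy0 : 0 ≤ y x := hxK.2
    have hyR : y x ≤ R := by
      have := real_inner_le_norm e x
      rw [he, one_mul] at this
      exact this.trans hxR
    have hyy : 0 ≤ y x * (R - y x) := mul_nonneg hy0 (by linarith)
    have hd0 : 0 ≤ d := Nat.cast_nonneg _
    by_cases hb : y x = 0
    · have hfix : σ x = x := by
        rw [hσ, Submodule.reflection_eq_self_iff, Submodule.mem_orthogonal_singleton_iff_inner_right]
        exact hb
      have h1 : φ x = 0 := by simp [φ, hfix]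
      have h2 : 0 ≤ q x := by positivity
      linarith
    by_cases hb' : ‖x‖ = R
    · have h1 : φ x ≤ M := by
        have e1 := (abs_le.1 (hM (x₀ + x) (by simpa using hxR))).2
        have e2 := (abs_le.1 (hM (x₀ + σ x) (by simpa [hσn] using hxR))).1
        simp only [φ]
        linarith
      have h2 : M ≤ q x := by
        have e1 : M / R ^ 2 * ‖x‖ ^ 2 = M := by rw [hb']; field_simp
        have e2 : 0 ≤ M / R ^ 2 * (d * (y x * (R - y x))) := by positivity
        have e3 : 0 ≤ N / 2 * (y x * (R - y x)) := by positivity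
        simp only [q]
        linarith
      linarith
    -- An interior maximum of `φ - q` bounds the second derivative of `φ` in each direction by that
    -- of `q`. Summing over the basis bounds the Laplacian of `φ` at the maximum by `-N`, whereas
    -- the strict bound `hN` makes it larger than `-N`.
    exfalso
    have hxK' : K ∈ 𝓝 x := by
      refine inter_mem ?_ ?_
      · exact mem_of_superset (isOpen_ball.mem_nhds
          (by simpa using lt_of_le_of_ne hxR hb')) ball_subset_closedBall
      · exact mem_of_superset ((isOpen_lt continuous_const hy).mem_nhds
          (lt_of_le_of_ne hy0 (Ne.symm hb))) fun z (hz : 0 < y z) => hz.le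
    have hloc : IsLocalMax (fun x => φ x - q x) x := hmax.isLocalMax hxK'
    have hu1 := hu (x₀ + x) (by simpa using hxR)
    have hu2 := hu (x₀ + σ x) (by simpa [hσn] using hxR)
    have hdir : ∀ v : W, (fderiv ℝ (fderiv ℝ u) (x₀ + x) v v
        - fderiv ℝ (fderiv ℝ u) (x₀ + σ x) (σ v) (σ v)) / 2
        ≤ 2 * (M / R ^ 2 * (‖v‖ ^ 2 - d * y v ^ 2) - N / 2 * y v ^ 2) := by
      intro v
      have c1 := contDiffAt_comp_line hu1 v
      have c2 := contDiffAt_comp_line hu2 (σ v)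
      have hdd : deriv (deriv fun t : ℝ => (u (x₀ + x + t • v) - u (x₀ + σ x + t • σ v)) / 2) 0
          = (fderiv ℝ (fderiv ℝ u) (x₀ + x) v v
            - fderiv ℝ (fderiv ℝ u) (x₀ + σ x) (σ v) (σ v)) / 2 := by
        rw [← deriv_deriv_comp_line hu1, ← deriv_deriv_comp_line hu2]
        exact deriv_deriv_sub_div_two c1 c2
      rw [← hdd]
      refine deriv_deriv_le_of_isLocalMax ((c1.sub c2).div_const 2)
        (c := M / R ^ 2 * (2 * inner ℝ x v + d * (y v * R - 2 * (y x * y v)))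
          + N / 2 * (y v * R - 2 * (y x * y v))) ?_
      have ht : Tendsto (fun t : ℝ => x + t • v) (𝓝 0) (𝓝 x) := by
        have : Continuous fun t : ℝ => x + t • v := by fun_prop
        simpa using this.tendsto 0
      have hq' : ∀ t : ℝ, q (x + t • v) = q x
          + (M / R ^ 2 * (2 * inner ℝ x v + d * (y v * R - 2 * (y x * y v)))
          + N / 2 * (y v * R - 2 * (y x * y v))) * t
          + (M / R ^ 2 * (‖v‖ ^ 2 - d * y v ^ 2) - N / 2 * y v ^ 2) * t ^ 2 := by
        intro t
        have e1 : y (x + t • v) = y x + t * y v := by simp [y, inner_add_right, inner_smul_right]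
        have e2 : ‖x + t • v‖ ^ 2 = ‖x‖ ^ 2 + 2 * t * inner ℝ x v + t ^ 2 * ‖v‖ ^ 2 := by
          rw [norm_add_sq_real, inner_smul_right, norm_smul, mul_pow, Real.norm_eq_abs, sq_abs]
          ring
        simp only [q, e1, e2]
        ring
      have := ht.eventually hloc
      filter_upwards [this] with t ht
      have h3 := hq' t
      simp only [φ, map_add, map_smul] at ht
      simp only [zero_smul, add_zero, mul_zero, sub_zero, ne_eq, OfNat.ofNat_ne_zero,
        not_false_eq_true, zero_pow, add_assoc] at ht ⊢
      rw [h3] at ht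
      linarith
    have hsum := Finset.sum_le_sum fun i (_ : i ∈ Finset.univ) => hdir (b i)
    -- The isometry `σ` carries `b` to another orthonormal basis, which yields the same Laplacian.
    have hs1 : ∑ i, (fderiv ℝ (fderiv ℝ u) (x₀ + x) (b i) (b i)
        - fderiv ℝ (fderiv ℝ u) (x₀ + σ x) (σ (b i)) (σ (b i))) / 2
        = (sqSum b u (x₀ + x) - sqSum b u (x₀ + σ x)) / 2 := by
      rw [← Finset.sum_div, Finset.sum_sub_distrib, sqSum_orthonormalBasis b u (x₀ + σ x),
        ← sqSum_orthonormalBasis (b.map σ)]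
      simp [sqSum]
    have hy2 : ∑ i, y (b i) ^ 2 = 1 := by
      have := b.sum_sq_norm_inner_left e
      simpa [he, y, Real.norm_eq_abs, sq_abs] using this
    have hn2 : ∑ i, ‖b i‖ ^ 2 = d := by simp [hd]
    have hs2 : ∑ i, 2 * (M / R ^ 2 * (‖b i‖ ^ 2 - d * y (b i) ^ 2) - N / 2 * y (b i) ^ 2)
        = -N := by
      rw [← Finset.mul_sum, Finset.sum_sub_distrib, ← Finset.mul_sum, ← Finset.mul_sum,
        Finset.sum_sub_distrib, ← Finset.mul_sum, hy2, hn2]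
      ring
    rw [hs1, hs2] at hsum
    have e1 := (abs_lt.1 (hN (x₀ + x) (by simpa using hxR))).1
    have e2 := (abs_lt.1 (hN (x₀ + σ x) (by simpa [hσn] using hxR))).2
    linarith
  have hline : HasDerivAt (fun s : ℝ => x₀ + s • e) e 0 := by
    simpa using ((hasDerivAt_id (0 : ℝ)).smul_const e).const_add x₀
  have hline' : HasDerivAt (fun s : ℝ => x₀ + σ (s • e)) (-e) 0 := by
    have := ((hasDerivAt_id (0 : ℝ)).smul_const (-e)).const_add x₀
    simpa [hσe] using this
  have hu0 : HasFDerivAt u (fderiv ℝ u x₀) x₀ :=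
    ((hu x₀ (by simp [hR.le])).differentiableAt (by simp)).hasFDerivAt
  have h1 : HasDerivAt (fun s : ℝ => φ (s • e)) (fderiv ℝ u x₀ e) 0 := by
    have a1 := HasFDerivAt.comp_hasDerivAt_of_eq (0 : ℝ) hu0 hline (by simp)
    have a2 := HasFDerivAt.comp_hasDerivAt_of_eq (0 : ℝ) hu0 hline' (by simp)
    refine ((a1.sub a2).div_const 2).congr_deriv ?_
    simp
  have hqe : ∀ s : ℝ, q (s • e) = M / R ^ 2 * (s ^ 2 + d * (s * (R - s))) + N / 2 * (s * (R - s)) := by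
    intro s
    have e1 : y (s • e) = s := by simp [y, inner_smul_right, he]
    simp only [q, e1, norm_smul, he, mul_one, Real.norm_eq_abs, sq_abs]
  have h2 : HasDerivAt (fun s : ℝ => q (s • e)) (M / R ^ 2 * (d * R) + N / 2 * R) 0 := by
    simp only [hqe]
    have hs := hasDerivAt_id (0 : ℝ)
    have hsR := hs.mul (hs.const_sub R)
    refine ((((hs.pow 2).add (hsR.const_mul d)).const_mul (M / R ^ 2)).add
      (hsR.const_mul (N / 2))).congr_deriv ?_
    simp
  have h3 := nonpos_of_hasDerivAt_of_forall_pos hR (h1.sub h2) (by simp [φ, hqe]) (by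
    intro s hs hsR
    refine key _ ⟨?_, ?_⟩
    · simpa [norm_smul, he, abs_of_pos hs] using hsR.le
    · simp [y, inner_smul_right, he, hs.le])
  have h4 : M / R ^ 2 * (d * R) = d * M / R := by field_simp
  linarith

/-- A norming functional of `fderiv ℝ u x₀ e` reduces this to the real-valued case. The strict bound
needed there holds for every `N' > N`, and `N'` then tends to `N`. -/
lemma norm_fderiv_apply_le_of_sqSum_le (b : OrthonormalBasis ι ℝ W) {u : W → F} {x₀ : W}
    {R M N : ℝ} (hR : 0 < R) (hu : ∀ x ∈ closedBall x₀ R, ContDiffAt ℝ 2 u x)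
    (hM : ∀ x ∈ closedBall x₀ R, ‖u x‖ ≤ M) (hN : ∀ x ∈ closedBall x₀ R, ‖sqSum b u x‖ ≤ N)
    {e : W} (he : ‖e‖ = 1) :
    ‖fderiv ℝ u x₀ e‖ ≤ Fintype.card ι * M / R + N * R / 2 := by
  obtain ⟨g, hg, hge⟩ := exists_dual_vector'' ℝ (fderiv ℝ u x₀ e)
  have hgle : ∀ w : F, |g w| ≤ ‖w‖ := fun w =>
    (g.le_opNorm w).trans (mul_le_of_le_one_left (norm_nonneg _) hg)
  have hlap : ∀ x ∈ closedBall x₀ R, sqSum b (fun x => g (u x)) x = g (sqSum b u x) := by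
    intro x hx
    rw [sqSum_orthonormalBasis, sqSum_orthonormalBasis]
    exact (hu x hx).laplacian_CLM_comp_left (l := g)
  have hfd : fderiv ℝ (fun x => g (u x)) x₀ e = ‖fderiv ℝ u x₀ e‖ := by
    have := (g.hasFDerivAt.comp x₀ ((hu x₀ (by simp [hR.le])).differentiableAt
      (by simp)).hasFDerivAt).fderiv
    have h2 : fderiv ℝ (fun x => g (u x)) x₀ = g.comp (fderiv ℝ u x₀) := this
    rw [h2]
    simpa using hge
  rw [← hfd]
  have main : ∀ N' > N, fderiv ℝ (fun x => g (u x)) x₀ e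
      ≤ Fintype.card ι * M / R + N' * R / 2 := by
    intro N' hN'
    refine fderiv_apply_le_of_sqSum_le b hR (fun x hx => ?_) (fun x hx => ?_) (fun x hx => ?_) he
    · exact g.contDiff.contDiffAt.comp x (hu x hx)
    · exact (hgle _).trans (hM x hx)
    · rw [hlap x hx]
      exact ((hgle _).trans (hN x hx)).trans_lt hN'
  have hcont : Tendsto (fun N' : ℝ => Fintype.card ι * M / R + N' * R / 2) (𝓝[>] N)
      (𝓝 (Fintype.card ι * M / R + N * R / 2)) := by
    have : Continuous (fun N' : ℝ => Fintype.card ι * M / R + N' * R / 2) := by fun_prop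
    exact (this.tendsto N).mono_left nhdsWithin_le_nhds
  exact ge_of_tendsto hcont (by filter_upwards [self_mem_nhdsWithin] with N' hN' using main N' hN')

end Inner

end Interior

/-! ### Interior estimates of every order for a sum of squares over a basis -/

section Interior

open Filter Topology Metric

/-- An affine substitution only changes the directions of differentiation. This one rule serves
translations, dilations, the shear, and the passage from an orthonormal basis to an arbitrary one.
-/
lemma sqSum_comp_add_right {V V' F ι : Type*} [NormedAddCommGroup V] [NormedSpace ℝ V]
    [NormedAddCommGroup V'] [NormedSpace ℝ V'] [NormedAddCommGroup F] [NormedSpace ℝ F] [Fintype ι]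
    (L : V' →L[ℝ] V) (c : V) {G : V → F} {w : V'} (hG : ContDiffAt ℝ 2 G (c + L w)) (e : ι → V') :
    sqSum e (fun w => G (c + L w)) w = sqSum (fun i => L (e i)) G (c + L w) := by
  have hc : ContDiffAt ℝ 2 (fun w => G (c + L w)) w :=
    ContDiffAt.comp (f := fun w => c + L w) w hG (by fun_prop)
  refine Finset.sum_congr rfl fun i _ => ?_
  rw [← deriv_deriv_comp_line hc, ← deriv_deriv_comp_line hG]
  simp [add_assoc]

variable {V : Type} [NormedAddCommGroup V] [NormedSpace ℝ V] {ι : Type} [Fintype ι]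

/-- The interior gradient estimate for `∑ ∂_{e i}²`, where `e` is a basis. -/
lemma exists_norm_fderiv_le (e : Module.Basis ι ℝ V) {ρ : ℝ} (hρ : 0 < ρ) :
    ∃ C : ℝ, 0 ≤ C ∧ ∀ (F : Type) [NormedAddCommGroup F] [NormedSpace ℝ F] (G : V → F) (x₀ : V)
      (A : ℝ), (∀ x ∈ closedBall x₀ ρ, ContDiffAt ℝ 2 G x) →
      (∀ x ∈ closedBall x₀ ρ, ‖G x‖ ≤ A) → (∀ x ∈ closedBall x₀ ρ, ‖sqSum e G x‖ ≤ A) →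
      ‖fderiv ℝ G x₀‖ ≤ C * A := by
  let b := EuclideanSpace.basisFun ι ℝ
  let L : EuclideanSpace ℝ ι →L[ℝ] V := LinearMap.toContinuousLinearMap
    ((b.toBasis.equiv e (Equiv.refl ι)).toLinearMap)
  have hLb : ∀ i, L (b i) = e i := by
    intro i
    have := b.toBasis.equiv_apply i e (Equiv.refl ι)
    simpa [L] using this
  -- This radius makes `L` map the ball of radius `R` into the ball of radius `ρ`; the `+ 1` avoids
  -- a division by zero.
  set R : ℝ := ρ / (‖L‖ + 1) with hRdef
  have hL0 : 0 < ‖L‖ + 1 := by positivity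
  have hR : 0 < R := by positivity
  set K : ℝ := Fintype.card ι / R + R / 2 with hK
  have hK0 : 0 ≤ K := by positivity
  refine ⟨Fintype.card ι * ‖e.equivFunL.toContinuousLinearMap‖ * K, by positivity, ?_⟩
  intro F _ _ G x₀ A hG hA hN
  have hA0 : 0 ≤ A := (norm_nonneg _).trans (hA x₀ (by simp [hρ.le]))
  have hmem : ∀ w ∈ closedBall (0 : EuclideanSpace ℝ ι) R, x₀ + L w ∈ closedBall x₀ ρ := by
    intro w hw
    have hw' : ‖w‖ ≤ R := by simpa using hw
    have : ‖L w‖ ≤ ρ := by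
      calc ‖L w‖ ≤ ‖L‖ * R := (L.le_opNorm w).trans (by gcongr)
        _ ≤ (‖L‖ + 1) * R := by gcongr; linarith
        _ = ρ := by rw [hRdef]; field_simp
    simpa using this
  have hcd : ∀ w ∈ closedBall (0 : EuclideanSpace ℝ ι) R,
      ContDiffAt ℝ 2 (fun w => G (x₀ + L w)) w := fun w hw =>
    ContDiffAt.comp (f := fun w => x₀ + L w) w (hG _ (hmem w hw)) (by fun_prop)
  have hbd : ∀ i, ‖fderiv ℝ G x₀ (e i)‖ ≤ K * A := by
    intro i
    have h1 := norm_fderiv_apply_le_of_sqSum_le b (x₀ := 0) (M := A) (N := A) hR hcd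
      (fun w hw => hA _ (hmem w hw))
      (fun w hw => by
        rw [sqSum_comp_add_right L x₀ (hG _ (hmem w hw))]
        simp only [hLb]
        exact hN _ (hmem w hw)) (e := b i) (by simp)
    have h2 : HasFDerivAt (fun w => x₀ + L w) L 0 := L.hasFDerivAt.const_add x₀
    have h3 : HasFDerivAt G (fderiv ℝ G x₀) (x₀ + L 0) := by
      simpa using ((hG x₀ (by simp [hρ.le])).differentiableAt (by simp)).hasFDerivAt
    have h4 : fderiv ℝ (fun w => G (x₀ + L w)) 0 = (fderiv ℝ G x₀).comp L := (h3.comp 0 h2).fderiv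
    rw [h4] at h1
    simp only [ContinuousLinearMap.comp_apply, hLb] at h1
    refine h1.trans (le_of_eq ?_)
    rw [hK]
    ring
  have := e.opNorm_le (by positivity) hbd
  refine this.trans (le_of_eq ?_)
  rw [nsmul_eq_mul]
  ring

lemma _root_.HasFDerivAt.apply_const {V F : Type*} [NormedAddCommGroup V] [NormedSpace ℝ V]
    [NormedAddCommGroup F] [NormedSpace ℝ F] {H : V → V →L[ℝ] F} {T : V →L[ℝ] V →L[ℝ] F} {x : V}
    (h : HasFDerivAt H T x) (a : V) :
    HasFDerivAt (fun y => H y a) ((ContinuousLinearMap.apply ℝ F a).comp T) x :=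
  (ContinuousLinearMap.apply ℝ F a).hasFDerivAt.comp x h

/-- Third derivatives are symmetric: in the first two slots by Schwarz's theorem for `fderiv ℝ G`,
in the last two by differentiating the symmetry of the second derivative of `G`, which holds near
`x`. -/
lemma sqSum_fderiv {F : Type*} [NormedAddCommGroup F] [NormedSpace ℝ F] (e : ι → V) {G : V → F}
    {x : V} (hG : ContDiffAt ℝ 3 G x) :
    sqSum e (fderiv ℝ G) x = fderiv ℝ (sqSum e G) x := by
  have h1 : ContDiffAt ℝ 2 (fderiv ℝ G) x := hG.fderiv_right (by norm_num)
  have h2 : ContDiffAt ℝ 1 (fderiv ℝ (fderiv ℝ G)) x := h1.fderiv_right (by norm_num)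
  have h3 : HasFDerivAt (fderiv ℝ (fderiv ℝ G)) (fderiv ℝ (fderiv ℝ (fderiv ℝ G)) x) x :=
    (h2.differentiableAt (by simp)).hasFDerivAt
  set T := fderiv ℝ (fderiv ℝ (fderiv ℝ G)) x with hT
  have s1 : ∀ a c v, T a c v = T c a v := fun a c v => by
    rw [(h1.isSymmSndFDerivAt (by simp)).eq a c]
  have happ : ∀ a c, HasFDerivAt (fun y => fderiv ℝ (fderiv ℝ G) y a c)
      ((ContinuousLinearMap.apply ℝ F c).comp ((ContinuousLinearMap.apply ℝ (V →L[ℝ] F) a).comp T))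
      x := fun a c => by
    exact HasFDerivAt.apply_const (HasFDerivAt.apply_const h3 a) c
  have s2 : ∀ v a c, T v a c = T v c a := by
    intro v a c
    have hev : (fun y => fderiv ℝ (fderiv ℝ G) y a c) =ᶠ[𝓝 x]
        fun y => fderiv ℝ (fderiv ℝ G) y c a := by
      filter_upwards [hG.eventually (by simp)] with y hy
      exact ((hy.of_le (by norm_num)).isSymmSndFDerivAt (n := 2) (by simp)).eq a c
    have e1 := (happ a c).fderiv
    rw [hev.fderiv_eq, (happ c a).fderiv] at e1
    exact (congrArg (fun φ => φ v) e1).symm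
  have hsum : HasFDerivAt (sqSum e G) (∑ i, (ContinuousLinearMap.apply ℝ F (e i)).comp
      ((ContinuousLinearMap.apply ℝ (V →L[ℝ] F) (e i)).comp T)) x :=
    HasFDerivAt.fun_sum fun i _ => happ (e i) (e i)
  rw [hsum.fderiv]
  ext v
  simp only [sqSum, sum_apply, ContinuousLinearMap.comp_apply,
    ContinuousLinearMap.apply_apply]
  refine Finset.sum_congr rfl fun i _ => ?_
  rw [← hT, s2 (e i), s1]

/-- Interior estimates for all derivatives. -/
lemma exists_norm_iteratedFDeriv_le (e : Module.Basis ι ℝ V) (m : ℕ) :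
    ∀ ρ : ℝ, 0 < ρ → ∃ C : ℝ, 0 ≤ C ∧
      ∀ (F : Type) [NormedAddCommGroup F] [NormedSpace ℝ F] (G : V → F) (x₀ : V) (A : ℝ),
      (∀ x ∈ closedBall x₀ ρ, ContDiffAt ℝ ∞ G x) → (∀ x ∈ closedBall x₀ ρ, ‖G x‖ ≤ A) →
      (∀ j < m, ∀ x ∈ closedBall x₀ ρ, ‖iteratedFDeriv ℝ j (sqSum e G) x‖ ≤ A) →
      ∀ j ≤ m, ‖iteratedFDeriv ℝ j G x₀‖ ≤ C * A := by
  induction m with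
  | zero =>
    intro ρ hρ
    refine ⟨1, zero_le_one, ?_⟩
    intro F _ _ G x₀ A _ hA _ j hj
    obtain rfl : j = 0 := by omega
    simpa using hA x₀ (by simp [hρ.le])
  | succ m ih =>
    intro ρ hρ
    obtain ⟨C₁, hC₁, h₁⟩ := exists_norm_fderiv_le e (half_pos hρ)
    obtain ⟨C₂, hC₂, h₂⟩ := ih (ρ / 2) (half_pos hρ)
    refine ⟨C₂ * (C₁ + 1) + 1, by positivity, ?_⟩
    intro F _ _ G x₀ A hG hA hN j hj
    have hA0 : 0 ≤ A := (norm_nonneg _).trans (hA x₀ (by simp [hρ.le]))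
    have hsub : ∀ y ∈ closedBall x₀ (ρ / 2), ∀ z ∈ closedBall y (ρ / 2), z ∈ closedBall x₀ ρ := by
      intro y hy z hz
      rw [mem_closedBall] at *
      linarith [dist_triangle z y x₀]
    have hsub' : ∀ y ∈ closedBall x₀ (ρ / 2), y ∈ closedBall x₀ ρ := fun y hy =>
      hsub y hy y (mem_closedBall_self (by positivity))
    rcases j with _ | j
    · have h0 := hA x₀ (by simp [hρ.le])
      have : 0 ≤ C₂ * (C₁ + 1) * A := by positivity
      rw [norm_iteratedFDeriv_zero]
      linarith
    · rw [← norm_iteratedFDeriv_fderiv]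
      have hle : A ≤ (C₁ + 1) * A := by nlinarith
      -- The induction hypothesis is applied to the derivative of `G`, whose Laplacian is the
      -- derivative of that of `G`. For this the estimate ranges over all targets `F : Type`, and
      -- `V` has to lie in `Type` as well. Halving the radius leaves room for the gradient estimate
      -- at every point of the smaller ball.
      have h3 := h₂ (V →L[ℝ] F) (fderiv ℝ G) x₀ ((C₁ + 1) * A)
        (fun y hy => (hG y (hsub' y hy)).fderiv_right (by simp))
        (fun y hy => by
          have := h₁ F G y A (fun z hz => (hG z (hsub y hy z hz)).of_le (WithTop.coe_le_coe.2 le_top))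
            (fun z hz => hA z (hsub y hy z hz)) (fun z hz => by
              simpa using hN 0 (by omega) z (hsub y hy z hz))
          linarith)
        (fun i hi y hy => by
          have hev : sqSum e (fderiv ℝ G) =ᶠ[𝓝 y] fderiv ℝ (sqSum e G) := by
            have h3 : ContDiffAt ℝ 3 G y := (hG y (hsub' y hy)).of_le (WithTop.coe_le_coe.2 le_top)
            filter_upwards [h3.eventually (by simp)] with z hz using sqSum_fderiv _ hz
          rw [(hev.iteratedFDeriv ℝ i).self_of_nhds, norm_iteratedFDeriv_fderiv]
          exact (hN (i + 1) (by omega) y (hsub' y hy)).trans hle) j (by omega)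
      refine h3.trans ?_
      nlinarith

end Interior

/-! ### Smooth integrals depending on a parameter -/

section Parametric

open Filter Topology

variable {V X E : Type*} [NormedAddCommGroup V] [NormedSpace ℝ V]
  [NormedAddCommGroup X] [NormedSpace ℝ X] [MeasurableSpace X]
  [NormedAddCommGroup E] [NormedSpace ℝ E]

/-- A function of `(x, t)` is smooth on `O × Y`, and each of its derivatives with respect to `x`
is dominated by a function of `t` that is integrable over `Y`. -/
structure DominatedSmooth (O : Set V) (Y : Set X) (μ : Measure X) (F : V → X → E) : Prop where
  smooth : ContDiffOn ℝ ∞ (fun z : V × X => F z.1 z.2) (O ×ˢ Y)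
  bound : ∀ j : ℕ, ∃ B : X → ℝ, IntegrableOn B Y μ ∧
    ∀ x ∈ O, ∀ t ∈ Y, ‖iteratedFDeriv ℝ j (fun x => F x t) x‖ ≤ B t

namespace DominatedSmooth

variable {O : Set V} {Y : Set X} {μ : Measure X} {F : V → X → E}

lemma contDiffAt (h : DominatedSmooth O Y μ F) (hO : IsOpen O) (hY : IsOpen Y) {x : V} (hx : x ∈ O)
    {t : X} (ht : t ∈ Y) : ContDiffAt ℝ ∞ (fun z : V × X => F z.1 z.2) (x, t) :=
  h.smooth.contDiffAt ((hO.prod hY).mem_nhds ⟨hx, ht⟩)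

lemma contDiffAt_left (h : DominatedSmooth O Y μ F) (hO : IsOpen O) (hY : IsOpen Y) {x : V}
    (hx : x ∈ O) {t : X} (ht : t ∈ Y) : ContDiffAt ℝ ∞ (fun x => F x t) x :=
  ContDiffAt.comp (f := fun x => (x, t)) x (h.contDiffAt hO hY hx ht) (by fun_prop)

/-- The majorant of order `j + 1` serves as that of order `j` for the derivative, so differentiation
under the integral can be iterated. -/
lemma fderiv (h : DominatedSmooth O Y μ F) (hO : IsOpen O) (hY : IsOpen Y) :
    DominatedSmooth O Y μ (fun x t => _root_.fderiv ℝ (fun x => F x t) x) where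
  smooth := by
    rintro ⟨x, t⟩ ⟨hx, ht⟩
    refine ContDiffAt.contDiffWithinAt ?_
    refine ContDiffAt.fderiv (n := ∞) (f := fun (z : V × X) x => F x z.2) (g := fun z => z.1)
      ?_ contDiffAt_fst (by simp)
    exact ContDiffAt.comp (f := fun q : (V × X) × V => (q.2, q.1.2)) ((x, t), x)
      (h.contDiffAt hO hY hx ht) (by fun_prop)
  bound j := by
    obtain ⟨B, hB, hB'⟩ := h.bound (j + 1)
    refine ⟨B, hB, fun x hx t ht => ?_⟩
    have := hB' x hx t ht
    rwa [← norm_iteratedFDeriv_fderiv] at this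

variable [OpensMeasurableSpace X] [SecondCountableTopology X]

lemma aestronglyMeasurable (h : DominatedSmooth O Y μ F) (hY : IsOpen Y) {x : V} (hx : x ∈ O) :
    AEStronglyMeasurable (F x) (μ.restrict Y) := by
  refine ContinuousOn.aestronglyMeasurable ?_ hY.measurableSet
  exact h.smooth.continuousOn.comp (f := fun t => (x, t)) (by fun_prop) fun t ht => ⟨hx, ht⟩

lemma integrableOn (h : DominatedSmooth O Y μ F) (hY : IsOpen Y) {x : V} (hx : x ∈ O) :
    IntegrableOn (F x) Y μ := by
  obtain ⟨B, hB, hB'⟩ := h.bound 0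
  refine Integrable.mono' hB (h.aestronglyMeasurable hY hx) ?_
  filter_upwards [ae_restrict_mem hY.measurableSet] with t ht
  simpa using hB' x hx t ht

lemma hasFDerivAt_integral (h : DominatedSmooth O Y μ F) (hO : IsOpen O) (hY : IsOpen Y) {x : V}
    (hx : x ∈ O) : HasFDerivAt (fun x => ∫ t in Y, F x t ∂μ)
      (∫ t in Y, _root_.fderiv ℝ (fun x => F x t) x ∂μ) x := by
  obtain ⟨B, hB, hB'⟩ := (h.fderiv hO hY).bound 0
  refine hasFDerivAt_integral_of_dominated_of_fderiv_le (hO.mem_nhds hx) (bound := B)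
    (F' := fun x t => _root_.fderiv ℝ (fun x => F x t) x)
    ?_ (h.integrableOn hY hx) ((h.fderiv hO hY).aestronglyMeasurable hY hx) ?_ hB ?_
  · filter_upwards [hO.mem_nhds hx] with y hy using h.aestronglyMeasurable hY hy
  · filter_upwards [ae_restrict_mem hY.measurableSet] with t ht y hy
    simpa using hB' y hy t ht
  · filter_upwards [ae_restrict_mem hY.measurableSet] with t ht y hy
    exact ((h.contDiffAt_left hO hY hy ht).differentiableAt (by simp)).hasFDerivAt

lemma fderiv_integral_apply [CompleteSpace E] (h : DominatedSmooth O Y μ F) (hO : IsOpen O)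
    (hY : IsOpen Y) {x : V} (hx : x ∈ O) (v : V) :
    _root_.fderiv ℝ (fun x => ∫ t in Y, F x t ∂μ) x v
      = ∫ t in Y, _root_.fderiv ℝ (fun x => F x t) x v ∂μ := by
  rw [(h.hasFDerivAt_integral hO hY hx).fderiv]
  exact ContinuousLinearMap.integral_apply ((h.fderiv hO hY).integrableOn hY hx) v

lemma sqSum_integral [CompleteSpace E] (h : DominatedSmooth O Y μ F) (hO : IsOpen O)
    (hY : IsOpen Y) {x : V} (hx : x ∈ O) {ι : Type*} [Fintype ι] (e : ι → V) :
    sqSum e (fun x => ∫ t in Y, F x t ∂μ) x = ∫ t in Y, sqSum e (fun x => F x t) x ∂μ := by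
  have h' := h.fderiv hO hY
  have h'' := h'.fderiv hO hY
  have hev : _root_.fderiv ℝ (fun x => ∫ t in Y, F x t ∂μ)
      =ᶠ[𝓝 x] fun x => ∫ t in Y, _root_.fderiv ℝ (fun x => F x t) x ∂μ := by
    filter_upwards [hO.mem_nhds hx] with y hy using (h.hasFDerivAt_integral hO hY hy).fderiv
  have hint : ∀ v, IntegrableOn
      (fun t => _root_.fderiv ℝ (_root_.fderiv ℝ (fun x => F x t)) x v) Y μ := fun v =>
    Integrable.apply_continuousLinearMap (h''.integrableOn hY hx) v
  have hint2 : ∀ v, IntegrableOn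
      (fun t => _root_.fderiv ℝ (_root_.fderiv ℝ (fun x => F x t)) x v v) Y μ := fun v =>
    Integrable.apply_continuousLinearMap (hint v) v
  simp only [sqSum]
  rw [integral_finsetSum _ fun i _ => hint2 (e i)]
  refine Finset.sum_congr rfl fun i _ => ?_
  rw [hev.fderiv_eq, h'.fderiv_integral_apply hO hY hx]
  exact ContinuousLinearMap.integral_apply (hint (e i)) (e i)

end DominatedSmooth

variable [OpensMeasurableSpace X] [SecondCountableTopology X]

/-- The derivative of the integral is the integral of the derivative, which is dominated in the same
sense. The target `E` varies in the induction, since it passes to `V →L[ℝ] E`. -/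
lemma DominatedSmooth.contDiffOn_integral_nat {V X : Type} [NormedAddCommGroup V] [NormedSpace ℝ V]
    [NormedAddCommGroup X] [NormedSpace ℝ X] [MeasurableSpace X]
    [OpensMeasurableSpace X] [SecondCountableTopology X] {O : Set V} {Y : Set X} {μ : Measure X}
    (hO : IsOpen O) (hY : IsOpen Y) (m : ℕ) :
    ∀ {E : Type} [NormedAddCommGroup E] [NormedSpace ℝ E] {F : V → X → E},
      DominatedSmooth O Y μ F → ContDiffOn ℝ m (fun x => ∫ t in Y, F x t ∂μ) O := by
  induction m with
  | zero =>
    intro E _ _ F h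
    exact contDiffOn_zero.2 fun x hx =>
      (h.hasFDerivAt_integral hO hY hx).continuousAt.continuousWithinAt
  | succ m ih =>
    intro E _ _ F h
    push_cast
    rw [contDiffOn_succ_iff_fderiv_of_isOpen hO]
    refine ⟨fun x hx => (h.hasFDerivAt_integral hO hY hx).differentiableAt.differentiableWithinAt,
      by simp, ?_⟩
    exact (ih (h.fderiv hO hY)).congr fun x hx => (h.hasFDerivAt_integral hO hY hx).fderiv

lemma DominatedSmooth.contDiffOn_integral {V X E : Type} [NormedAddCommGroup V] [NormedSpace ℝ V]
    [NormedAddCommGroup X] [NormedSpace ℝ X] [MeasurableSpace X]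
    [OpensMeasurableSpace X] [SecondCountableTopology X] [NormedAddCommGroup E] [NormedSpace ℝ E]
    {O : Set V} {Y : Set X} {μ : Measure X} {F : V → X → E}
    (h : DominatedSmooth O Y μ F) (hO : IsOpen O) (hY : IsOpen Y) :
    ContDiffOn ℝ ∞ (fun x => ∫ t in Y, F x t ∂μ) O :=
  contDiffOn_infty.2 fun m => contDiffOn_integral_nat hO hY m h

end Parametric

/-- Derivatives of the composition with a continuous linear map. -/
lemma norm_iteratedFDeriv_comp_clm_le {V V' F : Type*} [NormedAddCommGroup V] [NormedSpace ℝ V]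
    [NormedAddCommGroup V'] [NormedSpace ℝ V'] [NormedAddCommGroup F] [NormedSpace ℝ F]
    (L : V' →L[ℝ] V) {G : V → F} {U : Set V} (hU : IsOpen U) (hG : ContDiffOn ℝ ∞ G U) {x : V'}
    (hx : L x ∈ U) (j : ℕ) :
    ‖iteratedFDeriv ℝ j (fun x => G (L x)) x‖ ≤ ‖iteratedFDeriv ℝ j G (L x)‖ * ‖L‖ ^ j := by
  have hU' : IsOpen (L ⁻¹' U) := hU.preimage L.continuous
  have h1 := L.iteratedFDerivWithin_comp_right hG hU.uniqueDiffOn hU'.uniqueDiffOn hx (i := j)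
    (WithTop.coe_le_coe.2 le_top)
  rw [iteratedFDerivWithin_of_isOpen j hU' hx, iteratedFDerivWithin_of_isOpen j hU hx] at h1
  change ‖iteratedFDeriv ℝ j (G ∘ L) x‖ ≤ _
  rw [h1]
  refine (ContinuousMultilinearMap.norm_compContinuousLinearMap_le _ _).trans ?_
  simp

/-! ### Smooth functions on the cylinder and their extensions -/

section SqSum

open Filter Topology

variable {V F F' ι : Type*} [NormedAddCommGroup V] [NormedSpace ℝ V]
  [NormedAddCommGroup F] [NormedSpace ℝ F] [NormedAddCommGroup F'] [NormedSpace ℝ F'] [Fintype ι]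

lemma sqSum_congr {e : ι → V} {G G' : V → F} {x : V} (h : G =ᶠ[𝓝 x] G') :
    sqSum e G x = sqSum e G' x := by
  simp only [sqSum]
  rw [h.fderiv.fderiv_eq]

lemma sqSum_clm_comp {e : ι → V} {G : V → F} {x : V} (ℓ : F →L[ℝ] F') (hG : ContDiffAt ℝ 2 G x) :
    sqSum e (fun x => ℓ (G x)) x = ℓ (sqSum e G x) := by
  have hc : ContDiffAt ℝ 2 (fun x => ℓ (G x)) x := ℓ.contDiff.contDiffAt.comp x hG
  simp only [sqSum, map_sum]
  refine Finset.sum_congr rfl fun i _ => ?_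
  rw [← deriv_deriv_comp_line hc, ← deriv_deriv_comp_line hG]
  have h0 := contDiffAt_comp_line hG (e i)
  have h1 : deriv (fun t : ℝ => ℓ (G (x + t • e i)))
      =ᶠ[𝓝 0] fun t => ℓ (deriv (fun t : ℝ => G (x + t • e i)) t) := by
    filter_upwards [h0.eventually (by simp)] with t ht
    exact (ℓ.hasFDerivAt.comp_hasDerivAt t (ht.differentiableAt (by simp)).hasDerivAt).deriv
  rw [h1.deriv_eq]
  have h2 : DifferentiableAt ℝ (deriv fun t : ℝ => G (x + t • e i)) 0 := by
    have h1 : ContDiffAt ℝ 1 (fun s => fderiv ℝ (fun t : ℝ => G (x + t • e i)) s 1) 0 :=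
      (h0.fderiv_right (m := 1) (by norm_num)).clm_apply contDiffAt_const
    exact h1.differentiableAt (by simp)
  exact (ℓ.hasFDerivAt.comp_hasDerivAt 0 h2.hasDerivAt).deriv

end SqSum

open Filter Topology

variable {n : ℕ} [n.AtLeastTwo]

/-- The extension of a function on `𝕊^{n-1} × ℝ` that is homogeneous of degree `0` in the first
variable. -/
def cylExt (g : Cyl n → ℂ) (z : Euc n × ℝ) : ℂ := g (radial z.1, z.2)

lemma cylExt_coe (g : Cyl n → ℂ) (u : Sph n) (p : ℝ) : cylExt g ((u : Euc n), p) = g (u, p) := by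
  simp [cylExt, radial_coe]

lemma isOpen_fst_ne : IsOpen {z : Euc n × ℝ | z.1 ≠ 0} := isOpen_ne.preimage continuous_fst

lemma SmoothCyl.contDiffAt_cylExt {g : Cyl n → ℂ} (h : SmoothCyl g) {z : Euc n × ℝ}
    (hz : z.1 ≠ 0) : ContDiffAt ℝ ∞ (cylExt g) z :=
  ContDiffAt.comp (f := fun z : Euc n × ℝ => (z.1, z.2, (1 : ℝ))) z
    ((smoothY_pullY_iff.2 h).contDiffAt_extY (z := (z.1, z.2, 1)) hz one_pos) (by fun_prop)

lemma SmoothCyl.contDiffOn_cylExt {g : Cyl n → ℂ} (h : SmoothCyl g) :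
    ContDiffOn ℝ ∞ (cylExt g) {z | z.1 ≠ 0} :=
  fun _ hz => (h.contDiffAt_cylExt hz).contDiffWithinAt

lemma smoothCyl_of_contDiffAt {G : Euc n × ℝ → ℂ}
    (h : ∀ z : Euc n × ℝ, z.1 ≠ 0 → ContDiffAt ℝ ∞ G z) :
    SmoothCyl (fun z : Cyl n => G ((z.1 : Euc n), z.2)) := by
  rw [← smoothY_pullY_iff]
  exact smoothY_of_contDiffAt (G := fun z => G (z.1, z.2.1)) fun z hz _ =>
    ContDiffAt.comp (f := fun z : Euc n × ℝ × ℝ => (z.1, z.2.1)) z (h (z.1, z.2.1) hz)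
      (by fun_prop)

lemma SmoothCyl.dpCyl {g : Cyl n → ℂ} (h : SmoothCyl g) : SmoothCyl (dpCyl g) := h.mixedCyl 1 0

lemma SmoothCyl.lapCyl {g : Cyl n → ℂ} (h : SmoothCyl g) : SmoothCyl (lapCyl g) := h.mixedCyl 0 1

lemma radial_smul {c : ℝ} (hc : 0 < c) (x : Euc n) : radial (c • x) = radial x := by
  by_cases hx : x = 0
  · simp [hx]
  apply Subtype.ext
  have : c • x ≠ 0 := smul_ne_zero hc.ne' hx
  simp only [radial, hx, this, dif_neg, not_false_eq_true]
  rw [norm_smul, Real.norm_eq_abs, abs_of_pos hc, smul_smul]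
  congr 1
  field_simp

lemma coe_radial {x : Euc n} (hx : x ≠ 0) : (radial x : Euc n) = ‖x‖⁻¹ • x := by
  simp [radial, hx]

lemma SmoothCyl.hasDerivAt {g : Cyl n → ℂ} (h : SmoothCyl g) {z : Euc n × ℝ} (hz : z.1 ≠ 0) :
    HasDerivAt (fun t => g (radial z.1, t)) (fderiv ℝ (cylExt g) z (0, 1)) z.2 := by
  have h1 : HasDerivAt (fun t : ℝ => (z.1, t)) ((0, 1) : Euc n × ℝ) z.2 :=
    (hasDerivAt_const _ _).prodMk (hasDerivAt_id _)
  exact (((h.contDiffAt_cylExt hz).differentiableAt (by simp)).hasFDerivAt).comp_hasDerivAt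
    (f := fun t : ℝ => (z.1, t)) z.2 h1

lemma cylExt_dpCyl {g : Cyl n → ℂ} (h : SmoothCyl g) {z : Euc n × ℝ} (hz : z.1 ≠ 0) :
    cylExt (dpCyl g) z = fderiv ℝ (cylExt g) z (0, 1) :=
  (h.hasDerivAt hz).deriv

lemma cylExt_dpCyl_dpCyl {g : Cyl n → ℂ} (h : SmoothCyl g) {z : Euc n × ℝ} (hz : z.1 ≠ 0) :
    cylExt (dpCyl (dpCyl g)) z = fderiv ℝ (fderiv ℝ (cylExt g)) z (0, 1) (0, 1) := by
  rw [cylExt_dpCyl h.dpCyl hz]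
  have hev : cylExt (dpCyl g) =ᶠ[𝓝 z] fun z => fderiv ℝ (cylExt g) z (0, 1) := by
    filter_upwards [isOpen_fst_ne.mem_nhds hz] with y hy using cylExt_dpCyl h hy
  rw [hev.fderiv_eq]
  have h1 : DifferentiableAt ℝ (fderiv ℝ (cylExt g)) z :=
    (((h.contDiffAt_cylExt hz).of_le (WithTop.coe_le_coe.2 le_top)).fderiv_right (m := 1) (n := 2)
      (by norm_num)).differentiableAt (by simp)
  rw [(h1.hasFDerivAt.apply_const (0, 1)).fderiv]
  rfl

/-- The horizontal directions in `ℝⁿ × ℝ`. -/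
def horizontal (i : Fin n) : Euc n × ℝ := (EuclideanSpace.basisFun (Fin n) ℝ i, 0)

/-- The Laplacian of a function homogeneous of degree 0 is homogeneous of degree -2, and at `x /
‖x‖` it is the Laplace–Beltrami operator by definition. The code compares `f` with its composition
with the dilation by `‖x‖⁻¹`. -/
lemma sqSum_horizontal_cylExt {g : Cyl n → ℂ} (h : SmoothCyl g) {z : Euc n × ℝ} (hz : z.1 ≠ 0) :
    sqSum horizontal (cylExt g) z = (‖z.1‖ ^ 2)⁻¹ • cylExt (lapCyl g) z := by
  obtain ⟨x, p⟩ := z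
  change x ≠ 0 at hz
  set b := EuclideanSpace.basisFun (Fin n) ℝ
  set f : Euc n → ℂ := fun w => g (radial w, p) with hf
  have hsm : ∀ w : Euc n, w ≠ 0 → ContDiffAt ℝ 2 f w := fun w hw =>
    ContDiffAt.comp (f := fun w : Euc n => (w, p)) w
      ((h.contDiffAt_cylExt (z := (w, p)) hw).of_le (WithTop.coe_le_coe.2 le_top)) (by fun_prop)
  have e1 : sqSum horizontal (cylExt g) (x, p) = sqSum b f x := by
    have h2 : ContDiffAt ℝ 2 (cylExt g) ((0, p) + ContinuousLinearMap.inl ℝ (Euc n) ℝ x) :=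
      (h.contDiffAt_cylExt (by simpa using hz)).of_le (WithTop.coe_le_coe.2 le_top)
    have := sqSum_comp_add_right (ContinuousLinearMap.inl ℝ (Euc n) ℝ) (0, p) h2 b
    simp only [ContinuousLinearMap.inl_apply, Prod.mk_add_mk, zero_add, add_zero] at this
    exact this.symm
  have hc : 0 < ‖x‖⁻¹ := inv_pos.2 (norm_pos_iff.2 hz)
  have e2 : sqSum b f x = (‖x‖ ^ 2)⁻¹ • sqSum b f (‖x‖⁻¹ • x) := by
    have h2 : ContDiffAt ℝ 2 f (0 + (‖x‖⁻¹ • ContinuousLinearMap.id ℝ (Euc n)) x) :=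
      hsm _ (by simpa using hz)
    have := sqSum_comp_add_right (‖x‖⁻¹ • ContinuousLinearMap.id ℝ (Euc n)) 0 h2 b
    simp only [zero_add, _root_.smul_apply, ContinuousLinearMap.id_apply, hf,
      radial_smul hc] at this
    rw [hf, this]
    simp only [sqSum, Finset.smul_sum, map_smul, _root_.smul_apply, smul_smul]
    refine Finset.sum_congr rfl fun i _ => ?_
    congr 1
    ring
  rw [e1, e2, sqSum_orthonormalBasis, ← coe_radial hz]
  rfl

lemma lapCyl_eq_sqSum {g : Cyl n → ℂ} (h : SmoothCyl g) (u : Sph n) (p : ℝ) :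
    lapCyl g (u, p) = sqSum horizontal (cylExt g) ((u : Euc n), p) := by
  rw [sqSum_horizontal_cylExt h (ne_zero_coe u)]
  simp [cylExt_coe]

/-- On the extension both operators have constant coefficients near the sphere and therefore
commute. The factor `(‖z.1‖ ^ 2)⁻¹` does not depend on `p` and equals 1 on the sphere. -/
lemma lapCyl_dpCyl {g : Cyl n → ℂ} (h : SmoothCyl g) : lapCyl (dpCyl g) = dpCyl (lapCyl g) := by
  funext ⟨u, p⟩
  have hz : (((u : Euc n), p) : Euc n × ℝ).1 ≠ 0 := ne_zero_coe u
  have hnear := isOpen_fst_ne.mem_nhds hz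
  have hsm := h.contDiffAt_cylExt hz
  have hev : cylExt (dpCyl g) =ᶠ[𝓝 ((u : Euc n), p)]
      fun z => ContinuousLinearMap.apply ℝ ℂ ((0, 1) : Euc n × ℝ) (fderiv ℝ (cylExt g) z) := by
    filter_upwards [hnear] with y hy using cylExt_dpCyl h hy
  rw [lapCyl_eq_sqSum h.dpCyl, sqSum_congr hev,
    sqSum_clm_comp _ ((hsm.of_le (WithTop.coe_le_coe.2 le_top)).fderiv_right (m := 2) (n := 3)
      (by norm_num)),
    sqSum_fderiv _ (hsm.of_le (WithTop.coe_le_coe.2 le_top))]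
  have hev2 : sqSum horizontal (cylExt g) =ᶠ[𝓝 ((u : Euc n), p)]
      fun z => (‖z.1‖ ^ 2)⁻¹ • cylExt (lapCyl g) z := by
    filter_upwards [hnear] with y hy using sqSum_horizontal_cylExt h hy
  rw [hev2.fderiv_eq]
  have hd : DifferentiableAt ℝ (fun z : Euc n × ℝ => (‖z.1‖ ^ 2)⁻¹ • cylExt (lapCyl g) z)
      ((u : Euc n), p) := by
    have h1 : DifferentiableAt ℝ (cylExt (lapCyl g)) ((u : Euc n), p) :=
      (h.lapCyl.contDiffAt_cylExt hz).differentiableAt (by simp)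
    have h2 : DifferentiableAt ℝ (fun z : Euc n × ℝ => (‖z.1‖ ^ 2)⁻¹) ((u : Euc n), p) := by
      refine DifferentiableAt.inv ?_ (by simp)
      exact (differentiableAt_fst (𝕜 := ℝ)).norm_sq ℝ
    exact h2.smul h1
  have hl : HasDerivAt (fun t : ℝ => ((u : Euc n), t)) ((0, 1) : Euc n × ℝ) p :=
    (hasDerivAt_const _ _).prodMk (hasDerivAt_id _)
  have := (hd.hasFDerivAt.comp_hasDerivAt (f := fun t : ℝ => ((u : Euc n), t)) p hl).deriv
  refine Eq.trans this.symm ?_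
  simp [Function.comp_def, dpCyl, cylExt_coe]

lemma lapCyl_iterate_dpCyl {g : Cyl n → ℂ} (h : SmoothCyl g) (k : ℕ) :
    lapCyl^[k] (dpCyl g) = dpCyl (lapCyl^[k] g) := by
  induction k generalizing g with
  | zero => rfl
  | succ k ih =>
    rw [Function.iterate_succ_apply, Function.iterate_succ_apply, lapCyl_dpCyl h, ih h.lapCyl]

lemma mixedCyl_dpCyl {g : Cyl n → ℂ} (h : SmoothCyl g) (q k : ℕ) :
    mixedCyl q k (dpCyl g) = mixedCyl (q + 1) k g := by
  rw [mixedCyl, mixedCyl, lapCyl_iterate_dpCyl h, Function.iterate_succ_apply]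

lemma mixedCyl_lapCyl (g : Cyl n → ℂ) (q k : ℕ) :
    mixedCyl q k (lapCyl g) = mixedCyl q (k + 1) g := rfl

/-- The standard basis of `ℝⁿ × ℝ`. -/
def cylBasis (n : ℕ) : Module.Basis (Fin n ⊕ Unit) ℝ (Euc n × ℝ) :=
  (EuclideanSpace.basisFun (Fin n) ℝ).toBasis.prod (Module.Basis.singleton Unit ℝ)

/-- The link between the seminorms and elliptic regularity: the full Laplacian of the extension only
involves Δ_u g and ∂_p² g. -/
lemma sqSum_cylBasis_cylExt {g : Cyl n → ℂ} (h : SmoothCyl g) {z : Euc n × ℝ} (hz : z.1 ≠ 0) :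
    sqSum (cylBasis n) (cylExt g) z
      = (‖z.1‖ ^ 2)⁻¹ • cylExt (lapCyl g) z + cylExt (dpCyl (dpCyl g)) z := by
  rw [← sqSum_horizontal_cylExt h hz, cylExt_dpCyl_dpCyl h hz]
  simp only [sqSum, Fintype.sum_sum_type, Finset.univ_unique, Finset.sum_singleton]
  congr 1
  · refine Finset.sum_congr rfl fun i _ => ?_
    simp [cylBasis, horizontal, Module.Basis.prod_apply]
  · simp [cylBasis, Module.Basis.prod_apply]

/-- The derivatives of `‖z.1‖⁻²` on `ℝⁿ × ℝ` are bounded for `z.1` in a fixed annulus. -/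
lemma exists_norm_iteratedFDeriv_inv_norm_sq_le (n : ℕ) [n.AtLeastTwo] (m : ℕ) {r R : ℝ}
    (hr : 0 < r) : ∃ H : ℝ, 0 ≤ H ∧ ∀ z : Euc n × ℝ, r ≤ ‖z.1‖ → ‖z.1‖ ≤ R → ∀ j ≤ m,
      ‖iteratedFDeriv ℝ j (fun z : Euc n × ℝ => (‖z.1‖ ^ 2)⁻¹) z‖ ≤ H := by
  have hsm : ∀ x : Euc n, x ≠ 0 → ContDiffAt ℝ ∞ (fun x : Euc n => (‖x‖ ^ 2)⁻¹) x := fun x hx =>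
    ((contDiff_norm_sq ℝ).contDiffAt).inv (by simpa using hx)
  have hK : IsCompact (Metric.closedBall (0 : Euc n) R ∩ {x | r ≤ ‖x‖}) :=
    (isCompact_closedBall 0 R).inter_right (isClosed_le continuous_const continuous_norm)
  have hne : ∀ x : Euc n, r ≤ ‖x‖ → x ≠ 0 := fun x hx => norm_pos_iff.1 (hr.trans_le hx)
  have hj : ∀ j : ℕ, ∃ H : ℝ, ∀ x ∈ Metric.closedBall (0 : Euc n) R ∩ {x | r ≤ ‖x‖},
      ‖iteratedFDeriv ℝ j (fun x : Euc n => (‖x‖ ^ 2)⁻¹) x‖ ≤ H := fun j =>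
    hK.exists_bound_of_continuousOn fun x hx =>
      ((hsm x (hne x hx.2)).continuousAt_iteratedFDeriv
        (WithTop.coe_le_coe.2 le_top)).continuousWithinAt
  choose H hH using hj
  refine ⟨∑ j ∈ Finset.range (m + 1), |H j|, by positivity, fun z hz1 hz2 j hjm => ?_⟩
  have h1 := norm_iteratedFDeriv_comp_clm_le (ContinuousLinearMap.fst ℝ (Euc n) ℝ)
    (G := fun x : Euc n => (‖x‖ ^ 2)⁻¹) (U := {x | x ≠ 0}) isOpen_ne
    (fun x hx => (hsm x hx).contDiffWithinAt) (x := z) (hne _ hz1) j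
  have h2 := hH j z.1 ⟨by simpa using hz2, hz1⟩
  have h3 : ‖ContinuousLinearMap.fst ℝ (Euc n) ℝ‖ ^ j ≤ 1 :=
    pow_le_one₀ (norm_nonneg _) (ContinuousLinearMap.norm_fst_le ℝ (Euc n) ℝ)
  calc _ ≤ _ := h1
    _ ≤ ‖iteratedFDeriv ℝ j (fun x : Euc n => (‖x‖ ^ 2)⁻¹) z.1‖ :=
      mul_le_of_le_one_right (norm_nonneg _) h3
    _ ≤ |H j| := h2.trans (le_abs_self _)
    _ ≤ _ := Finset.single_le_sum (f := fun j => |H j|) (fun i _ => abs_nonneg _)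
      (Finset.mem_range.2 (by omega))

/-- All the derivatives of the extension of `g` are controlled by the suprema of
`∂_p^q Δ_u^k g`. -/
lemma exists_norm_iteratedFDeriv_cylExt_le (n : ℕ) [n.AtLeastTwo] (m : ℕ) :
    ∀ r R : ℝ, 0 < r → ∃ C : ℝ, 0 ≤ C ∧ ∀ (g : Cyl n → ℂ) (A : ℝ), SmoothCyl g →
      (∀ q ≤ 2 * m, ∀ k ≤ m, ∀ z, ‖mixedCyl q k g z‖ ≤ A) →
      ∀ z : Euc n × ℝ, r ≤ ‖z.1‖ → ‖z.1‖ ≤ R → ∀ j ≤ m,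
        ‖iteratedFDeriv ℝ j (cylExt g) z‖ ≤ C * A := by
  induction m with
  | zero =>
    intro r R _
    refine ⟨1, zero_le_one, ?_⟩
    intro g A _ hA z _ _ j hj
    obtain rfl : j = 0 := by omega
    simpa using! hA 0 le_rfl 0 le_rfl (radial z.1, z.2)
  | succ m ih =>
    intro r R hr
    -- On the ball of radius `r / 2` around `z`, the first component stays in this larger annulus
    -- and away from 0.
    obtain ⟨C₁, hC₁, h₁⟩ := ih (r / 2) (R + r / 2) (half_pos hr)
    obtain ⟨C₂, hC₂, h₂⟩ := exists_norm_iteratedFDeriv_le (cylBasis n) (m + 1) (r / 2) (half_pos hr)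
    obtain ⟨H, hH, hH'⟩ := exists_norm_iteratedFDeriv_inv_norm_sq_le n m (R := R + r / 2)
      (half_pos hr)
    refine ⟨C₂ * (2 ^ m * H * C₁ + C₁ + 1), by positivity, ?_⟩
    intro g A hg hA z hz1 hz2 j hj
    have hA0 : 0 ≤ A := (norm_nonneg _).trans
      (hA 0 (by omega) 0 (by omega) (radial z.1, z.2))
    have hball : ∀ y ∈ Metric.closedBall z (r / 2), r / 2 ≤ ‖y.1‖ ∧ ‖y.1‖ ≤ R + r / 2 := by
      intro y hy
      have h1 : ‖y.1 - z.1‖ ≤ r / 2 :=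
        (norm_fst_le (y - z)).trans (by simpa [dist_eq_norm] using hy)
      have h2 := norm_sub_norm_le z.1 y.1
      have h3 := norm_sub_norm_le y.1 z.1
      rw [norm_sub_rev] at h2
      constructor <;> linarith
    have hne : ∀ y ∈ Metric.closedBall z (r / 2), y.1 ≠ 0 := fun y hy =>
      norm_pos_iff.1 ((half_pos hr).trans_le (hball y hy).1)
    -- One more order of differentiation costs one factor Δ_u or two factors ∂_p, whence the ranges
    -- `k ≤ m` and `q ≤ 2 * m`.
    have hlap := h₁ (lapCyl g) A hg.lapCyl (fun q hq k hk => by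
      rw [mixedCyl_lapCyl]
      exact hA q (by omega) (k + 1) (by omega))
    have hdp := h₁ (dpCyl (dpCyl g)) A hg.dpCyl.dpCyl (fun q hq k hk => by
      rw [mixedCyl_dpCyl hg.dpCyl, mixedCyl_dpCyl hg]
      exact hA (q + 1 + 1) (by omega) k (by omega))
    have hcA : 0 ≤ 2 ^ m * H * C₁ * A + C₁ * A := by positivity
    rw [mul_assoc]
    refine h₂ ℂ (cylExt g) z _ (fun y hy => hg.contDiffAt_cylExt (hne y hy)) (fun y hy => ?_)
      (fun i hi y hy => ?_) j hj
    · have : ‖cylExt g y‖ ≤ A := hA 0 (by omega) 0 (by omega) (radial y.1, y.2)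
      linarith
    · have him : i ≤ m := by omega
      have hyne := hne y hy
      have hev : sqSum (cylBasis n) (cylExt g) =ᶠ[𝓝 y]
          (fun z => (‖z.1‖ ^ 2)⁻¹ • cylExt (lapCyl g) z) + cylExt (dpCyl (dpCyl g)) := by
        filter_upwards [isOpen_fst_ne.mem_nhds hyne] with w hw using sqSum_cylBasis_cylExt hg hw
      have hinv : ContDiffOn ℝ ∞ (fun z : Euc n × ℝ => (‖z.1‖ ^ 2)⁻¹) {z | z.1 ≠ 0} := by
        intro w hw
        refine ContDiffAt.contDiffWithinAt (ContDiffAt.inv ?_ (by simpa using hw))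
        exact (contDiff_fst.norm_sq ℝ).contDiffAt
      have hprod : ContDiffOn ℝ ∞ (fun z : Euc n × ℝ => (‖z.1‖ ^ 2)⁻¹ • cylExt (lapCyl g) z)
          {z | z.1 ≠ 0} := hinv.smul hg.lapCyl.contDiffOn_cylExt
      have hnhds := isOpen_fst_ne.mem_nhds hyne
      have hi' : (i : WithTop ℕ∞) ≤ ∞ := WithTop.coe_le_coe.2 le_top
      rw [(hev.iteratedFDeriv ℝ i).self_of_nhds, iteratedFDeriv_add_apply
        ((hprod.contDiffAt hnhds).of_le hi') ((hg.dpCyl.dpCyl.contDiffAt_cylExt hyne).of_le hi')]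
      -- Leibniz' rule for the product with `(‖z.1‖ ^ 2)⁻¹`; the binomial coefficients sum to `2 ^ i
      -- ≤ 2 ^ m`.
      have hleib := norm_iteratedFDerivWithin_smul_le hinv hg.lapCyl.contDiffOn_cylExt
        isOpen_fst_ne.uniqueDiffOn hyne hi'
      simp only [iteratedFDerivWithin_of_isOpen _ isOpen_fst_ne hyne] at hleib
      have hb := hball y hy
      have h3 : ‖iteratedFDeriv ℝ i (fun z : Euc n × ℝ => (‖z.1‖ ^ 2)⁻¹ • cylExt (lapCyl g) z) y‖
          ≤ 2 ^ m * H * C₁ * A := by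
        refine hleib.trans ?_
        calc _ ≤ ∑ k ∈ Finset.range (i + 1), (i.choose k : ℝ) * H * (C₁ * A) := by
              refine Finset.sum_le_sum fun k hk => ?_
              have hk' := Finset.mem_range.1 hk
              gcongr
              · exact hH' y hb.1 hb.2 k (by omega)
              · exact hlap y hb.1 hb.2 (i - k) (by omega)
          _ = 2 ^ i * (H * (C₁ * A)) := by
              simp only [mul_assoc]
              rw [← Finset.sum_mul]
              congr 1
              exact_mod_cast Nat.sum_range_choose i
          _ ≤ 2 ^ m * (H * (C₁ * A)) := by
              gcongr
              norm_num
          _ = _ := by ring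
      have h4 := hdp y hb.1 hb.2 i him
      refine (norm_add_le _ _).trans ?_
      linarith

/-! ### Weighted bounds for Schwartz functions on the line -/

/-- A continuous seminorm that dominates `sup (1 + |t|)^k |φ^{(j)}(t)|`. -/
def schwartzBound (k j : ℕ) : Seminorm ℝ 𝓢(ℝ, ℂ) :=
  (2 ^ k : NNReal) • (Finset.Iic (k, j)).sup (schwartzSeminormFamily ℝ ℝ ℂ)

lemma continuous_schwartzBound (k j : ℕ) : Continuous (schwartzBound k j) := by
  have h1 : ∀ s : Finset (ℕ × ℕ),
      Continuous fun φ => (s.sup (schwartzSeminormFamily ℝ ℝ ℂ) : Seminorm ℝ 𝓢(ℝ, ℂ)) φ := by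
    intro s
    induction s using Finset.cons_induction with
    | empty => simpa using! continuous_const
    | cons i s hi ih =>
      simp only [Finset.sup_cons, Seminorm.sup_apply]
      exact ((schwartz_withSeminorms ℝ ℝ ℂ).continuous_seminorm i).max ih
  exact (h1 _).const_smul (2 ^ k : NNReal)

lemma pow_mul_norm_iteratedFDeriv_le (φ : 𝓢(ℝ, ℂ)) (k j : ℕ) (t : ℝ) :
    (1 + |t|) ^ k * ‖iteratedFDeriv ℝ j φ t‖ ≤ schwartzBound k j φ := by
  have := SchwartzMap.one_add_le_sup_seminorm_apply (𝕜 := ℝ) (m := (k, j)) le_rfl le_rfl φ t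
  exact this

lemma pow_mul_norm_le (φ : 𝓢(ℝ, ℂ)) (k : ℕ) (t : ℝ) :
    (1 + |t|) ^ k * ‖φ t‖ ≤ schwartzBound k 0 φ := by
  simpa using pow_mul_norm_iteratedFDeriv_le φ k 0 t

lemma integrable_inv_one_add_sq : Integrable fun t : ℝ => ((1 + |t|) ^ 2)⁻¹ := by
  have h := integrable_one_add_norm (E := ℝ) (μ := volume) (r := 2) (by simp)
  refine h.congr (Filter.Eventually.of_forall fun t => ?_)
  have h0 : (0 : ℝ) ≤ 1 + |t| := by positivity
  simp only [Real.norm_eq_abs]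
  rw [Real.rpow_neg h0]
  norm_cast

lemma integrable_pow_mul_norm (φ : 𝓢(ℝ, ℂ)) (k : ℕ) :
    Integrable fun t : ℝ => (1 + |t|) ^ k * ‖φ t‖ := by
  refine (integrable_inv_one_add_sq.const_mul (schwartzBound (k + 2) 0 φ)).mono'
    (by fun_prop) (Filter.Eventually.of_forall fun t => ?_)
  have h0 : (0 : ℝ) < 1 + |t| := by positivity
  have := pow_mul_norm_le φ (k + 2) t
  rw [Real.norm_of_nonneg (by positivity), ← div_eq_mul_inv, le_div_iff₀ (by positivity)]
  calc _ = (1 + |t|) ^ (k + 2) * ‖φ t‖ := by ring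
    _ ≤ _ := this

/-- Multiplication of a Schwartz function by the variable. -/
def mulVar : 𝓢(ℝ, ℂ) →L[ℂ] 𝓢(ℝ, ℂ) := SchwartzMap.smulLeftCLM ℂ fun t : ℝ => (t : ℂ)

lemma mulVar_apply (φ : 𝓢(ℝ, ℂ)) (t : ℝ) : mulVar φ t = t * φ t := by
  have : Function.HasTemperateGrowth fun t : ℝ => (t : ℂ) :=
    Complex.ofRealCLM.hasTemperateGrowth
  simp [mulVar, SchwartzMap.smulLeftCLM_apply_apply this]

lemma mulVar_iterate_apply (φ : 𝓢(ℝ, ℂ)) (l : ℕ) (t : ℝ) : mulVar^[l] φ t = (t : ℂ) ^ l * φ t := by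
  induction l with
  | zero => simp
  | succ l ih => rw [Function.iterate_succ_apply', mulVar_apply, ih]; ring

/-- Complex conjugation of Schwartz functions. -/
def conjS : 𝓢(ℝ, ℂ) →L[ℝ] 𝓢(ℝ, ℂ) :=
  SchwartzMap.postcompCLM (𝕜 := ℝ) (Complex.conjCLE : ℂ →L[ℝ] ℂ)

lemma conjS_apply (φ : 𝓢(ℝ, ℂ)) (t : ℝ) : conjS φ t = conj (φ t) := by
  simp [conjS]

/-! ### The wavelet transform as an integral over the wavelet variable -/

/-- Smooth functions on `𝕊^{n-1} × ℝ` for which all `∂_p^q Δ_u^k g` are bounded. -/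
structure BddCyl (g : Cyl n → ℂ) : Prop where
  smooth : SmoothCyl g
  bdd : ∀ q k : ℕ, ∃ A : ℝ, ∀ z, ‖mixedCyl q k g z‖ ≤ A

namespace BddCyl

lemma dpCyl {g : Cyl n → ℂ} (h : BddCyl g) : BddCyl (dpCyl g) where
  smooth := h.smooth.dpCyl
  bdd q k := by rw [mixedCyl_dpCyl h.smooth]; exact h.bdd (q + 1) k

lemma lapCyl {g : Cyl n → ℂ} (h : BddCyl g) : BddCyl (lapCyl g) where
  smooth := h.smooth.lapCyl
  bdd q k := h.bdd q (k + 1)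

lemma exists_bound {g : Cyl n → ℂ} (h : BddCyl g) (m : ℕ) :
    ∃ A : ℝ, ∀ q ≤ 2 * m, ∀ k ≤ m, ∀ z, ‖mixedCyl q k g z‖ ≤ A := by
  choose A hA using h.bdd
  refine ⟨∑ q ∈ Finset.range (2 * m + 1), ∑ k ∈ Finset.range (m + 1), |A q k|,
    fun q hq k hk z => ?_⟩
  calc _ ≤ |A q k| := (hA q k z).trans (le_abs_self _)
    _ ≤ ∑ k ∈ Finset.range (m + 1), |A q k| :=
      Finset.single_le_sum (f := fun k => |A q k|) (fun _ _ => abs_nonneg _)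
        (Finset.mem_range.2 (by omega))
    _ ≤ _ := Finset.single_le_sum (f := fun q => ∑ k ∈ Finset.range (m + 1), |A q k|)
        (fun _ _ => Finset.sum_nonneg fun _ _ => abs_nonneg _) (Finset.mem_range.2 (by omega))

lemma exists_norm_iteratedFDeriv_le {g : Cyl n → ℂ} (h : BddCyl g) (j : ℕ) {r R : ℝ} (hr : 0 < r) :
    ∃ C : ℝ, ∀ z : Euc n × ℝ, r ≤ ‖z.1‖ → ‖z.1‖ ≤ R → ‖iteratedFDeriv ℝ j (cylExt g) z‖ ≤ C := by
  obtain ⟨C, _, hC⟩ := exists_norm_iteratedFDeriv_cylExt_le n j r R hr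
  obtain ⟨A, hA⟩ := h.exists_bound j
  exact ⟨C * A, fun z h1 h2 => hC g A h.smooth hA z h1 h2 j le_rfl⟩

end BddCyl

lemma SchwartzCyl.bddCyl (g : SchwartzCyl n) : BddCyl (g : Cyl n → ℂ) where
  smooth := g.2.1
  bdd q k := by
    obtain ⟨A, hA⟩ := g.2.2 0 q k
    exact ⟨A, fun z => by simpa [weightCyl] using hA ⟨z, rfl⟩⟩

/-- The annulus `r < ‖x‖ < R` in the first variable. -/
def annulus (n : ℕ) (V : Type) (r R : ℝ) : Set (Euc n × V) := {z | r < ‖z.1‖ ∧ ‖z.1‖ < R}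

lemma isOpen_annulus {V : Type} [TopologicalSpace V] {r R : ℝ} : IsOpen (annulus n V r R) :=
  (isOpen_lt continuous_const continuous_fst.norm).inter
    (isOpen_lt continuous_fst.norm continuous_const)

lemma mem_annulus {V : Type} {z : Euc n × V} (hz : z.1 ≠ 0) :
    z ∈ annulus n V (‖z.1‖ / 2) (2 * ‖z.1‖) := by
  have : 0 < ‖z.1‖ := norm_pos_iff.2 hz
  constructor <;> linarith

/-- The linear map `(x, b, a) ↦ (x, b + a t)`. -/
def shear (n : ℕ) (t : ℝ) : Euc n × ℝ × ℝ →L[ℝ] Euc n × ℝ :=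
  (ContinuousLinearMap.fst ℝ _ _).prod
    ((ContinuousLinearMap.fst ℝ ℝ ℝ + t • ContinuousLinearMap.snd ℝ ℝ ℝ).comp
      (ContinuousLinearMap.snd ℝ (Euc n) (ℝ × ℝ)))

lemma shear_apply (t : ℝ) (z : Euc n × ℝ × ℝ) : shear n t z = (z.1, z.2.1 + z.2.2 * t) := by
  simp [shear, mul_comm]

lemma norm_shear_le (t : ℝ) : ‖shear n t‖ ≤ 1 + |t| := by
  refine ContinuousLinearMap.opNorm_le_bound _ (by positivity) fun z => ?_
  rw [shear_apply, Prod.norm_mk]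
  have h1 : ‖z.1‖ ≤ ‖z‖ := norm_fst_le z
  have h2 : ‖z.2‖ ≤ ‖z‖ := norm_snd_le z
  have h3 : ‖z.2.1‖ ≤ ‖z‖ := (norm_fst_le z.2).trans h2
  have h4 : ‖z.2.2‖ ≤ ‖z‖ := (norm_snd_le z.2).trans h2
  have h0 := norm_nonneg z
  refine max_le ?_ ?_
  · nlinarith [abs_nonneg t]
  · calc ‖z.2.1 + z.2.2 * t‖ ≤ ‖z.2.1‖ + ‖z.2.2‖ * |t| := by
          refine (norm_add_le _ _).trans ?_
          rw [norm_mul, Real.norm_eq_abs t]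
      _ ≤ ‖z‖ + ‖z‖ * |t| := by gcongr
      _ = (1 + |t|) * ‖z‖ := by ring

/-- `∫ φ(t) g(x/‖x‖, b + a t) dt` as a function on an open subset of a vector space. -/
def waveletExt (φ : ℝ → ℂ) (g : Cyl n → ℂ) (z : Euc n × ℝ × ℝ) : ℂ :=
  ∫ t : ℝ, φ t * cylExt g (shear n t z)

/-- `∫ φ(t) g(u, b + a t) dt`. -/
def waveletFn (φ : ℝ → ℂ) (g : Cyl n → ℂ) (y : YSp n) : ℂ :=
  ∫ t : ℝ, φ t * g (y.1, y.2.1 + y.2.2 * t)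

lemma waveletExt_coe (φ : ℝ → ℂ) (g : Cyl n → ℂ) (y : YSp n) :
    waveletExt φ g ((y.1 : Euc n), y.2.1, (y.2.2 : ℝ)) = waveletFn φ g y := by
  simp [waveletExt, waveletFn, shear_apply, cylExt, radial_coe]

lemma BddCyl.contDiffAt_comp_shear {g : Cyl n → ℂ} (h : BddCyl g) (t : ℝ) {z : Euc n × ℝ × ℝ}
    (hz : z.1 ≠ 0) : ContDiffAt ℝ ∞ (fun z => cylExt g (shear n t z)) z :=
  ContDiffAt.comp (f := shear n t) z (h.smooth.contDiffAt_cylExt (by simpa [shear_apply] using hz))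
    (shear n t).contDiff.contDiffAt

/-- The `j`-th derivative of `cylExt g` is bounded on the annulus, uniformly in the line variable.
Composition with the shear costs at most `(1 + |t|) ^ j`, which the rapid decay of `φ` absorbs. -/
lemma BddCyl.dominatedSmooth {g : Cyl n → ℂ} (h : BddCyl g) (φ : 𝓢(ℝ, ℂ)) {r R : ℝ} (hr : 0 < r) :
    DominatedSmooth (annulus n (ℝ × ℝ) r R) Set.univ volume
      (fun z t => φ t * cylExt g (shear n t z)) where
  smooth := by
    rintro ⟨z, t⟩ ⟨hz, -⟩
    have hz0 : z.1 ≠ 0 := norm_pos_iff.1 (hr.trans hz.1)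
    refine ContDiffAt.contDiffWithinAt ?_
    simp only [shear_apply]
    refine ContDiffAt.mul ?_ ?_
    · exact ContDiffAt.comp (f := fun w : (Euc n × ℝ × ℝ) × ℝ => w.2) _
        (φ.smooth ⊤).contDiffAt contDiffAt_snd
    · exact ContDiffAt.comp
        (f := fun w : (Euc n × ℝ × ℝ) × ℝ => (w.1.1, w.1.2.1 + w.1.2.2 * w.2)) _
        (h.smooth.contDiffAt_cylExt hz0) (by fun_prop)
  bound j := by
    obtain ⟨C, hC⟩ := h.exists_norm_iteratedFDeriv_le j hr (R := R)
    refine ⟨fun t => C * ((1 + |t|) ^ j * ‖φ t‖), ?_, fun z hz t _ => ?_⟩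
    · exact ((integrable_pow_mul_norm φ j).const_mul C).integrableOn
    · have hz0 : z.1 ≠ 0 := norm_pos_iff.1 (hr.trans hz.1)
      have h1 := iteratedFDeriv_const_smul_apply (a := φ t) (i := j)
        ((h.contDiffAt_comp_shear t hz0).of_le (WithTop.coe_le_coe.2 le_top))
      simp only [← smul_eq_mul]
      change ‖iteratedFDeriv ℝ j (φ t • fun z => cylExt g (shear n t z)) z‖ ≤ _
      rw [h1, norm_smul]
      have hz' : shear n t z ∈ {z : Euc n × ℝ | z.1 ≠ 0} := by simpa [shear_apply] using hz0
      have h2 := norm_iteratedFDeriv_comp_clm_le (shear n t) isOpen_fst_ne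
        h.smooth.contDiffOn_cylExt hz' j
      have h3 := hC (shear n t z) (by simpa [shear_apply] using hz.1.le)
        (by simpa [shear_apply] using hz.2.le)
      have hC0 : 0 ≤ C := (norm_nonneg _).trans h3
      calc ‖φ t‖ * ‖iteratedFDeriv ℝ j (fun z => cylExt g (shear n t z)) z‖
          ≤ ‖φ t‖ * (C * (1 + |t|) ^ j) := by
            gcongr
            refine h2.trans ?_
            gcongr
            exact norm_shear_le t
        _ = _ := by simp only [smul_eq_mul]; ring

lemma BddCyl.contDiffAt_waveletExt {g : Cyl n → ℂ} (h : BddCyl g) (φ : 𝓢(ℝ, ℂ))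
    {z : Euc n × ℝ × ℝ} (hz : z.1 ≠ 0) :
    ContDiffAt ℝ ∞ (waveletExt φ g) z := by
  have hr : 0 < ‖z.1‖ / 2 := half_pos (norm_pos_iff.2 hz)
  have := (h.dominatedSmooth φ hr (R := 2 * ‖z.1‖)).contDiffOn_integral isOpen_annulus isOpen_univ
  simp only [Measure.restrict_univ] at this
  exact this.contDiffAt (isOpen_annulus.mem_nhds (mem_annulus hz))

lemma BddCyl.smoothY_waveletFn {g : Cyl n → ℂ} (h : BddCyl g) (φ : 𝓢(ℝ, ℂ)) :
    SmoothY (waveletFn φ g) := by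
  have := smoothY_of_contDiffAt (G := waveletExt φ g) fun z hz _ => h.contDiffAt_waveletExt φ hz
  simpa only [waveletExt_coe] using this

lemma BddCyl.fderiv_waveletExt {g : Cyl n → ℂ} (h : BddCyl g) (φ : 𝓢(ℝ, ℂ))
    {z : Euc n × ℝ × ℝ} (hz : z.1 ≠ 0) (v : Euc n × ℝ × ℝ) :
    fderiv ℝ (waveletExt φ g) z v
      = ∫ t : ℝ, φ t * fderiv ℝ (cylExt g) (shear n t z) (shear n t v) := by
  have hr : 0 < ‖z.1‖ / 2 := half_pos (norm_pos_iff.2 hz)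
  have := (h.dominatedSmooth φ hr (R := 2 * ‖z.1‖)).fderiv_integral_apply isOpen_annulus
    isOpen_univ (mem_annulus hz) v
  simp only [Measure.restrict_univ] at this
  refine this.trans (integral_congr_ae (Eventually.of_forall fun t => ?_))
  have h1 : HasFDerivAt (cylExt g) (fderiv ℝ (cylExt g) (shear n t z)) (shear n t z) :=
    ((h.smooth.contDiffAt_cylExt (by simpa [shear_apply] using hz)).differentiableAt
      (by simp)).hasFDerivAt
  have h2 := ((h1.comp z (shear n t).hasFDerivAt).const_smul (φ t)).fderiv
  exact congrArg (fun L => L v) h2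

lemma BddCyl.dbY_waveletFn {g : Cyl n → ℂ} (h : BddCyl g) (φ : 𝓢(ℝ, ℂ)) :
    dbY (waveletFn φ g) = waveletFn φ (Ridgelet.dpCyl g) := by
  funext ⟨u, b, a⟩
  have hz : (((u : Euc n), b, (a : ℝ)) : Euc n × ℝ × ℝ).1 ≠ 0 := ne_zero_coe u
  have hl : HasDerivAt (fun t : ℝ => ((u : Euc n), t, (a : ℝ))) ((0, 1, 0) : Euc n × ℝ × ℝ) b :=
    (hasDerivAt_const _ _).prodMk ((hasDerivAt_id _).prodMk (hasDerivAt_const _ _))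
  have h1 := (((h.contDiffAt_waveletExt φ hz).differentiableAt (by simp)).hasFDerivAt).comp_hasDerivAt
    (f := fun t : ℝ => ((u : Euc n), t, (a : ℝ))) b hl
  have h2 : (waveletExt φ g ∘ fun t : ℝ => ((u : Euc n), t, (a : ℝ)))
      = fun t : ℝ => waveletFn φ g (u, t, a) := by
    funext t
    exact waveletExt_coe φ g (u, t, a)
  rw [h2] at h1
  refine h1.deriv.trans ?_
  rw [h.fderiv_waveletExt φ hz]
  refine integral_congr_ae (Eventually.of_forall fun t => ?_)
  have h3 : shear n t ((0, 1, 0) : Euc n × ℝ × ℝ) = (0, 1) := by simp [shear_apply]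
  have h4 := cylExt_dpCyl h.smooth (z := shear n t ((u : Euc n), b, (a : ℝ)))
    (by simpa [shear_apply] using hz)
  simp only [h3]
  rw [← h4, shear_apply, cylExt_coe]

/-- The shear sends the direction of `a` to `t` times the direction of `p`, and the factor `t` is
moved into `φ`. -/
lemma BddCyl.daY_waveletFn {g : Cyl n → ℂ} (h : BddCyl g) (φ : 𝓢(ℝ, ℂ)) :
    daY (waveletFn φ g) = waveletFn (mulVar φ) (Ridgelet.dpCyl g) := by
  funext ⟨u, b, a⟩
  have hz : (((u : Euc n), b, (a : ℝ)) : Euc n × ℝ × ℝ).1 ≠ 0 := ne_zero_coe u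
  have hl : HasDerivAt (fun t : ℝ => ((u : Euc n), b, t)) ((0, 0, 1) : Euc n × ℝ × ℝ) (a : ℝ) :=
    (hasDerivAt_const _ _).prodMk ((hasDerivAt_const _ _).prodMk (hasDerivAt_id _))
  have h1 := (((h.contDiffAt_waveletExt φ hz).differentiableAt (by simp)).hasFDerivAt).comp_hasDerivAt
    (f := fun t : ℝ => ((u : Euc n), b, t)) (a : ℝ) hl
  have h2 : (waveletExt φ g ∘ fun t : ℝ => ((u : Euc n), b, t))
      =ᶠ[𝓝 (a : ℝ)] fun t : ℝ => waveletFn φ g (u, b, toPos t) := by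
    filter_upwards [lt_mem_nhds (show (0 : ℝ) < a from a.2)] with t ht
    have := waveletExt_coe φ g (u, b, toPos t)
    simpa [coe_toPos ht] using this
  refine (h1.congr_of_eventuallyEq h2.symm).deriv.trans ?_
  rw [h.fderiv_waveletExt φ hz]
  refine integral_congr_ae (Eventually.of_forall fun t => ?_)
  have h3 : shear n t ((0, 0, 1) : Euc n × ℝ × ℝ) = t • (0, 1) := by simp [shear_apply]
  have h4 := cylExt_dpCyl h.smooth (z := shear n t ((u : Euc n), b, (a : ℝ)))
    (by simpa [shear_apply] using hz)
  simp only [h3, map_smul]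
  rw [← h4, shear_apply, cylExt_coe, mulVar_apply, Complex.real_smul]
  ring

/-- The shear fixes the directions of ℝⁿ, so the Laplacian passes through the integral to `g`. -/
lemma BddCyl.lapY_waveletFn {g : Cyl n → ℂ} (h : BddCyl g) (φ : 𝓢(ℝ, ℂ)) :
    lapY (waveletFn φ g) = waveletFn φ (Ridgelet.lapCyl g) := by
  funext ⟨u, b, a⟩
  set z : Euc n × ℝ × ℝ := ((u : Euc n), b, (a : ℝ)) with hzdef
  have hz : z.1 ≠ 0 := ne_zero_coe u
  have hr : 0 < ‖z.1‖ / 2 := half_pos (norm_pos_iff.2 hz)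
  set e := EuclideanSpace.basisFun (Fin n) ℝ with he
  have h0 : (fun x : Euc n => waveletFn φ g (radial x, b, a))
      = fun x => waveletExt φ g ((0, b, (a : ℝ)) + ContinuousLinearMap.inl ℝ (Euc n) (ℝ × ℝ) x) := by
    funext x
    rw [← waveletExt_coe]
    simp [waveletExt, shear_apply, cylExt, radial_coe]
  have hz' : ((0, b, (a : ℝ)) + ContinuousLinearMap.inl ℝ (Euc n) (ℝ × ℝ) (u : Euc n)) = z := by
    simp [hzdef]
  change Laplacian.laplacian (fun x : Euc n => waveletFn φ g (radial x, b, a)) (u : Euc n) = _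
  rw [h0, ← sqSum_orthonormalBasis e, sqSum_comp_add_right, hz']
  swap
  · rw [hz']
    exact (h.contDiffAt_waveletExt φ hz).of_le (WithTop.coe_le_coe.2 le_top)
  have := (h.dominatedSmooth φ hr (R := 2 * ‖z.1‖)).sqSum_integral isOpen_annulus
    isOpen_univ (mem_annulus hz) (fun i => ContinuousLinearMap.inl ℝ (Euc n) (ℝ × ℝ) (e i))
  simp only [Measure.restrict_univ] at this
  refine this.trans (integral_congr_ae (Eventually.of_forall fun t => ?_))
  have h1 : ContDiffAt ℝ 2 (fun z => cylExt g (shear n t z)) z :=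
    (h.contDiffAt_comp_shear t hz).of_le (WithTop.coe_le_coe.2 le_top)
  have h2 := sqSum_clm_comp (e := fun i => ContinuousLinearMap.inl ℝ (Euc n) (ℝ × ℝ) (e i))
    (ContinuousLinearMap.mul ℝ ℂ (φ t)) h1
  have h3 : ContDiffAt ℝ 2 (cylExt g) (0 + shear n t z) := by
    rw [zero_add]
    exact (h.smooth.contDiffAt_cylExt (by simpa [shear_apply] using hz)).of_le
      (WithTop.coe_le_coe.2 le_top)
  have h4 := sqSum_comp_add_right (shear n t) 0 h3
    (fun i => ContinuousLinearMap.inl ℝ (Euc n) (ℝ × ℝ) (e i))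
  simp only [zero_add] at h4
  have h5 : (fun i => shear n t (ContinuousLinearMap.inl ℝ (Euc n) (ℝ × ℝ) (e i)))
      = horizontal := by
    funext i
    simp [shear_apply, horizontal, he]
  refine Eq.trans h2 ?_
  rw [h4, h5, shear_apply, hzdef, ← lapCyl_eq_sqSum h.smooth]
  rfl

lemma BddCyl.mixedY_waveletFn {g : Cyl n → ℂ} (h : BddCyl g) (φ : 𝓢(ℝ, ℂ)) (l m k : ℕ) :
    mixedY l m k (waveletFn φ g) = waveletFn (mulVar^[l] φ) (mixedCyl (l + m) k g) := by
  have h1 : ∀ k : ℕ, ∀ {g : Cyl n → ℂ}, BddCyl g →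
      lapY^[k] (waveletFn φ g) = waveletFn φ (Ridgelet.lapCyl^[k] g) ∧
        BddCyl (Ridgelet.lapCyl^[k] g) := by
    intro k
    induction k with
    | zero => exact fun h => ⟨rfl, h⟩
    | succ k ih =>
      intro g h
      rw [Function.iterate_succ_apply, h.lapY_waveletFn]
      exact ih h.lapCyl
  have h2 : ∀ m : ℕ, ∀ {g : Cyl n → ℂ}, BddCyl g →
      dbY^[m] (waveletFn φ g) = waveletFn φ (Ridgelet.dpCyl^[m] g) ∧
        BddCyl (Ridgelet.dpCyl^[m] g) := by
    intro m
    induction m with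
    | zero => exact fun h => ⟨rfl, h⟩
    | succ m ih =>
      intro g h
      rw [Function.iterate_succ_apply, h.dbY_waveletFn]
      exact ih h.dpCyl
  have h3 : ∀ l : ℕ, ∀ (φ : 𝓢(ℝ, ℂ)) {g : Cyl n → ℂ}, BddCyl g →
      daY^[l] (waveletFn φ g) = waveletFn (mulVar^[l] φ) (Ridgelet.dpCyl^[l] g) := by
    intro l
    induction l with
    | zero => exact fun _ _ h => rfl
    | succ l ih =>
      intro φ g h
      rw [Function.iterate_succ_apply, h.daY_waveletFn]
      exact ih _ h.dpCyl
  rw [mixedY, (h1 k h).1, (h2 m (h1 k h).2).1, h3 l φ (h2 m (h1 k h).2).2,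
    ← Function.iterate_add_apply, mixedCyl]

/-! ### Decay of `∫ φ(t) f(b + a t) dt` when moments vanish -/

/-- The constant `∫ (1 + |t|)⁻² dt`. -/
def decayConst : ℝ := ∫ t : ℝ, ((1 + |t|) ^ 2)⁻¹

lemma decayConst_nonneg : 0 ≤ decayConst := integral_nonneg fun t => by positivity

lemma integral_comp_affine (F : ℝ → ℂ) {a : ℝ} (ha : 0 < a) (b : ℝ) :
    ∫ t, F (b + a * t) = (a : ℂ)⁻¹ * ∫ p, F p := by
  have h1 := Measure.integral_comp_mul_left (fun t => F (b + t)) a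
  rw [h1, integral_add_left_eq_self F b, abs_of_pos (inv_pos.2 ha), Complex.real_smul]
  simp

/-- Peetre's inequality: it moves polynomial weights from one point to another. -/
lemma one_add_abs_le_mul (b c : ℝ) : 1 + |b| ≤ (1 + |b + c|) * (1 + |c|) := by
  have h1 : |b| ≤ |b + c| + |c| := by
    have := abs_sub (b + c) c
    simpa using this
  nlinarith [abs_nonneg (b + c), abs_nonneg c]

/-- Taylor's formula with integral remainder. Peetre's inequality transfers the decay of the
derivative at `b + s h` to the point `b`, at the price of `(1 + |t|) ^ N`. Two variables `h` and `t`
occur because `h = a t` later, and the price must not depend on `a`. -/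
lemma norm_taylor_remainder_le {f : ℝ → ℂ} {m N : ℕ} (hf : ContDiff ℝ (m + 1) f) {A : ℝ}
    (hA : ∀ p, (1 + |p|) ^ N * ‖iteratedFDeriv ℝ (m + 1) f p‖ ≤ A) (b h t : ℝ) (ht : |h| ≤ |t|) :
    ‖f (b + h) - ∑ k ∈ Finset.range (m + 1), ((k.factorial : ℝ)⁻¹ * h ^ k) • iteratedDeriv k f b‖
      ≤ A * (1 + |t|) ^ N * |h| ^ (m + 1) / (1 + |b|) ^ N := by
  have h1 := map_add_eq_sum_add_integral_iteratedFDeriv (x := b) (y := h) (n := m) (f := f)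
    (fun s _ => hf.contDiffAt)
  have h2 : ∀ k, iteratedFDeriv ℝ k f b (fun _ => h) = h ^ k • iteratedDeriv k f b := fun k => by
    simp [iteratedFDeriv_apply_eq_iteratedDeriv_mul_prod]
  simp only [h2, smul_smul] at h1
  rw [h1, add_sub_cancel_left, norm_smul, norm_inv, Real.norm_of_nonneg (by positivity)]
  have hfac : ((m.factorial : ℝ))⁻¹ ≤ 1 := by
    refine inv_le_one_of_one_le₀ ?_
    exact_mod_cast Nat.one_le_iff_ne_zero.2 m.factorial_ne_zero
  refine (mul_le_of_le_one_left (norm_nonneg _) hfac).trans ?_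
  have h3 := intervalIntegral.norm_integral_le_of_norm_le_const (a := 0) (b := 1)
    (f := fun s : ℝ => (1 - s) ^ m • iteratedFDeriv ℝ (m + 1) f (b + s • h) (fun _ => h))
    (C := A * (1 + |t|) ^ N * |h| ^ (m + 1) / (1 + |b|) ^ N) ?_
  · simpa using h3
  intro s hs
  rw [Set.uIoc_of_le zero_le_one] at hs
  have hs0 : |s| ≤ 1 := abs_le.2 ⟨by linarith [hs.1], hs.2⟩
  have e1 : |1 - s| ^ m ≤ 1 := pow_le_one₀ (abs_nonneg _) (abs_le.2 ⟨by linarith [hs.2],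
    by linarith [hs.1]⟩)
  have e2 : ‖iteratedFDeriv ℝ (m + 1) f (b + s • h) (fun _ => h)‖
      ≤ ‖iteratedFDeriv ℝ (m + 1) f (b + s • h)‖ * |h| ^ (m + 1) := by
    simpa using (iteratedFDeriv ℝ (m + 1) f (b + s • h)).le_opNorm (fun _ => h)
  have e3 : 1 + |b| ≤ (1 + |b + s • h|) * (1 + |t|) := by
    have hst : |s • h| ≤ |t| := by
      rw [smul_eq_mul, abs_mul]
      exact (mul_le_of_le_one_left (abs_nonneg _) hs0).trans ht
    refine (one_add_abs_le_mul b (s • h)).trans ?_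
    gcongr
  have hb : 0 < (1 + |b|) ^ N := by positivity
  rw [norm_smul, norm_pow, Real.norm_eq_abs, le_div_iff₀ hb]
  calc |1 - s| ^ m * ‖iteratedFDeriv ℝ (m + 1) f (b + s • h) (fun _ => h)‖ * (1 + |b|) ^ N
      ≤ 1 * (‖iteratedFDeriv ℝ (m + 1) f (b + s • h)‖ * |h| ^ (m + 1))
        * ((1 + |b + s • h|) * (1 + |t|)) ^ N := by gcongr
    _ = ((1 + |b + s • h|) ^ N * ‖iteratedFDeriv ℝ (m + 1) f (b + s • h)‖)
        * (1 + |t|) ^ N * |h| ^ (m + 1) := by rw [mul_pow]; ring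
    _ ≤ A * (1 + |t|) ^ N * |h| ^ (m + 1) := by gcongr; exact hA _

/-- The moments of `φ` annihilate the Taylor polynomial `P` of `f` at `b`, so only the remainder
contributes. The weight on `φ` pays `m + 1` powers for `|t| ^ (m + 1)`, `N` for Peetre's inequality
and 2 for integrability. -/
lemma norm_integral_affine_le {f φ : ℝ → ℂ} {m N : ℕ} (hf : ContDiff ℝ (m + 1) f)
    (hφ : Continuous φ) {A B : ℝ}
    (hA : ∀ p, (1 + |p|) ^ N * ‖iteratedFDeriv ℝ (m + 1) f p‖ ≤ A)
    (hB : ∀ t, (1 + |t|) ^ (m + 1 + N + 2) * ‖φ t‖ ≤ B)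
    (hmom : ∀ k ≤ m, ∫ t : ℝ, (t : ℂ) ^ k * φ t = 0) {a : ℝ} (ha : 0 < a) (ha1 : a ≤ 1) (b : ℝ) :
    ‖∫ t, φ t * f (b + a * t)‖ ≤ decayConst * (A * B) * a ^ (m + 1) / (1 + |b|) ^ N := by
  have hA0 : 0 ≤ A := le_trans (by positivity) (hA 0)
  have hB0 : 0 ≤ B := le_trans (by positivity) (hB 0)
  set P : ℝ → ℂ := fun t => ∑ k ∈ Finset.range (m + 1),
    ((k.factorial : ℝ)⁻¹ * (a * t) ^ k) • iteratedDeriv k f b with hP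
  have hmono : ∀ k ≤ m, Integrable fun t : ℝ => (t : ℂ) ^ k * φ t := by
    intro k hk
    refine (integrable_inv_one_add_sq.const_mul B).mono' (by fun_prop)
      (Eventually.of_forall fun t => ?_)
    have h0 : (0 : ℝ) < 1 + |t| := by positivity
    rw [← div_eq_mul_inv, le_div_iff₀ (by positivity), norm_mul, norm_pow, Complex.norm_real,
      Real.norm_eq_abs]
    calc |t| ^ k * ‖φ t‖ * (1 + |t|) ^ 2 ≤ (1 + |t|) ^ k * ‖φ t‖ * (1 + |t|) ^ 2 := by
          gcongr; linarith
      _ = (1 + |t|) ^ (k + 2) * ‖φ t‖ := by ring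
      _ ≤ (1 + |t|) ^ (m + 1 + N + 2) * ‖φ t‖ := by
          gcongr
          · linarith [abs_nonneg t]
          · omega
      _ ≤ B := hB t
  have hterm : ∀ (t : ℝ) (k : ℕ), φ t * (((k.factorial : ℝ)⁻¹ * (a * t) ^ k) • iteratedDeriv k f b)
      = (((k.factorial : ℝ)⁻¹ * a ^ k) • iteratedDeriv k f b) * ((t : ℂ) ^ k * φ t) := by
    intro t k
    simp only [Complex.real_smul]
    push_cast
    ring
  have hPint : Integrable fun t => φ t * P t := by
    simp only [hP, Finset.mul_sum, hterm]
    exact integrable_finsetSum _ fun k hk =>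
      (hmono k (by have := Finset.mem_range.1 hk; omega)).const_mul _
  have hP0 : ∫ t, φ t * P t = 0 := by
    simp only [hP, Finset.mul_sum, hterm]
    rw [integral_finsetSum _ fun k hk =>
      (hmono k (by have := Finset.mem_range.1 hk; omega)).const_mul _]
    refine Finset.sum_eq_zero fun k hk => ?_
    rw [integral_const_mul, hmom k (by have := Finset.mem_range.1 hk; omega), mul_zero]
  have hbound : ∀ t, ‖φ t * (f (b + a * t) - P t)‖
      ≤ (A * B) * a ^ (m + 1) / (1 + |b|) ^ N * ((1 + |t|) ^ 2)⁻¹ := by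
    intro t
    have hat : |a * t| ≤ |t| := by
      rw [abs_mul, abs_of_pos ha]
      exact mul_le_of_le_one_left (abs_nonneg _) ha1
    have h1 := norm_taylor_remainder_le hf hA b (a * t) t hat
    have h0 : (0 : ℝ) < 1 + |t| := by positivity
    rw [norm_mul]
    calc ‖φ t‖ * ‖f (b + a * t) - P t‖
        ≤ ‖φ t‖ * (A * (1 + |t|) ^ N * |a * t| ^ (m + 1) / (1 + |b|) ^ N) := by gcongr
      _ = (A * a ^ (m + 1) / (1 + |b|) ^ N) * (|t| ^ (m + 1) * (1 + |t|) ^ N * ‖φ t‖) := by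
          rw [abs_mul, abs_of_pos ha, mul_pow]; ring
      _ ≤ (A * a ^ (m + 1) / (1 + |b|) ^ N) * (B * ((1 + |t|) ^ 2)⁻¹) := by
          refine mul_le_mul_of_nonneg_left ?_ (by positivity)
          rw [← div_eq_mul_inv, le_div_iff₀ (by positivity)]
          calc |t| ^ (m + 1) * (1 + |t|) ^ N * ‖φ t‖ * (1 + |t|) ^ 2
              ≤ (1 + |t|) ^ (m + 1) * (1 + |t|) ^ N * ‖φ t‖ * (1 + |t|) ^ 2 := by
                gcongr; linarith
            _ = (1 + |t|) ^ (m + 1 + N + 2) * ‖φ t‖ := by ring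
            _ ≤ B := hB t
      _ = _ := by ring
  have hRint : Integrable fun t => φ t * (f (b + a * t) - P t) := by
    refine (integrable_inv_one_add_sq.const_mul _).mono' ?_ (Eventually.of_forall hbound)
    have := hf.continuous
    refine Continuous.aestronglyMeasurable ?_
    fun_prop
  have hsplit : ∫ t, φ t * f (b + a * t) = ∫ t, φ t * (f (b + a * t) - P t) := by
    have := integral_add hRint hPint
    rw [hP0, add_zero] at this
    rw [← this]
    exact integral_congr_ae (Eventually.of_forall fun t => by ring)
  rw [hsplit]
  refine (norm_integral_le_of_norm_le (integrable_inv_one_add_sq.const_mul _)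
    (Eventually.of_forall hbound)).trans (le_of_eq ?_)
  rw [integral_const_mul, decayConst]
  ring

lemma one_add_sq_rpow_le (b : ℝ) (r : ℕ) : (1 + b ^ 2) ^ ((r : ℝ) / 2) ≤ (1 + |b|) ^ r := by
  have h0 : (0 : ℝ) ≤ 1 + |b| := by positivity
  have h1 : 1 + b ^ 2 ≤ (1 + |b|) ^ 2 := by nlinarith [abs_nonneg b, sq_abs b]
  calc (1 + b ^ 2) ^ ((r : ℝ) / 2) ≤ ((1 + |b|) ^ 2) ^ ((r : ℝ) / 2) :=
        Real.rpow_le_rpow (by positivity) h1 (by positivity)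
    _ = (1 + |b|) ^ r := by
        rw [← Real.rpow_natCast (1 + |b|) 2, ← Real.rpow_mul h0, ← Real.rpow_natCast]
        congr 1
        push_cast
        ring

/-- The two-sided decay of `∫ φ(t) f(b + a t) dt` when all the moments of `φ` and `f` vanish. -/
lemma weighted_norm_integral_affine_le {f φ : ℝ → ℂ} (s r : ℕ) (hf : ContDiff ℝ ∞ f)
    (hφ : ContDiff ℝ ∞ φ) {A B : ℝ}
    (hA : ∀ p, (1 + |p|) ^ r * ‖iteratedFDeriv ℝ (s + 1) f p‖ ≤ A)
    (hA' : ∀ p, (1 + |p|) ^ (s + r + 1 + r + 2) * ‖f p‖ ≤ A)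
    (hB : ∀ t, (1 + |t|) ^ r * ‖iteratedFDeriv ℝ (s + r + 1) φ t‖ ≤ B)
    (hB' : ∀ t, (1 + |t|) ^ (s + 1 + r + 2) * ‖φ t‖ ≤ B)
    (hf0 : ∀ k : ℕ, ∫ p : ℝ, (p : ℂ) ^ k * f p = 0)
    (hφ0 : ∀ k : ℕ, ∫ t : ℝ, (t : ℂ) ^ k * φ t = 0) {a : ℝ} (ha : 0 < a) (b : ℝ) :
    (a ^ s + 1 / a ^ s) * (1 + b ^ 2) ^ ((r : ℝ) / 2) * ‖∫ t, φ t * f (b + a * t)‖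
      ≤ 2 * decayConst * (A * B) := by
  have hA0 : 0 ≤ A := le_trans (by positivity) (hA 0)
  have hB0 : 0 ≤ B := le_trans (by positivity) (hB 0)
  have hK := decayConst_nonneg
  have hbr := one_add_sq_rpow_le b r
  have hb0 : 0 < (1 + |b|) ^ r := by positivity
  rcases le_total a 1 with ha1 | ha1
  -- Small scales: the moments of `φ` give `a ^ (s + 1)`, which beats the weight `1 / a ^ s`.
  · have h1 := norm_integral_affine_le (m := s) (N := r) (hf.of_le (by
      exact_mod_cast (WithTop.coe_le_coe.2 le_top : (((s + 1 : ℕ) : ℕ∞) : WithTop ℕ∞) ≤ ∞)))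
      hφ.continuous hA hB' (fun k _ => hφ0 k) ha ha1 b
    have h2 : a ^ s + 1 / a ^ s ≤ 2 * (1 / a ^ s) := by
      have e1 : a ^ s ≤ 1 := pow_le_one₀ ha.le ha1
      have e2 : 1 ≤ 1 / a ^ s := by rw [le_div_iff₀ (by positivity)]; linarith
      linarith
    calc _ ≤ (2 * (1 / a ^ s)) * (1 + |b|) ^ r
            * (decayConst * (A * B) * a ^ (s + 1) / (1 + |b|) ^ r) := by gcongr
      _ = 2 * decayConst * (A * B) * a := by field_simp; ring
      _ ≤ 2 * decayConst * (A * B) := mul_le_of_le_one_right (by positivity) ha1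
  · have hinv1 : a⁻¹ ≤ 1 := inv_le_one_of_one_le₀ ha1
    -- Large scales: after the change of variables, `f` is integrated against `φ` at scale `1 / a`
    -- and position `-b / a`, and the moments of `f` are used. The `r` extra orders compensate the
    -- loss `a ^ r` when the weight in `b` is replaced by one in `b / a`.
    have h1 := norm_integral_affine_le (m := s + r) (N := r) (hφ.of_le (by
      exact_mod_cast (WithTop.coe_le_coe.2 le_top : (((s + r + 1 : ℕ) : ℕ∞) : WithTop ℕ∞) ≤ ∞)))
      hf.continuous hB hA' (fun k _ => hf0 k) (inv_pos.2 ha) hinv1 (-b / a)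
    have h3 : ∫ t, φ t * f (b + a * t) = (a : ℂ)⁻¹ * ∫ p, f p * φ (-b / a + a⁻¹ * p) := by
      rw [← integral_comp_affine _ ha b]
      refine integral_congr_ae (Eventually.of_forall fun t => ?_)
      have : -b / a + a⁻¹ * (b + a * t) = t := by field_simp; ring
      simp only [this]
      ring
    rw [h3, norm_mul, norm_inv, Complex.norm_real, Real.norm_of_nonneg ha.le]
    have h2 : a ^ s + 1 / a ^ s ≤ 2 * a ^ s := by
      have e1 : 1 ≤ a ^ s := one_le_pow₀ ha1
      have e2 : 1 / a ^ s ≤ 1 := by rw [div_le_one (by positivity)]; exact e1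
      linarith
    have h4 : (1 + |b|) ^ r ≤ a ^ r * (1 + |-b / a|) ^ r := by
      rw [← mul_pow]
      gcongr
      rw [abs_div, abs_neg, abs_of_pos ha]
      have : a * (1 + |b| / a) = a + |b| := by field_simp
      rw [this]
      linarith
    have hb1 : 0 < (1 + |-b / a|) ^ r := by positivity
    calc _ ≤ (2 * a ^ s) * (a ^ r * (1 + |-b / a|) ^ r)
            * (a⁻¹ * (decayConst * (B * A) * a⁻¹ ^ (s + r + 1) / (1 + |-b / a|) ^ r)) := by
          gcongr
          exact hbr.trans h4
      _ = 2 * decayConst * (A * B) * (a⁻¹ * a⁻¹) := by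
          rw [inv_pow]
          field_simp
          ring
      _ ≤ 2 * decayConst * (A * B) := by
          refine mul_le_of_le_one_right (by positivity) ?_
          exact mul_le_one₀ hinv1 (inv_pos.2 ha).le hinv1

/-! ### Continuity of bilinear maps -/

/-- The increment at `(x₀, y₀)` is `B (x - x₀, y) + B (x₀, y - y₀)`, and the bound of each term is
continuous and vanishes at `(x₀, y₀)`. Biadditivity is the right generality because 𝒲 is
conjugate-linear in ψ. -/
lemma continuous_of_biadditive_of_le {E F G ι : Type*} [AddCommGroup E] [TopologicalSpace E]
    [IsTopologicalAddGroup E] [AddCommGroup F] [TopologicalSpace F] [IsTopologicalAddGroup F]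
    [AddCommGroup G] [Module ℂ G] [TopologicalSpace G] {p : SeminormFamily ℂ G ι}
    (hp : WithSeminorms p) (B : E × F → G)
    (hl : ∀ x x' y, B (x + x', y) = B (x, y) + B (x', y))
    (hr : ∀ x y y', B (x, y + y') = B (x, y) + B (x, y'))
    (hB : ∀ i, ∃ (P : E → ℝ) (Q : F → ℝ), Continuous P ∧ Continuous Q ∧ P 0 = 0 ∧ Q 0 = 0 ∧
      ∀ x y, p i (B (x, y)) ≤ P x * Q y) : Continuous B := by
  rw [continuous_iff_continuousAt]
  rintro ⟨x₀, y₀⟩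
  refine (hp.tendsto_nhds B _).2 fun i ε hε => ?_
  obtain ⟨P, Q, hP, hQ, hP0, hQ0, hPQ⟩ := hB i
  have hlim : Continuous fun z : E × F => P (z.1 - x₀) * Q z.2 + P x₀ * Q (z.2 - y₀) := by
    fun_prop
  have h0 : P ((x₀, y₀).1 - x₀) * Q (x₀, y₀).2 + P x₀ * Q ((x₀, y₀).2 - y₀) < ε := by
    simp [hP0, hQ0, hε]
  filter_upwards [hlim.continuousAt.eventually (gt_mem_nhds h0)] with z hz
  obtain ⟨x, y⟩ := z
  have e1 : B (x, y) = B (x - x₀, y) + B (x₀, y) := by rw [← hl, sub_add_cancel]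
  have e2 : B (x₀, y) = B (x₀, y - y₀) + B (x₀, y₀) := by rw [← hr, sub_add_cancel]
  have e3 : B (x, y) - B (x₀, y₀) = B (x - x₀, y) + B (x₀, y - y₀) := by
    rw [e1, e2]; abel
  rw [e3]
  exact ((map_add_le_add (p i) _ _).trans (add_le_add (hPQ _ _) (hPQ _ _))).trans_lt hz

instance : IsTopologicalAddGroup (SchwartzCyl n) := SchwartzCyl.withSeminorms.topologicalAddGroup

instance : IsTopologicalAddGroup (SchwartzY n) := SchwartzY.withSeminorms.topologicalAddGroup

/-! ### Slices and moments of the derivatives of Lizorkin functions -/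

lemma SmoothCyl.contDiff_slice {g : Cyl n → ℂ} (h : SmoothCyl g) (u : Sph n) :
    ContDiff ℝ ∞ fun p : ℝ => g (u, p) := by
  rw [contDiff_iff_contDiffAt]
  intro p
  have := ContDiffAt.comp (f := fun p : ℝ => ((u : Euc n), p)) p
    (h.contDiffAt_cylExt (z := ((u : Euc n), p)) (ne_zero_coe u)) (by fun_prop)
  simpa [Function.comp_def, cylExt_coe] using this

lemma iteratedDeriv_slice (g : Cyl n → ℂ) (u : Sph n) (j : ℕ) :
    iteratedDeriv j (fun p : ℝ => g (u, p)) = fun p => dpCyl^[j] g (u, p) := by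
  rw [iteratedDeriv_eq_iterate]
  induction j generalizing g with
  | zero => rfl
  | succ j ih => exact ih (dpCyl g)

lemma norm_iteratedFDeriv_slice_mixedCyl (g : Cyl n → ℂ) (q k : ℕ) (u : Sph n) (j : ℕ) (p : ℝ) :
    ‖iteratedFDeriv ℝ j (fun p : ℝ => mixedCyl q k g (u, p)) p‖
      = ‖mixedCyl (j + q) k g (u, p)‖ := by
  rw [norm_iteratedFDeriv_eq_norm_iteratedDeriv, iteratedDeriv_slice]
  simp only [mixedCyl, Function.iterate_add_apply]

lemma SchwartzCyl.le_rho (g : SchwartzCyl n) (N q k : ℕ) (u : Sph n) (p : ℝ) :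
    (1 + |p|) ^ N * ‖mixedCyl q k (g : Cyl n → ℂ) (u, p)‖ ≤ SchwartzCyl.rho (N, q, k) g :=
  le_ciSup (f := fun z => weightCyl N z * ‖mixedCyl q k (g : Cyl n → ℂ) z‖) (g.2.2 N q k) (u, p)

/-- Membership in `𝒮₀(𝕊^{n-1} × ℝ)`, for functions. -/
structure IsLizorkinCyl (g : Cyl n → ℂ) : Prop where
  mem : g ∈ schwartzCylSubmodule n
  moment : ∀ (u : Sph n) (m : ℕ), ∫ p : ℝ, (p : ℂ) ^ m * g (u, p) = 0

namespace IsLizorkinCyl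

/-- Integration by parts: a moment of ∂_p g of order `m` is `-m` times a moment of `g` of order `m -
1`. -/
lemma dpCyl {g : Cyl n → ℂ} (h : IsLizorkinCyl g) : IsLizorkinCyl (dpCyl g) := by
  have hs : SmoothCyl g := h.mem.1
  have hmem : Ridgelet.dpCyl g ∈ schwartzCylSubmodule n :=
    ⟨hs.dpCyl, fun N q k => by rw [mixedCyl_dpCyl hs]; exact h.mem.2 N (q + 1) k⟩
  refine ⟨hmem, fun u m => ?_⟩
  have hd : ∀ p : ℝ, HasDerivAt (fun p => g (u, p)) (Ridgelet.dpCyl g (u, p)) p := fun p =>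
    ((hs.contDiff_slice u).differentiable (by simp) p).hasDerivAt
  have hu : ∀ p : ℝ, HasDerivAt (fun p : ℝ => (p : ℂ) ^ m) (m * (p : ℂ) ^ (m - 1)) p := fun p => by
    simpa using (hasDerivAt_pow m (p : ℂ)).comp_ofReal
  have i1 : Integrable fun p : ℝ => (p : ℂ) ^ m * Ridgelet.dpCyl g (u, p) :=
    SchwartzCyl.integrable_moment (⟨_, hmem⟩ : SchwartzCyl n) u m
  have i2 : Integrable fun p : ℝ => (p : ℂ) ^ m * g (u, p) :=
    SchwartzCyl.integrable_moment (⟨_, h.mem⟩ : SchwartzCyl n) u m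
  -- For `m = 0` the truncated exponent `m - 1` is harmless, because of the factor `m`.
  have i3 : Integrable fun p : ℝ => (m * (p : ℂ) ^ (m - 1)) * g (u, p) := by
    have := (SchwartzCyl.integrable_moment (⟨_, h.mem⟩ : SchwartzCyl n) u (m - 1)).const_mul (m : ℂ)
    refine this.congr (Eventually.of_forall fun p => ?_)
    simp only [mul_assoc]
  have := integral_mul_deriv_eq_deriv_mul_of_integrable (fun p _ => hu p) (fun p _ => hd p)
    i1 i3 i2
  rw [this]
  simp only [mul_assoc]
  rw [integral_const_mul, h.moment, mul_zero, neg_zero]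

/-- Freezing `p` turns `g(·, p)` into a function on the cylinder that is constant in the second
variable. The derivative estimates then apply for each `p` separately, with a bound that decays in
`p`. -/
lemma smoothCyl_frozen {g : Cyl n → ℂ} (h : SmoothCyl g) (p : ℝ) :
    SmoothCyl (fun z : Cyl n => g (z.1, p)) := by
  have := smoothCyl_of_contDiffAt (n := n) (G := fun z => cylExt g (z.1, p)) fun z hz =>
    ContDiffAt.comp (f := fun z : Euc n × ℝ => (z.1, p)) z
      (h.contDiffAt_cylExt (z := (z.1, p)) hz) (by fun_prop)
  simpa only [cylExt_coe] using this

lemma norm_mixedCyl_frozen_le (g : Cyl n → ℂ) (p : ℝ) (q k : ℕ) (z : Cyl n) :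
    ‖mixedCyl q k (fun z : Cyl n => g (z.1, p)) z‖ ≤ ‖mixedCyl 0 k g (z.1, p)‖ := by
  have h1 : ∀ k : ℕ, ∀ g : Cyl n → ℂ, Ridgelet.lapCyl^[k] (fun z : Cyl n => g (z.1, p))
      = fun z => Ridgelet.lapCyl^[k] g (z.1, p) := by
    intro k
    induction k with
    | zero => exact fun _ => rfl
    | succ k ih => exact fun g => ih (Ridgelet.lapCyl g)
  rw [mixedCyl, h1]
  rcases q with _ | q
  · exact le_rfl
  · have h2 : Ridgelet.dpCyl (fun z : Cyl n => Ridgelet.lapCyl^[k] g (z.1, p)) = 0 := by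
      funext z
      simp [Ridgelet.dpCyl]
    have h3 : ∀ q : ℕ, Ridgelet.dpCyl^[q] (0 : Cyl n → ℂ) = 0 := by
      intro q
      refine Function.iterate_fixed ?_ q
      funext z
      simp [Ridgelet.dpCyl]
    rw [Function.iterate_succ_apply, h2, h3]
    simp

/-- For frozen `p`, elliptic regularity bounds all derivatives of the extension by the suprema of
Δ_u^k g(·, p), which are `O((1 + |p|)^{-(m+2)})`. This outweighs `|p| ^ m` and leaves an integrable
function of `p`. -/
lemma dominatedSmooth_moment {g : Cyl n → ℂ} (h : g ∈ schwartzCylSubmodule n) (m : ℕ) {r R : ℝ}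
    (hr : 0 < r) : DominatedSmooth (annulus n ℝ r R) Set.univ volume
      (fun z (p : ℝ) => (p : ℂ) ^ m * cylExt (fun z : Cyl n => g (z.1, p)) z) where
  smooth := by
    rintro ⟨z, p⟩ ⟨hz, -⟩
    have hz0 : z.1 ≠ 0 := norm_pos_iff.1 (hr.trans hz.1)
    refine ContDiffAt.contDiffWithinAt (ContDiffAt.mul ?_ ?_)
    · exact (Complex.ofRealCLM.contDiff.contDiffAt.comp _ contDiffAt_snd).pow m
    · exact ContDiffAt.comp (g := cylExt g) (f := fun w : (Euc n × ℝ) × ℝ => (w.1.1, w.2)) (z, p)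
        (h.1.contDiffAt_cylExt (z := (z.1, p)) hz0) (by fun_prop)
  bound j := by
    obtain ⟨C, hC0, hC⟩ := exists_norm_iteratedFDeriv_cylExt_le n j r R hr
    have hA : ∀ k : ℕ, ∃ A : ℝ, ∀ u p, (1 + |p|) ^ (m + 2) * ‖mixedCyl 0 k g (u, p)‖ ≤ A := by
      intro k
      obtain ⟨A, hA⟩ := h.2 (m + 2) 0 k
      exact ⟨A, fun u p => hA ⟨(u, p), rfl⟩⟩
    choose A hA using hA
    set A' := ∑ k ∈ Finset.range (j + 1), |A k|
    have hA' : ∀ k ≤ j, ∀ u p, ‖mixedCyl 0 k g (u, p)‖ ≤ A' / (1 + |p|) ^ (m + 2) := by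
      intro k hk u p
      rw [le_div_iff₀ (by positivity), mul_comm]
      exact ((hA k u p).trans (le_abs_self _)).trans (Finset.single_le_sum (f := fun k => |A k|)
        (fun _ _ => abs_nonneg _) (Finset.mem_range.2 (by omega)))
    refine ⟨fun p => C * A' * ((1 + |p|) ^ 2)⁻¹, ?_, fun z hz p _ => ?_⟩
    · exact (integrable_inv_one_add_sq.const_mul _).integrableOn
    · have hz0 : z.1 ≠ 0 := norm_pos_iff.1 (hr.trans hz.1)
      have hsm := smoothCyl_frozen h.1 p
      have h1 := iteratedFDeriv_const_smul_apply (a := (p : ℂ) ^ m) (i := j)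
        ((hsm.contDiffAt_cylExt hz0).of_le (WithTop.coe_le_coe.2 le_top))
      change ‖iteratedFDeriv ℝ j ((p : ℂ) ^ m • cylExt (fun z : Cyl n => g (z.1, p))) z‖ ≤ _
      rw [h1, norm_smul, norm_pow, Complex.norm_real, Real.norm_eq_abs]
      have h2 := hC _ (A' / (1 + |p|) ^ (m + 2)) hsm (fun q _ k hk z =>
        (norm_mixedCyl_frozen_le g p q k z).trans (hA' k hk z.1 p)) z hz.1.le hz.2.le j le_rfl
      have hA0 : 0 ≤ A' := Finset.sum_nonneg fun _ _ => abs_nonneg _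
      calc |p| ^ m * ‖iteratedFDeriv ℝ j (cylExt fun z : Cyl n => g (z.1, p)) z‖
          ≤ (1 + |p|) ^ m * (C * (A' / (1 + |p|) ^ (m + 2))) := by
            gcongr
            linarith [abs_nonneg p]
        _ = _ := by
            have : (1 + |p|) ≠ 0 := by positivity
            field_simp
            ring

/-- The moment of order `m`, as a function of the sphere variable, is identically zero. Applying the
Laplacian to it under the integral sign yields the moment of Δ_u g. -/
lemma lapCyl {g : Cyl n → ℂ} (h : IsLizorkinCyl g) : IsLizorkinCyl (lapCyl g) := by
  have hs : SmoothCyl g := h.mem.1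
  refine ⟨⟨hs.lapCyl, fun N q k => h.mem.2 N q (k + 1)⟩, fun u m => ?_⟩
  set z : Euc n × ℝ := ((u : Euc n), 0) with hzdef
  have hz : z.1 ≠ 0 := ne_zero_coe u
  have hr : 0 < ‖z.1‖ / 2 := half_pos (norm_pos_iff.2 hz)
  have key := (dominatedSmooth_moment h.mem m hr (R := 2 * ‖z.1‖)).sqSum_integral isOpen_annulus
    isOpen_univ (mem_annulus hz) horizontal
  simp only [Measure.restrict_univ, cylExt, h.moment] at key
  have h0 : sqSum horizontal (fun _ : Euc n × ℝ => (0 : ℂ)) z = 0 := by simp [sqSum]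
  rw [h0] at key
  rw [key]
  refine integral_congr_ae (Eventually.of_forall fun p => ?_)
  have hsm := smoothCyl_frozen hs p
  have h2 := sqSum_clm_comp (e := horizontal) (ContinuousLinearMap.mul ℝ ℂ ((p : ℂ) ^ m))
    ((hsm.contDiffAt_cylExt hz).of_le (WithTop.coe_le_coe.2 le_top))
  refine Eq.trans ?_ h2.symm
  rw [hzdef, ← lapCyl_eq_sqSum hsm]
  rfl

lemma mixedCyl {g : Cyl n → ℂ} (h : IsLizorkinCyl g) (q k : ℕ) :
    IsLizorkinCyl (mixedCyl q k g) := by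
  have h1 : ∀ k : ℕ, ∀ {g : Cyl n → ℂ}, IsLizorkinCyl g →
      IsLizorkinCyl (Ridgelet.lapCyl^[k] g) := by
    intro k
    induction k with
    | zero => exact fun h => h
    | succ k ih => exact fun h => ih h.lapCyl
  have h2 : ∀ q : ℕ, ∀ {g : Cyl n → ℂ}, IsLizorkinCyl g →
      IsLizorkinCyl (Ridgelet.dpCyl^[q] g) := by
    intro q
    induction q with
    | zero => exact fun h => h
    | succ q ih => exact fun h => ih h.dpCyl
  exact h2 q (h1 k h)

end IsLizorkinCyl

lemma LizorkinCyl.isLizorkinCyl (g : LizorkinCyl n) :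
    IsLizorkinCyl ((g : SchwartzCyl n) : Cyl n → ℂ) := ⟨g.1.2, g.2⟩

/-! ### The wavelet transform -/

lemma integrable_mul_comp_affine (φ : 𝓢(ℝ, ℂ)) {f : ℝ → ℂ} (hf : Continuous f) {A : ℝ}
    (hA : ∀ p, ‖f p‖ ≤ A) (a b : ℝ) : Integrable fun t : ℝ => φ t * f (b + a * t) :=
  φ.integrable.mul_bdd (c := A) (by fun_prop) (Eventually.of_forall fun t => hA _)

lemma SchwartzCyl.continuous (g : SchwartzCyl n) : Continuous (g : Cyl n → ℂ) :=
  ContMDiff.continuous g.2.1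

lemma SchwartzCyl.integrable (g : SchwartzCyl n) (u : Sph n) : Integrable fun p : ℝ => g (u, p) := by
  simpa using g.integrable_moment u 0

lemma integrable_waveletIntegrand (ψ : 𝓢(ℝ, ℂ)) (g : SchwartzCyl n) (u : Sph n) (b : ℝ)
    (a : posReal) : Integrable (waveletIntegrand ψ g u b a) := by
  refine (g.integrable u).bdd_mul
    (c := ‖(1 / ((a : ℝ) : ℂ))‖ * schwartzBound 0 0 ψ)
    (f := fun p : ℝ => (1 / ((a : ℝ) : ℂ)) * conj (ψ ((p - b) / (a : ℝ)))) ?_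
    (Eventually.of_forall fun p => ?_)
  · have := ψ.continuous
    have h2 : Continuous fun p : ℝ => (p - b) / (a : ℝ) := by fun_prop
    exact (continuous_const.mul
      (Complex.continuous_conj.comp (this.comp h2))).aestronglyMeasurable
  · rw [norm_mul, RCLike.norm_conj]
    gcongr
    simpa using pow_mul_norm_le ψ 0 ((p - b) / (a : ℝ))

lemma waveletTransform_eq_waveletFn (ψ : 𝓢(ℝ, ℂ)) (g : Cyl n → ℂ) (u : Sph n) (b : ℝ)
    (a : posReal) : waveletTransform ψ g u b a = waveletFn (conjS ψ) g (u, b, a) := by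
  have ha : 0 < (a : ℝ) := a.2
  have h := integral_comp_affine (fun p : ℝ => conj (ψ ((p - b) / (a : ℝ))) * g (u, p)) ha b
  simp only [add_sub_cancel_left, mul_div_cancel_left₀ _ ha.ne'] at h
  simp only [waveletFn, conjS_apply]
  rw [h, waveletTransform, ← integral_const_mul]
  simp only [waveletIntegrand, one_div, mul_assoc]

/-- This is the conjugate of the moment of `ψ` of order `k + l`, as `t` is real. -/
lemma moment_mulVar_conjS (ψ : LizorkinR) (l k : ℕ) :
    ∫ t : ℝ, (t : ℂ) ^ k * mulVar^[l] (conjS ψ) t = 0 := by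
  have h := congrArg conj (ψ.2 (k + l))
  rw [← integral_conj, map_zero] at h
  rw [← h]
  refine integral_congr_ae (Eventually.of_forall fun t => ?_)
  simp only [mulVar_iterate_apply, conjS_apply, map_mul, map_pow, Complex.conj_ofReal]
  ring

/-- The continuous factor that carries the dependence on `ψ` in the bounds for `𝒲`. -/
def waveletBound (s r l : ℕ) (ψ : 𝓢(ℝ, ℂ)) : ℝ :=
  schwartzBound r (s + r + 1) (mulVar^[l] (conjS ψ))
    + schwartzBound (s + 1 + r + 2) 0 (mulVar^[l] (conjS ψ))

lemma continuous_waveletBound (s r l : ℕ) : Continuous (waveletBound s r l) := by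
  have h : Continuous fun ψ : 𝓢(ℝ, ℂ) => mulVar^[l] (conjS ψ) :=
    (mulVar.continuous.iterate l).comp conjS.continuous
  exact ((continuous_schwartzBound _ _).comp h).add ((continuous_schwartzBound _ _).comp h)

lemma waveletBound_zero (s r l : ℕ) : waveletBound s r l 0 = 0 := by
  simp [waveletBound]

/-- The decay estimate asks for two weighted bounds on each function, one for small and one for
large scales. The sum of two seminorms serves both at once. -/
lemma weightY_mul_norm_mixedY_waveletFn_le (g : LizorkinCyl n) (ψ : LizorkinR) (s r l m k : ℕ)
    (y : YSp n) :
    weightY s r y * ‖mixedY l m k (waveletFn (conjS ψ) (g : SchwartzCyl n)) y‖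
      ≤ (2 * decayConst * (SchwartzCyl.rho (r, s + 1 + (l + m), k) (g : SchwartzCyl n)
          + SchwartzCyl.rho (s + r + 1 + r + 2, l + m, k) (g : SchwartzCyl n)))
        * waveletBound s r l ψ := by
  obtain ⟨u, b, a⟩ := y
  rw [(g : SchwartzCyl n).bddCyl.mixedY_waveletFn]
  have hL := (LizorkinCyl.isLizorkinCyl g).mixedCyl (l + m) k
  have h0 : ∀ i, 0 ≤ SchwartzCyl.rho i (g : SchwartzCyl n) := fun i => apply_nonneg _ _
  have h1 : ∀ i j, 0 ≤ schwartzBound i j (mulVar^[l] (conjS ψ)) := fun i j => apply_nonneg _ _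
  have key := weighted_norm_integral_affine_le
    (f := fun p => mixedCyl (l + m) k (g : SchwartzCyl n) (u, p))
    (φ := mulVar^[l] (conjS ψ)) s r (hL.mem.1.contDiff_slice u) (SchwartzMap.smooth _ ⊤)
    (A := SchwartzCyl.rho (r, s + 1 + (l + m), k) (g : SchwartzCyl n)
          + SchwartzCyl.rho (s + r + 1 + r + 2, l + m, k) (g : SchwartzCyl n))
    (B := waveletBound s r l ψ)
    (fun p => by
      rw [norm_iteratedFDeriv_slice_mixedCyl]
      exact ((g : SchwartzCyl n).le_rho _ _ _ u p).trans (le_add_of_nonneg_right (h0 _)))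
    (fun p => ((g : SchwartzCyl n).le_rho _ _ _ u p).trans (le_add_of_nonneg_left (h0 _)))
    (fun t => (pow_mul_norm_iteratedFDeriv_le _ _ _ t).trans (le_add_of_nonneg_right (h1 _ _)))
    (fun t => (pow_mul_norm_le _ _ t).trans (le_add_of_nonneg_left (h1 _ _)))
    (fun j => hL.moment u j) (fun j => moment_mulVar_conjS ψ l j) (show 0 < (a : ℝ) from a.2) b
  refine le_trans key (le_of_eq ?_)
  ring

/-- The wavelet transform as a map `𝒮₀(𝕊^{n-1} × ℝ) × 𝒮₀(ℝ) → 𝒮(𝕐^{n+1})`. -/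
def waveletMap (x : LizorkinCyl n × LizorkinR) : SchwartzY n :=
  ⟨waveletFn (conjS x.2) (x.1 : SchwartzCyl n),
    (x.1 : SchwartzCyl n).bddCyl.smoothY_waveletFn _, fun s r l m k =>
      ⟨_, Set.forall_mem_range.2 (weightY_mul_norm_mixedY_waveletFn_le x.1 x.2 s r l m k)⟩⟩

lemma SchwartzCyl.norm_apply_le (g : SchwartzCyl n) (z : Cyl n) :
    ‖g z‖ ≤ SchwartzCyl.rho (0, 0, 0) g := by
  have := g.le_rho 0 0 0 z.1 z.2
  rwa [pow_zero, one_mul] at this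

lemma SchwartzCyl.integrable_mul_comp_affine (g : SchwartzCyl n) (φ : 𝓢(ℝ, ℂ)) (u : Sph n)
    (a b : ℝ) : Integrable fun t : ℝ => φ t * g (u, b + a * t) :=
  Ridgelet.integrable_mul_comp_affine φ (f := fun p => g (u, p))
    (g.continuous.comp (by fun_prop)) (fun p => g.norm_apply_le _) a b

lemma continuous_waveletMap : Continuous (waveletMap (n := n)) := by
  refine continuous_of_biadditive_of_le SchwartzY.withSeminorms waveletMap ?_ ?_ ?_
  · intro g g' ψ
    refine Subtype.ext (funext fun y => ?_)
    refine Eq.trans ?_ (integral_add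
      ((g : SchwartzCyl n).integrable_mul_comp_affine (conjS ψ) y.1 y.2.2 y.2.1)
      ((g' : SchwartzCyl n).integrable_mul_comp_affine (conjS ψ) y.1 y.2.2 y.2.1))
    exact integral_congr_ae (Eventually.of_forall fun t => mul_add _ _ _)
  · intro g ψ ψ'
    refine Subtype.ext (funext fun y => ?_)
    refine Eq.trans ?_ (integral_add
      ((g : SchwartzCyl n).integrable_mul_comp_affine (conjS ψ) y.1 y.2.2 y.2.1)
      ((g : SchwartzCyl n).integrable_mul_comp_affine (conjS ψ') y.1 y.2.2 y.2.1))
    refine integral_congr_ae (Eventually.of_forall fun t => ?_)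
    have h : conjS ((ψ + ψ' : LizorkinR) : 𝓢(ℝ, ℂ)) t = conjS ψ t + conjS ψ' t := by simp
    exact (congrArg (· * (g : SchwartzCyl n) (y.1, y.2.1 + y.2.2 * t)) h).trans (add_mul _ _ _)
  · rintro ⟨s, r, l, m, k⟩
    refine ⟨fun g => 2 * decayConst * (SchwartzCyl.rho (r, s + 1 + (l + m), k) (g : SchwartzCyl n)
          + SchwartzCyl.rho (s + r + 1 + r + 2, l + m, k) (g : SchwartzCyl n)),
      fun ψ => waveletBound s r l ψ, ?_, (continuous_waveletBound s r l).comp continuous_subtype_val,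
      by simp, waveletBound_zero s r l, fun g ψ => ?_⟩
    · have h : ∀ i, Continuous fun g : LizorkinCyl n => SchwartzCyl.rho i (g : SchwartzCyl n) :=
        fun i => (SchwartzCyl.withSeminorms.continuous_seminorm i).comp continuous_subtype_val
      exact continuous_const.mul ((h _).add (h _))
    -- A supremum is bounded through `ciSup_le` over a nonempty type; `radial 0` is the default
    -- point of the sphere.
    · have : Nonempty (YSp n) := ⟨(radial 0, 0, toPos 1)⟩
      exact ciSup_le (weightY_mul_norm_mixedY_waveletFn_le g ψ s r l m k)

/-! ### Derivatives of the wavelet synthesis operator -/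

/-- The restriction of a function on `𝕐^{n+1}` to fixed `a`. -/
def sliceY (Φ : YSp n → ℂ) (a : posReal) (z : Cyl n) : ℂ := Φ (z.1, z.2, a)

lemma SmoothY.smoothCyl_sliceY {Φ : YSp n → ℂ} (h : SmoothY Φ) (a : posReal) :
    SmoothCyl (sliceY Φ a) := by
  have h1 : ContMDiff ((𝓡 (n - 1)).prod 𝓘(ℝ, ℝ)) ((𝓡 (n - 1)).prod (𝓘(ℝ, ℝ).prod 𝓘(ℝ, ℝ))) ∞
      (fun z : Cyl n => ((z.1, z.2, a) : YSp n)) :=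
    contMDiff_fst.prodMk (contMDiff_snd.prodMk contMDiff_const)
  exact ContMDiff.comp h h1

lemma mixedCyl_sliceY (Φ : YSp n → ℂ) (a : posReal) (q k : ℕ) :
    mixedCyl q k (sliceY Φ a) = sliceY (mixedY 0 q k Φ) a := by
  have h1 : ∀ k : ℕ, ∀ Φ : YSp n → ℂ, lapCyl^[k] (sliceY Φ a) = sliceY (lapY^[k] Φ) a := by
    intro k
    induction k with
    | zero => exact fun _ => rfl
    | succ k ih => exact fun Φ => ih (lapY Φ)
  have h2 : ∀ q : ℕ, ∀ Φ : YSp n → ℂ, dpCyl^[q] (sliceY Φ a) = sliceY (dbY^[q] Φ) a := by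
    intro q
    induction q with
    | zero => exact fun _ => rfl
    | succ q ih => exact fun Φ => ih (dbY Φ)
  rw [mixedCyl, h1, h2]
  rfl

/-- For fixed `a` this is the commutation of Δ_u and ∂_p on the cylinder. -/
lemma mixedY_dbY {Φ : YSp n → ℂ} (h : SmoothY Φ) (q k : ℕ) :
    mixedY 0 q k (dbY Φ) = mixedY 0 (q + 1) k Φ := by
  funext ⟨u, b, a⟩
  have h1 := mixedCyl_dpCyl (h.smoothCyl_sliceY a) q k
  rw [mixedCyl_sliceY] at h1
  exact (congrFun (mixedCyl_sliceY (dbY Φ) a q k) (u, b)).symm.trans (congrFun h1 (u, b))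

/-- Smooth functions on `𝕐^{n+1}` for which all the functions `(a + 1/a) ∂_b^q Δ_u^k Φ` are
bounded. -/
structure BddY (Φ : YSp n → ℂ) : Prop where
  smooth : SmoothY Φ
  bdd : ∀ q k : ℕ, ∃ A : ℝ, ∀ y : YSp n,
    ((y.2.2 : ℝ) + 1 / (y.2.2 : ℝ)) * ‖mixedY 0 q k Φ y‖ ≤ A

lemma SchwartzY.bddY (Φ : SchwartzY n) : BddY (Φ : YSp n → ℂ) where
  smooth := Φ.2.1
  bdd q k := by
    obtain ⟨A, hA⟩ := Φ.2.2 1 0 0 q k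
    exact ⟨A, fun y => by simpa [weightY] using hA ⟨y, rfl⟩⟩

/-- The domain of the integral that defines the synthesis operator, with points `(t, a)`. -/
def halfPlane : Set (ℝ × ℝ) := Set.univ ×ˢ Set.Ioi 0

lemma isOpen_halfPlane : IsOpen halfPlane := isOpen_univ.prod isOpen_Ioi

lemma pos_of_mem_halfPlane {x : ℝ × ℝ} (hx : x ∈ halfPlane) : 0 < x.2 := hx.2

lemma volume_restrict_halfPlane : (volume : Measure (ℝ × ℝ)).restrict halfPlane
    = (volume : Measure ℝ).prod (volume.restrict (Set.Ioi (0 : ℝ))) := by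
  rw [halfPlane, Measure.volume_eq_prod, ← Measure.prod_restrict, Measure.restrict_univ]

/-- `ψ(t) Φ(u, p - a t, a) / a`. -/
def synthesisKernel (ψ : ℝ → ℂ) (Φ : YSp n → ℂ) (z : Cyl n) (x : ℝ × ℝ) : ℂ :=
  (ψ x.1 * (x.2 : ℂ)⁻¹) * Φ (z.1, z.2 - x.2 * x.1, toPos x.2)

/-- The synthesis operator, written as an integral over the wavelet variable and the scale. -/
def synthesisFn (ψ : ℝ → ℂ) (Φ : YSp n → ℂ) (z : Cyl n) : ℂ :=
  ∫ x in halfPlane, synthesisKernel ψ Φ z x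

/-- The kernel as a function on `ℝⁿ × ℝ`. -/
def synthesisKernelExt (ψ : ℝ → ℂ) (Φ : YSp n → ℂ) (z : Euc n × ℝ) (x : ℝ × ℝ) : ℂ :=
  (ψ x.1 * (x.2 : ℂ)⁻¹) •
    cylExt (sliceY Φ (toPos x.2)) ((0, -(x.2 * x.1)) + ContinuousLinearMap.id ℝ (Euc n × ℝ) z)

lemma synthesisKernelExt_eq (ψ : ℝ → ℂ) (Φ : YSp n → ℂ) (z : Euc n × ℝ) (x : ℝ × ℝ) :
    synthesisKernelExt ψ Φ z x = synthesisKernel ψ Φ (radial z.1, z.2) x := by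
  simp [synthesisKernelExt, synthesisKernel, cylExt, sliceY, neg_add_eq_sub]

lemma cylExt_synthesisFn (ψ : ℝ → ℂ) (Φ : YSp n → ℂ) :
    cylExt (synthesisFn ψ Φ) = fun z => ∫ x in halfPlane, synthesisKernelExt ψ Φ z x := by
  funext z
  simp only [synthesisKernelExt_eq]
  rfl

lemma integrableOn_halfPlane {f : ℝ → ℝ} (hf : Integrable f) :
    IntegrableOn (fun x : ℝ × ℝ => f x.1 * (1 + x.2 ^ 2)⁻¹) halfPlane :=
  (hf.mul_prod (_root_.integrable_inv_one_add_sq)).integrableOn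

namespace BddY

lemma dbY {Φ : YSp n → ℂ} (h : BddY Φ) : BddY (dbY Φ) where
  smooth := h.smooth.dbY
  bdd q k := by rw [mixedY_dbY h.smooth]; exact h.bdd (q + 1) k

lemma lapY {Φ : YSp n → ℂ} (h : BddY Φ) : BddY (lapY Φ) where
  smooth := h.smooth.lapY
  bdd q k := h.bdd q (k + 1)

lemma exists_bound {Φ : YSp n → ℂ} (h : BddY Φ) (m : ℕ) :
    ∃ A : ℝ, 0 ≤ A ∧ ∀ q ≤ 2 * m, ∀ k ≤ m, ∀ (a : posReal) (z : Cyl n),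
      ‖mixedCyl q k (sliceY Φ a) z‖ ≤ A / ((a : ℝ) + 1 / (a : ℝ)) := by
  choose A hA using h.bdd
  refine ⟨∑ q ∈ Finset.range (2 * m + 1), ∑ k ∈ Finset.range (m + 1), |A q k|,
    Finset.sum_nonneg fun _ _ => Finset.sum_nonneg fun _ _ => abs_nonneg _,
    fun q hq k hk a z => ?_⟩
  have ha : 0 < (a : ℝ) := a.2
  rw [mixedCyl_sliceY, le_div_iff₀ (by positivity), mul_comm]
  calc _ ≤ |A q k| := (hA q k (z.1, z.2, a)).trans (le_abs_self _)
    _ ≤ ∑ k ∈ Finset.range (m + 1), |A q k| :=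
      Finset.single_le_sum (f := fun k => |A q k|) (fun _ _ => abs_nonneg _)
        (Finset.mem_range.2 (by omega))
    _ ≤ _ := Finset.single_le_sum (f := fun q => ∑ k ∈ Finset.range (m + 1), |A q k|)
        (fun _ _ => Finset.sum_nonneg fun _ _ => abs_nonneg _) (Finset.mem_range.2 (by omega))

lemma contDiffAt_translate {Φ : YSp n → ℂ} (h : BddY Φ) (a : posReal) (c : ℝ) {z : Euc n × ℝ}
    (hz : z.1 ≠ 0) :
    ContDiffAt ℝ ∞ (cylExt (sliceY Φ a)) ((0, c) + ContinuousLinearMap.id ℝ (Euc n × ℝ) z) :=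
  (h.smooth.smoothCyl_sliceY a).contDiffAt_cylExt (by simpa using hz)

lemma dominatedSmooth {Φ : YSp n → ℂ} (h : BddY Φ) (ψ : 𝓢(ℝ, ℂ)) {r R : ℝ} (hr : 0 < r) :
    DominatedSmooth (annulus n ℝ r R) halfPlane volume (synthesisKernelExt ψ Φ) where
  smooth := by
    rintro ⟨z, t, a⟩ ⟨hz, ht⟩
    have hz0 : z.1 ≠ 0 := norm_pos_iff.1 (hr.trans hz.1)
    have ha : 0 < a := pos_of_mem_halfPlane ht
    have e : (fun w : (Euc n × ℝ) × ℝ × ℝ => synthesisKernelExt ψ Φ w.1 w.2)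
        = fun w => (ψ w.2.1 * (w.2.2 : ℂ)⁻¹) *
          extY Φ (w.1.1, w.1.2 - w.2.2 * w.2.1, w.2.2) := by
      funext w
      rw [synthesisKernelExt_eq]
      rfl
    rw [e]
    refine ContDiffAt.contDiffWithinAt (ContDiffAt.mul (ContDiffAt.mul ?_ ?_) ?_)
    · exact ContDiffAt.comp (f := fun w : (Euc n × ℝ) × ℝ × ℝ => w.2.1) _
        (ψ.smooth ⊤).contDiffAt contDiffAt_snd.fst
    · refine ContDiffAt.inv ?_ (by simpa using ha.ne')
      exact Complex.ofRealCLM.contDiff.contDiffAt.comp _ contDiffAt_snd.snd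
    · exact ContDiffAt.comp (g := extY Φ)
        (f := fun w : (Euc n × ℝ) × ℝ × ℝ => (w.1.1, w.1.2 - w.2.2 * w.2.1, w.2.2)) (z, t, a)
        (h.smooth.contDiffAt_extY hz0 ha) (by fun_prop)
  bound j := by
    obtain ⟨C, hC0, hC⟩ := exists_norm_iteratedFDeriv_cylExt_le n j r R hr
    obtain ⟨A, hA0, hA⟩ := h.exists_bound j
    -- The weight on Φ gives `A / (a + 1 / a)`. With the factor `1 / a` of the kernel this is `A /
    -- (1 + a ^ 2)`, integrable over all scales.
    refine ⟨fun x => C * A * (‖ψ x.1‖ * (1 + x.2 ^ 2)⁻¹), ?_, ?_⟩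
    · exact (integrableOn_halfPlane ψ.integrable.norm).const_mul (C * A)
    · rintro z hz ⟨t, a⟩ ht
      have hz0 : z.1 ≠ 0 := norm_pos_iff.1 (hr.trans hz.1)
      have ha : 0 < a := pos_of_mem_halfPlane ht
      have hc := h.contDiffAt_translate (toPos a) (-(a * t)) hz0
      have h1 := iteratedFDeriv_const_smul_apply (𝕜 := ℝ) (a := ψ t * (a : ℂ)⁻¹) (i := j)
        (f := fun z => cylExt (sliceY Φ (toPos a)) ((0, -(a * t)) + z)) (x := z)
        ((ContDiffAt.comp (f := fun z => (0, -(a * t)) + z) z hc (by fun_prop)).of_le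
          (WithTop.coe_le_coe.2 le_top))
      change ‖iteratedFDeriv ℝ j ((ψ t * (a : ℂ)⁻¹) •
        fun z => cylExt (sliceY Φ (toPos a)) ((0, -(a * t)) + z)) z‖ ≤ _
      rw [h1, norm_smul, iteratedFDeriv_comp_add_left, norm_mul, norm_inv, Complex.norm_real,
        Real.norm_of_nonneg ha.le]
      have h2 := hC _ _ (h.smooth.smoothCyl_sliceY (toPos a)) (fun q hq k hk z =>
        hA q hq k hk (toPos a) z) ((0, -(a * t)) + z) (by simpa using hz.1.le)
        (by simpa using hz.2.le) j le_rfl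
      rw [coe_toPos ha] at h2
      calc _ ≤ ‖ψ t‖ * a⁻¹ * (C * (A / (a + 1 / a))) := by gcongr
        _ = _ := by
          have : 1 + a ^ 2 ≠ 0 := by positivity
          have h3 : a + 1 / a = (1 + a ^ 2) / a := by field_simp; ring
          simp only [h3]
          field_simp

lemma contDiffAt_synthesis {Φ : YSp n → ℂ} (h : BddY Φ) (ψ : 𝓢(ℝ, ℂ)) {z : Euc n × ℝ}
    (hz : z.1 ≠ 0) : ContDiffAt ℝ ∞ (cylExt (synthesisFn ψ Φ)) z := by
  rw [cylExt_synthesisFn]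
  have hr : 0 < ‖z.1‖ / 2 := half_pos (norm_pos_iff.2 hz)
  have := (h.dominatedSmooth ψ hr (R := 2 * ‖z.1‖)).contDiffOn_integral isOpen_annulus
    isOpen_halfPlane
  exact this.contDiffAt (isOpen_annulus.mem_nhds (mem_annulus hz))

lemma smoothCyl_synthesisFn {Φ : YSp n → ℂ} (h : BddY Φ) (ψ : 𝓢(ℝ, ℂ)) :
    SmoothCyl (synthesisFn ψ Φ) := by
  have := smoothCyl_of_contDiffAt (G := cylExt (synthesisFn ψ Φ)) fun z hz =>
    h.contDiffAt_synthesis ψ hz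
  simpa only [cylExt_coe] using this

lemma integrableOn_synthesisKernel {Φ : YSp n → ℂ} (h : BddY Φ) (ψ : 𝓢(ℝ, ℂ)) (u : Sph n)
    (p : ℝ) : IntegrableOn (synthesisKernel ψ Φ (u, p)) halfPlane := by
  set z : Euc n × ℝ := ((u : Euc n), p) with hzdef
  have hz : z.1 ≠ 0 := ne_zero_coe u
  have hr : 0 < ‖z.1‖ / 2 := half_pos (norm_pos_iff.2 hz)
  have key := (h.dominatedSmooth ψ hr (R := 2 * ‖z.1‖)).integrableOn isOpen_halfPlane
    (mem_annulus hz)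
  have e : synthesisKernelExt ψ Φ z = synthesisKernel ψ Φ (u, p) := by
    funext x
    rw [synthesisKernelExt_eq, hzdef, radial_coe]
  rwa [e] at key

/-- In the variables `(t, a)` the kernel depends on `p` only through the translated argument of Φ,
so ∂_p becomes ∂_b. -/
lemma dpCyl_synthesisFn {Φ : YSp n → ℂ} (h : BddY Φ) (ψ : 𝓢(ℝ, ℂ)) :
    dpCyl (synthesisFn ψ Φ) = synthesisFn ψ (Ridgelet.dbY Φ) := by
  funext ⟨u, p⟩
  set z : Euc n × ℝ := ((u : Euc n), p) with hzdef
  have hz : z.1 ≠ 0 := ne_zero_coe u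
  have hr : 0 < ‖z.1‖ / 2 := half_pos (norm_pos_iff.2 hz)
  have key := (h.dominatedSmooth ψ hr (R := 2 * ‖z.1‖)).fderiv_integral_apply isOpen_annulus
    isOpen_halfPlane (mem_annulus hz) (0, 1)
  have h0 := cylExt_dpCyl (h.smoothCyl_synthesisFn ψ) hz
  rw [cylExt_coe, cylExt_synthesisFn, key] at h0
  rw [h0]
  refine setIntegral_congr_fun isOpen_halfPlane.measurableSet fun x _ => ?_
  have h1 := h.contDiffAt_translate (toPos x.2) (-(x.2 * x.1)) hz
  have h2 : HasFDerivAt (fun z => (0, -(x.2 * x.1)) + ContinuousLinearMap.id ℝ (Euc n × ℝ) z)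
      (ContinuousLinearMap.id ℝ (Euc n × ℝ)) z :=
    (ContinuousLinearMap.id ℝ (Euc n × ℝ)).hasFDerivAt.const_add _
  have h3 := (((h1.differentiableAt (by simp)).hasFDerivAt.comp z h2).const_smul
    (ψ x.1 * (x.2 : ℂ)⁻¹)).fderiv
  refine (congrArg (fun L => L (0, 1)) h3).trans ?_
  have h4 := cylExt_dpCyl (h.smooth.smoothCyl_sliceY (toPos x.2))
    (z := (0, -(x.2 * x.1)) + ContinuousLinearMap.id ℝ (Euc n × ℝ) z) (by simpa using hz)
  change (ψ x.1 * (x.2 : ℂ)⁻¹) • fderiv ℝ (cylExt (sliceY Φ (toPos x.2))) _ (0, 1) = _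
  rw [← h4, synthesisKernel, smul_eq_mul]
  congr 1
  simp [hzdef, cylExt, radial_coe, neg_add_eq_sub]
  rfl

lemma lapCyl_synthesisFn {Φ : YSp n → ℂ} (h : BddY Φ) (ψ : 𝓢(ℝ, ℂ)) :
    lapCyl (synthesisFn ψ Φ) = synthesisFn ψ (Ridgelet.lapY Φ) := by
  funext ⟨u, p⟩
  set z : Euc n × ℝ := ((u : Euc n), p) with hzdef
  have hz : z.1 ≠ 0 := ne_zero_coe u
  have hr : 0 < ‖z.1‖ / 2 := half_pos (norm_pos_iff.2 hz)
  have key := (h.dominatedSmooth ψ hr (R := 2 * ‖z.1‖)).sqSum_integral isOpen_annulus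
    isOpen_halfPlane (mem_annulus hz) horizontal
  rw [lapCyl_eq_sqSum (h.smoothCyl_synthesisFn ψ), cylExt_synthesisFn, key]
  refine setIntegral_congr_fun isOpen_halfPlane.measurableSet fun x _ => ?_
  have h1 : ContDiffAt ℝ 2 (cylExt (sliceY Φ (toPos x.2)))
      ((0, -(x.2 * x.1)) + ContinuousLinearMap.id ℝ (Euc n × ℝ) z) :=
    (h.contDiffAt_translate (toPos x.2) (-(x.2 * x.1)) hz).of_le (WithTop.coe_le_coe.2 le_top)
  have h2 := sqSum_comp_add_right _ _ h1 horizontal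
  have h3 := sqSum_clm_comp (e := horizontal)
    (ContinuousLinearMap.mul ℝ ℂ (ψ x.1 * (x.2 : ℂ)⁻¹))
    (ContDiffAt.comp (f := fun z => (0, -(x.2 * x.1)) + ContinuousLinearMap.id ℝ (Euc n × ℝ) z)
      z h1 (by fun_prop))
  refine h3.trans ?_
  have h4 := lapCyl_eq_sqSum (h.smooth.smoothCyl_sliceY (toPos x.2)) u (p - x.2 * x.1)
  have h5 : ((0, -(x.2 * x.1)) + ContinuousLinearMap.id ℝ (Euc n × ℝ) z)
      = ((u : Euc n), p - x.2 * x.1) := by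
    simp [hzdef, neg_add_eq_sub]
  refine congrArg (fun w => ψ x.1 * (x.2 : ℂ)⁻¹ * w) (h2.trans ?_)
  rw [h5]
  exact h4.symm

lemma mixedCyl_synthesisFn {Φ : YSp n → ℂ} (h : BddY Φ) (ψ : 𝓢(ℝ, ℂ)) (q k : ℕ) :
    mixedCyl q k (synthesisFn ψ Φ) = synthesisFn ψ (mixedY 0 q k Φ) := by
  have h1 : ∀ k : ℕ, ∀ Φ : YSp n → ℂ, BddY Φ → BddY (Ridgelet.lapY^[k] Φ) ∧
      Ridgelet.lapCyl^[k] (synthesisFn ψ Φ) = synthesisFn ψ (Ridgelet.lapY^[k] Φ) := by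
    intro k
    induction k with
    | zero => exact fun _ h => ⟨h, rfl⟩
    | succ k ih =>
      intro Φ h
      rw [Function.iterate_succ_apply, Function.iterate_succ_apply, h.lapCyl_synthesisFn]
      exact ih _ h.lapY
  have h2 : ∀ q : ℕ, ∀ Φ : YSp n → ℂ, BddY Φ →
      Ridgelet.dpCyl^[q] (synthesisFn ψ Φ) = synthesisFn ψ (Ridgelet.dbY^[q] Φ) := by
    intro q
    induction q with
    | zero => exact fun _ _ => rfl
    | succ q ih =>
      intro Φ h
      rw [Function.iterate_succ_apply, Function.iterate_succ_apply, h.dpCyl_synthesisFn]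
      exact ih _ h.dbY
  rw [mixedCyl, (h1 k Φ h).2, h2 q _ (h1 k Φ h).1]
  rfl

end BddY

/-! ### Bounds for the wavelet synthesis operator -/

/-- From `(1 + |b|)² ≤ 4 (1 + b²)`; both sides are squared to remove the half-integer exponent. -/
lemma one_add_abs_pow_le (b : ℝ) (N : ℕ) :
    (1 + |b|) ^ N ≤ 2 ^ N * (1 + b ^ 2) ^ ((N : ℝ) / 2) := by
  have h1 : (1 + |b|) ^ 2 ≤ 4 * (1 + b ^ 2) := by nlinarith [sq_nonneg (1 - |b|), sq_abs b]
  have h2 : ((1 + b ^ 2) ^ ((N : ℝ) / 2)) ^ 2 = (1 + b ^ 2) ^ N := by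
    rw [← Real.rpow_natCast, ← Real.rpow_mul (by positivity),
      show (N : ℝ) / 2 * ((2 : ℕ) : ℝ) = N by push_cast; ring, Real.rpow_natCast]
  refine le_of_sq_le_sq ?_ (by positivity)
  calc ((1 + |b|) ^ N) ^ 2 = ((1 + |b|) ^ 2) ^ N := by rw [← pow_mul, ← pow_mul, mul_comm]
    _ ≤ (4 * (1 + b ^ 2)) ^ N := by gcongr
    _ = (2 ^ N * (1 + b ^ 2) ^ ((N : ℝ) / 2)) ^ 2 := by
      rw [mul_pow, mul_pow, h2, ← pow_mul, mul_comm N 2, pow_mul]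
      norm_num

/-- Explains the exponent `N + 1` of the scale weight: the left side is of order `1 / a` for small
`a` and `a ^ (N + 1)` for large `a`. The factor `1 + a ^ 2` is reserved for integrability in `a`. -/
lemma one_add_pow_div_mul_le {a : ℝ} (ha : 0 < a) (N : ℕ) :
    (1 + a) ^ N * (a⁻¹ * (1 + a ^ 2)) ≤ 2 ^ (N + 1) * (a ^ (N + 1) + 1 / a ^ (N + 1)) := by
  rcases le_total a 1 with h | h
  · have h1 : 1 / a ≤ 1 / a ^ (N + 1) := by
      refine one_div_le_one_div_of_le (by positivity) ?_
      rw [pow_succ]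
      exact mul_le_of_le_one_left ha.le (pow_le_one₀ ha.le h)
    calc (1 + a) ^ N * (a⁻¹ * (1 + a ^ 2)) ≤ 2 ^ N * (1 / a * 2) := by
          rw [one_div]
          gcongr <;> nlinarith
      _ = 2 ^ (N + 1) * (1 / a) := by ring
      _ ≤ 2 ^ (N + 1) * (a ^ (N + 1) + 1 / a ^ (N + 1)) := by
          gcongr
          exact h1.trans (le_add_of_nonneg_left (by positivity))
  · calc (1 + a) ^ N * (a⁻¹ * (1 + a ^ 2)) ≤ (2 * a) ^ N * (a⁻¹ * (2 * a ^ 2)) := by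
          gcongr <;> nlinarith
      _ = 2 ^ (N + 1) * a ^ (N + 1) := by field_simp; ring
      _ ≤ 2 ^ (N + 1) * (a ^ (N + 1) + 1 / a ^ (N + 1)) := by
          gcongr
          exact le_add_of_nonneg_right (by positivity)

/-- Peetre's inequality for `p = b + a t` spreads `(1 + |p|) ^ N` over the weights in `b`, `a` and
`t`. Two more powers in `t` and the factor `1 + a ^ 2` make the majorant integrable. The constant
collects `2 ^ (N + 1)` from the scale weight and `2 ^ N` from the weight in `b`. -/
lemma pow_mul_norm_synthesisKernel_le {ψ : ℝ → ℂ} {h : YSp n → ℂ} (N : ℕ) {A B : ℝ}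
    (hA : ∀ y, weightY (N + 1) N y * ‖h y‖ ≤ A)
    (hB : ∀ t, (1 + |t|) ^ (N + 2) * ‖ψ t‖ ≤ B) (u : Sph n) (p : ℝ) {x : ℝ × ℝ}
    (hx : x ∈ halfPlane) : (1 + |p|) ^ N * ‖synthesisKernel ψ h (u, p) x‖
      ≤ 2 ^ (2 * N + 1) * (A * B) * (((1 + |x.1|) ^ 2)⁻¹ * (1 + x.2 ^ 2)⁻¹) := by
  obtain ⟨t, a⟩ := x
  have ha : 0 < a := pos_of_mem_halfPlane hx
  have hA1 := hA (u, p - a * t, toPos a)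
  have hB1 := hB t
  simp only [weightY, coe_toPos ha] at hA1
  simp only [synthesisKernel, norm_mul, norm_inv, Complex.norm_real, Real.norm_of_nonneg ha.le]
  set b := p - a * t with hb
  set H := ‖h (u, b, toPos a)‖
  have h1 : 1 + |p| ≤ (1 + |b|) * ((1 + a) * (1 + |t|)) := by
    have e1 := one_add_abs_le_mul p (-(a * t))
    have e2 : 1 + |-(a * t)| ≤ (1 + a) * (1 + |t|) := by
      rw [abs_neg, abs_mul, abs_of_pos ha]
      nlinarith [abs_nonneg t]
    rw [← sub_eq_add_neg] at e1
    exact e1.trans (by gcongr)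
  rw [← mul_inv, ← div_eq_mul_inv (2 ^ (2 * N + 1) * (A * B)), le_div_iff₀ (by positivity)]
  calc (1 + |p|) ^ N * (‖ψ t‖ * a⁻¹ * H) * ((1 + |t|) ^ 2 * (1 + a ^ 2))
      ≤ ((1 + |b|) * ((1 + a) * (1 + |t|))) ^ N * (‖ψ t‖ * a⁻¹ * H)
        * ((1 + |t|) ^ 2 * (1 + a ^ 2)) := by gcongr
    _ = (((1 + a) ^ N * (a⁻¹ * (1 + a ^ 2))) * (1 + |b|) ^ N * H)
        * ((1 + |t|) ^ (N + 2) * ‖ψ t‖) := by rw [mul_pow, mul_pow]; ring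
    _ ≤ ((2 ^ (N + 1) * (a ^ (N + 1) + 1 / a ^ (N + 1)))
        * (2 ^ N * (1 + b ^ 2) ^ ((N : ℝ) / 2)) * H) * ((1 + |t|) ^ (N + 2) * ‖ψ t‖) := by
        have e1 := one_add_pow_div_mul_le ha N
        have e2 := one_add_abs_pow_le b N
        exact mul_le_mul_of_nonneg_right (mul_le_mul_of_nonneg_right
          (mul_le_mul e1 e2 (by positivity) (by positivity)) (norm_nonneg _)) (by positivity)
    _ = 2 ^ (2 * N + 1) * (((a ^ (N + 1) + 1 / a ^ (N + 1)) * (1 + b ^ 2) ^ ((N : ℝ) / 2) * H)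
        * ((1 + |t|) ^ (N + 2) * ‖ψ t‖)) := by ring
    _ ≤ 2 ^ (2 * N + 1) * (A * B) := by
        gcongr
        exact le_trans (by positivity) hA1

/-- The integral of the majorant of the synthesis kernel. -/
def synthesisConst : ℝ := ∫ x in halfPlane, ((1 + |x.1|) ^ 2)⁻¹ * (1 + x.2 ^ 2)⁻¹

lemma pow_mul_norm_synthesisFn_le {ψ : ℝ → ℂ} {h : YSp n → ℂ} (N : ℕ) {A B : ℝ}
    (hA : ∀ y, weightY (N + 1) N y * ‖h y‖ ≤ A)
    (hB : ∀ t, (1 + |t|) ^ (N + 2) * ‖ψ t‖ ≤ B) (z : Cyl n) :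
    weightCyl N z * ‖synthesisFn ψ h z‖ ≤ 2 ^ (2 * N + 1) * synthesisConst * A * B := by
  obtain ⟨u, p⟩ := z
  have hw : 0 < (1 + |p|) ^ N := by positivity
  have h1 := norm_integral_le_of_norm_le
    ((integrableOn_halfPlane integrable_inv_one_add_sq).const_mul
      (((1 + |p|) ^ N)⁻¹ * (2 ^ (2 * N + 1) * (A * B)))) (f := synthesisKernel ψ h (u, p)) (by
      filter_upwards [ae_restrict_mem isOpen_halfPlane.measurableSet] with x hx
      rw [mul_assoc, ← div_eq_inv_mul, le_div_iff₀' hw]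
      exact pow_mul_norm_synthesisKernel_le N hA hB u p hx)
  rw [integral_const_mul] at h1
  calc (1 + |p|) ^ N * ‖synthesisFn ψ h (u, p)‖
      ≤ (1 + |p|) ^ N * (((1 + |p|) ^ N)⁻¹ * (2 ^ (2 * N + 1) * (A * B)) * synthesisConst) := by
        gcongr
        exact h1
    _ = _ := by field_simp

lemma SchwartzY.le_rho (Φ : SchwartzY n) (s r l m k : ℕ) (y : YSp n) :
    weightY s r y * ‖mixedY l m k (Φ : YSp n → ℂ) y‖ ≤ SchwartzY.rho (s, r, l, m, k) Φ :=
  le_ciSup (f := fun y => weightY s r y * ‖mixedY l m k (Φ : YSp n → ℂ) y‖) (Φ.2.2 s r l m k) y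

lemma weightCyl_mul_norm_mixedCyl_synthesisFn_le (Φ : SchwartzY n) (ψ : 𝓢(ℝ, ℂ)) (N q k : ℕ)
    (z : Cyl n) : weightCyl N z * ‖mixedCyl q k (synthesisFn ψ (Φ : YSp n → ℂ)) z‖
      ≤ 2 ^ (2 * N + 1) * synthesisConst * SchwartzY.rho (N + 1, N, 0, q, k) Φ
        * schwartzBound (N + 2) 0 ψ := by
  rw [Φ.bddY.mixedCyl_synthesisFn]
  exact pow_mul_norm_synthesisFn_le N (Φ.le_rho _ _ _ _ _) (pow_mul_norm_le ψ _) z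

/-- The wavelet synthesis operator as a map `𝒮(𝕐^{n+1}) × 𝒮(ℝ) → 𝒮(𝕊^{n-1} × ℝ)`. -/
def synthesisMap (x : SchwartzY n × 𝓢(ℝ, ℂ)) : SchwartzCyl n :=
  ⟨synthesisFn x.2 (x.1 : YSp n → ℂ), x.1.bddY.smoothCyl_synthesisFn x.2, fun N q k =>
    ⟨_, Set.forall_mem_range.2 (weightCyl_mul_norm_mixedCyl_synthesisFn_le x.1 x.2 N q k)⟩⟩

lemma continuous_synthesisMap : Continuous (synthesisMap (n := n)) := by
  refine continuous_of_biadditive_of_le SchwartzCyl.withSeminorms synthesisMap ?_ ?_ ?_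
  · intro Φ Φ' ψ
    refine Subtype.ext (funext fun z => ?_)
    refine Eq.trans ?_ (integral_add (Φ.bddY.integrableOn_synthesisKernel ψ z.1 z.2)
      (Φ'.bddY.integrableOn_synthesisKernel ψ z.1 z.2))
    exact integral_congr_ae (Eventually.of_forall fun x => mul_add _ _ _)
  · intro Φ ψ ψ'
    refine Subtype.ext (funext fun z => ?_)
    refine Eq.trans ?_ (integral_add (Φ.bddY.integrableOn_synthesisKernel ψ z.1 z.2)
      (Φ.bddY.integrableOn_synthesisKernel ψ' z.1 z.2))
    refine integral_congr_ae (Eventually.of_forall fun x => ?_)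
    have h : (ψ + ψ') x.1 * (x.2 : ℂ)⁻¹ = ψ x.1 * (x.2 : ℂ)⁻¹ + ψ' x.1 * (x.2 : ℂ)⁻¹ :=
      add_mul _ _ _
    exact (congrArg (· * Φ (z.1, z.2 - x.2 * x.1, toPos x.2)) h).trans (add_mul _ _ _)
  · rintro ⟨N, q, k⟩
    refine ⟨fun Φ => 2 ^ (2 * N + 1) * synthesisConst * SchwartzY.rho (N + 1, N, 0, q, k) Φ,
      schwartzBound (N + 2) 0, ?_, continuous_schwartzBound _ _, by simp, map_zero _,
      fun Φ ψ => ?_⟩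
    · exact continuous_const.mul (SchwartzY.withSeminorms.continuous_seminorm _)
    · have : Nonempty (Cyl n) := ⟨(radial 0, 0)⟩
      exact ciSup_le (weightCyl_mul_norm_mixedCyl_synthesisFn_le Φ ψ N q k)

/-! ### The synthesis operator as an iterated integral -/

lemma SchwartzY.continuous (Φ : SchwartzY n) : Continuous (Φ : YSp n → ℂ) :=
  ContMDiff.continuous Φ.2.1

lemma continuousOn_toPos : ContinuousOn toPos (Set.Ioi 0) := fun _ ht =>
  (contMDiffAt_toPos ht).continuousAt.continuousWithinAt

lemma SchwartzY.continuousOn_comp_toPos (Φ : SchwartzY n) (u : Sph n) {X : Type*}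
    [TopologicalSpace X] {f g : X → ℝ} {s : Set X} (hf : Continuous f) (hg : Continuous g)
    (hs : Set.MapsTo g s (Set.Ioi 0)) :
    ContinuousOn (fun x => Φ (u, f x, toPos (g x))) s :=
  Φ.continuous.comp_continuousOn (continuousOn_const.prodMk
    (hf.continuousOn.prodMk (continuousOn_toPos.comp hg.continuousOn hs)))

lemma integrable_synthesisIntegrand (Φ : SchwartzY n) (ψ : 𝓢(ℝ, ℂ)) (u : Sph n) (p : ℝ) :
    Integrable (fun q : ℝ × ℝ => synthesisIntegrand ψ Φ u p q.1 q.2)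
      ((volume : Measure ℝ).prod (volume.restrict (Set.Ioi (0 : ℝ)))) := by
  rw [← volume_restrict_halfPlane]
  -- The scale weight of order 2 absorbs the two factors `1 / a` and leaves `(1 + a ^ 4)⁻¹`, and `r
  -- = 2` gives integrability in `b`. Boundedness of `ψ` is enough.
  set A := SchwartzY.rho (2, 2, 0, 0, 0) Φ
  set B := schwartzBound 0 0 ψ
  refine Integrable.mono' ((integrableOn_halfPlane _root_.integrable_inv_one_add_sq).const_mul
    (2 * (A * B))) ?_ ?_
  · refine ContinuousOn.aestronglyMeasurable ?_ isOpen_halfPlane.measurableSet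
    have h1 : ContinuousOn (fun q : ℝ × ℝ => 1 / (q.2 : ℂ)) halfPlane :=
      continuousOn_const.div (by fun_prop) fun q hq => by
        simpa using (pos_of_mem_halfPlane hq).ne'
    have h2 : ContinuousOn (fun q : ℝ × ℝ => ψ ((p - q.1) / q.2)) halfPlane :=
      ψ.continuous.comp_continuousOn
        (ContinuousOn.div (by fun_prop) (by fun_prop) fun q hq => (pos_of_mem_halfPlane hq).ne')
    exact ((h1.mul h2).mul (Φ.continuousOn_comp_toPos u continuous_fst continuous_snd
      fun q hq => hq.2)).mul h1
  · filter_upwards [ae_restrict_mem isOpen_halfPlane.measurableSet] with q hq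
    obtain ⟨b, a⟩ := q
    have ha : 0 < a := pos_of_mem_halfPlane hq
    have hA : (a ^ 2 + 1 / a ^ 2) * (1 + b ^ 2) * ‖Φ (u, b, toPos a)‖ ≤ A := by
      have := Φ.le_rho 2 2 0 0 0 (u, b, toPos a)
      simpa [weightY, coe_toPos ha, mixedY] using this
    have hB : ‖ψ ((p - b) / a)‖ ≤ B := by simpa using pow_mul_norm_le ψ 0 ((p - b) / a)
    simp only [synthesisIntegrand, norm_mul, norm_div, norm_one, Complex.norm_real,
      Real.norm_of_nonneg ha.le]
    have h3 : (1 + a ^ 2) ≤ 2 * (1 + a ^ 4) := by nlinarith [sq_nonneg (a ^ 2 - 1)]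
    have e : a ^ 2 + 1 / a ^ 2 = (1 + a ^ 4) / a ^ 2 := by field_simp; ring
    rw [e] at hA
    rw [← mul_inv, ← div_eq_mul_inv, le_div_iff₀ (by positivity)]
    calc 1 / a * ‖ψ ((p - b) / a)‖ * ‖Φ (u, b, toPos a)‖ * (1 / a) * ((1 + b ^ 2) * (1 + a ^ 2))
        ≤ 1 / a * B * ‖Φ (u, b, toPos a)‖ * (1 / a) * ((1 + b ^ 2) * (2 * (1 + a ^ 4))) := by
          gcongr
      _ = 2 * (((1 + a ^ 4) / a ^ 2 * (1 + b ^ 2) * ‖Φ (u, b, toPos a)‖) * B) := by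
          field_simp
      _ ≤ 2 * (A * B) := by
          have : 0 ≤ B := (norm_nonneg _).trans hB
          gcongr

/-- With `b = p - a t`, the Jacobian `a` cancels one of the two factors `1 / a`. -/
lemma integral_synthesisIntegrand (ψ : ℝ → ℂ) (Φ : YSp n → ℂ) (u : Sph n) (p : ℝ) {a : ℝ}
    (ha : 0 < a) : ∫ b : ℝ, synthesisIntegrand ψ Φ u p b a
      = ∫ t : ℝ, synthesisKernel ψ Φ (u, p) (t, a) := by
  have hac : (a : ℂ) ≠ 0 := by simpa using ha.ne'
  have h := integral_comp_affine (fun b => synthesisIntegrand ψ Φ u p (p - b) a) ha 0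
  rw [integral_sub_left_eq_self (fun b => synthesisIntegrand ψ Φ u p b a)] at h
  rw [eq_comm, inv_mul_eq_iff_eq_mul₀ hac, ← integral_const_mul] at h
  rw [h]
  refine integral_congr_ae (Eventually.of_forall fun t => ?_)
  have e : (p - (p - a * t)) / a = t := by field_simp; ring
  simp only [synthesisIntegrand, synthesisKernel, zero_add, e]
  field_simp

lemma waveletSynthesis_eq_synthesisFn (Φ : SchwartzY n) (ψ : 𝓢(ℝ, ℂ)) (u : Sph n) (p : ℝ) :
    waveletSynthesis ψ Φ u p = synthesisFn ψ (Φ : YSp n → ℂ) (u, p) := by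
  have hi := Φ.bddY.integrableOn_synthesisKernel ψ u p
  rw [IntegrableOn, volume_restrict_halfPlane] at hi
  rw [synthesisFn, volume_restrict_halfPlane, integral_prod_symm _ hi, waveletSynthesis]
  exact setIntegral_congr_fun measurableSet_Ioi fun a ha =>
    integral_synthesisIntegrand ψ Φ u p ha

/-! ### The moments of the synthesis operator -/

lemma SchwartzY.integrable_moment (Φ : SchwartzY n) (u : Sph n) (a : posReal) (m : ℕ) :
    Integrable fun b : ℝ => (b : ℂ) ^ m * Φ (u, b, a) := by
  refine SchwartzCyl.integrable_moment (⟨sliceY (Φ : YSp n → ℂ) a,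
    SmoothY.smoothCyl_sliceY Φ.2.1 a, fun N q k => ?_⟩ : SchwartzCyl n) u m
  refine ⟨2 ^ N * SchwartzY.rho (0, N, 0, q, k) Φ, Set.forall_mem_range.2 fun z => ?_⟩
  have h1 := Φ.le_rho 0 N 0 q k (z.1, z.2, a)
  have h2 := one_add_abs_pow_le z.2 N
  simp only [weightY, pow_zero] at h1
  rw [mixedCyl_sliceY, weightCyl, sliceY]
  set H := ‖mixedY 0 q k (Φ : YSp n → ℂ) (z.1, z.2, a)‖
  -- For `s = 0` the scale factor of the weight is `1 + 1`, so the seminorm bounds twice the left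
  -- side.
  have h3 : (1 + z.2 ^ 2) ^ ((N : ℝ) / 2) * H ≤ SchwartzY.rho (0, N, 0, q, k) Φ := by
    have : 0 ≤ (1 + z.2 ^ 2) ^ ((N : ℝ) / 2) * H := by positivity
    linarith
  calc (1 + |z.2|) ^ N * H ≤ 2 ^ N * (1 + z.2 ^ 2) ^ ((N : ℝ) / 2) * H := by gcongr
    _ = 2 ^ N * ((1 + z.2 ^ 2) ^ ((N : ℝ) / 2) * H) := by ring
    _ ≤ _ := by gcongr

lemma integrable_pow_mul_synthesisKernel (Φ : SchwartzY n) (ψ : 𝓢(ℝ, ℂ)) (u : Sph n) (m : ℕ) :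
    Integrable (fun w : ℝ × ℝ × ℝ => (w.1 : ℂ) ^ m * synthesisKernel ψ Φ (u, w.1) w.2)
      ((volume : Measure ℝ).prod ((volume : Measure (ℝ × ℝ)).restrict halfPlane)) := by
  -- The kernel bound is taken with `N = m + 2`: `m` powers absorb `p ^ m`, and two make the
  -- majorant integrable in `p` jointly with `(t, a)`.
  set C := 2 ^ (2 * (m + 2) + 1) * (SchwartzY.rho (m + 2 + 1, m + 2, 0, 0, 0) Φ
    * schwartzBound (m + 2 + 2) 0 ψ)
  have hdom := (integrable_inv_one_add_sq.mul_prod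
    (integrableOn_halfPlane integrable_inv_one_add_sq)).const_mul C
  have hmeas : (volume : Measure ℝ).prod ((volume : Measure (ℝ × ℝ)).restrict halfPlane)
      = ((volume : Measure ℝ).prod (volume : Measure (ℝ × ℝ))).restrict
        (Set.univ ×ˢ halfPlane) := by
    rw [← Measure.prod_restrict, Measure.restrict_univ]
  have hS : IsOpen ((Set.univ : Set ℝ) ×ˢ halfPlane) := isOpen_univ.prod isOpen_halfPlane
  refine Integrable.mono' hdom ?_ ?_
  · rw [hmeas]
    refine ContinuousOn.aestronglyMeasurable ?_ hS.measurableSet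
    have h1 : ContinuousOn (fun w : ℝ × ℝ × ℝ => (w.2.2 : ℂ)⁻¹) (Set.univ ×ˢ halfPlane) :=
      ContinuousOn.inv₀ (by fun_prop) fun w hw => by
        simpa using (pos_of_mem_halfPlane hw.2).ne'
    have h2 : Continuous fun w : ℝ × ℝ × ℝ => ψ w.2.1 := ψ.continuous.comp (by fun_prop)
    have h3 : Continuous fun w : ℝ × ℝ × ℝ => (w.1 : ℂ) ^ m := by fun_prop
    exact h3.continuousOn.mul ((h2.continuousOn.mul h1).mul
      (Φ.continuousOn_comp_toPos u (f := fun w : ℝ × ℝ × ℝ => w.1 - w.2.2 * w.2.1)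
        (by fun_prop) (g := fun w => w.2.2) (by fun_prop)
        fun w hw => pos_of_mem_halfPlane hw.2))
  · rw [hmeas]
    filter_upwards [ae_restrict_mem hS.measurableSet] with w hw
    obtain ⟨p, x⟩ := w
    have h1 := pow_mul_norm_synthesisKernel_le (m + 2) (Φ.le_rho (m + 2 + 1) (m + 2) 0 0 0)
      (pow_mul_norm_le ψ (m + 2 + 2)) u p hw.2
    have h0 : 0 < (1 + |p|) ^ 2 := by positivity
    rw [norm_mul, norm_pow, Complex.norm_real, Real.norm_eq_abs, mul_left_comm, ← div_eq_inv_mul,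
      le_div_iff₀ h0]
    refine le_trans ?_ h1
    calc |p| ^ m * ‖synthesisKernel ψ Φ (u, p) x‖ * (1 + |p|) ^ 2
        ≤ (1 + |p|) ^ m * ‖synthesisKernel ψ Φ (u, p) x‖ * (1 + |p|) ^ 2 := by
          gcongr
          linarith
      _ = _ := by
          rw [pow_add]
          exact mul_right_comm _ _ _

/-- Translation by `a t` and the binomial formula for `(b + a t) ^ m` separate the variables,
leaving `t` only in the integrands `t ^ (m - j) ψ(t)` of moments of `ψ`. -/
lemma integral_pow_mul_synthesisKernel (Φ : SchwartzY n) (ψ : ℝ → ℂ) (u : Sph n) (m : ℕ)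
    (t a : ℝ) : ∫ p : ℝ, (p : ℂ) ^ m * synthesisKernel ψ Φ (u, p) (t, a)
      = ∑ j ∈ Finset.range (m + 1), ((a : ℂ) ^ (m - j) * (m.choose j) * (a : ℂ)⁻¹
          * ∫ b : ℝ, (b : ℂ) ^ j * Φ (u, b, toPos a)) * ((t : ℂ) ^ (m - j) * ψ t) := by
  rw [← integral_add_right_eq_self _ (a * t)]
  have e : ∀ b : ℝ, ((b + a * t : ℝ) : ℂ) ^ m * synthesisKernel ψ Φ (u, b + a * t) (t, a)
      = ∑ j ∈ Finset.range (m + 1), ((a : ℂ) ^ (m - j) * (m.choose j) * (a : ℂ)⁻¹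
        * ((t : ℂ) ^ (m - j) * ψ t)) * ((b : ℂ) ^ j * Φ (u, b, toPos a)) := by
    intro b
    push_cast
    rw [add_pow, Finset.sum_mul]
    refine Finset.sum_congr rfl fun j _ => ?_
    rw [synthesisKernel, mul_pow]
    simp only [add_sub_cancel_right]
    ring
  simp only [e]
  rw [integral_finsetSum _ fun j _ => (Φ.integrable_moment u (toPos a) j).const_mul _]
  refine Finset.sum_congr rfl fun j _ => ?_
  rw [integral_const_mul]
  ring

/-- By Fubini the integral over `p` is taken first, then that over `t`. For every `a`, the latter is
a combination of moments of `ψ` and vanishes. -/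
lemma moment_synthesisFn (Φ : SchwartzY n) (ψ : LizorkinR) (u : Sph n) (m : ℕ) :
    ∫ p : ℝ, (p : ℂ) ^ m * synthesisFn (ψ : 𝓢(ℝ, ℂ)) (Φ : YSp n → ℂ) (u, p) = 0 := by
  have hi := integrable_pow_mul_synthesisKernel Φ ψ u m
  have hi' := hi.integral_prod_right
  simp only [synthesisFn, ← integral_const_mul]
  rw [integral_integral_swap hi]
  rw [volume_restrict_halfPlane] at hi' ⊢
  rw [integral_prod_symm _ hi']
  refine integral_eq_zero_of_ae (Eventually.of_forall fun a => ?_)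
  simp only [integral_pow_mul_synthesisKernel]
  rw [integral_finsetSum _ fun j _ => (integrable_moment _ _).const_mul _]
  refine Finset.sum_eq_zero fun j _ => ?_
  rw [integral_const_mul, ψ.2, mul_zero]

/-- The wavelet synthesis operator as a map `𝒮(𝕐^{n+1}) × 𝒮₀(ℝ) → 𝒮₀(𝕊^{n-1} × ℝ)`. -/
def lizorkinSynthesisMap (x : SchwartzY n × LizorkinR) : LizorkinCyl n :=
  ⟨synthesisMap (x.1, (x.2 : 𝓢(ℝ, ℂ))), fun u m => moment_synthesisFn x.1 x.2 u m⟩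

lemma continuous_lizorkinSynthesisMap : Continuous (lizorkinSynthesisMap (n := n)) :=
  (continuous_synthesisMap.comp
    (continuous_fst.prodMk (continuous_subtype_val.comp continuous_snd))).subtype_mk _

end Ridgelet

end

open Ridgelet in
theorem corollary4p3 (n : ℕ) [n.AtLeastTwo] :
    -- the integrals that define the two transforms converge absolutely
    (∀ (g : LizorkinCyl n) (ψ : LizorkinR) (u : Sph n) (b : ℝ) (a : posReal),
      Integrable (waveletIntegrand (ψ : 𝓢(ℝ, ℂ)) (g : SchwartzCyl n) u b a)) ∧
    (∀ (Φ : SchwartzY n) (ψ : 𝓢(ℝ, ℂ)) (u : Sph n) (p : ℝ),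
      Integrable (fun q : ℝ × ℝ => synthesisIntegrand ψ Φ u p q.1 q.2)
        ((volume : Measure ℝ).prod (volume.restrict (Set.Ioi (0 : ℝ))))) ∧
    -- (i)
    (∃ W : LizorkinCyl n × LizorkinR → SchwartzY n,
      (∀ (g : LizorkinCyl n) (ψ : LizorkinR) (u : Sph n) (b : ℝ) (a : posReal),
        W (g, ψ) (u, b, a) = waveletTransform (ψ : 𝓢(ℝ, ℂ)) (g : SchwartzCyl n) u b a) ∧
      Continuous W) ∧
    -- (ii)
    (∃ M : SchwartzY n × 𝓢(ℝ, ℂ) → SchwartzCyl n,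
      (∀ (Φ : SchwartzY n) (ψ : 𝓢(ℝ, ℂ)) (u : Sph n) (p : ℝ),
        M (Φ, ψ) (u, p) = waveletSynthesis ψ Φ u p) ∧
      Continuous M) ∧
    -- (iii)
    (∃ M₀ : SchwartzY n × LizorkinR → LizorkinCyl n,
      (∀ (Φ : SchwartzY n) (ψ : LizorkinR) (u : Sph n) (p : ℝ),
        (M₀ (Φ, ψ) : SchwartzCyl n) (u, p) = waveletSynthesis (ψ : 𝓢(ℝ, ℂ)) Φ u p) ∧
      Continuous M₀) := by
  refine ⟨fun g ψ => integrable_waveletIntegrand ψ (g : SchwartzCyl n),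
    fun Φ ψ => integrable_synthesisIntegrand Φ ψ,
    ⟨waveletMap, fun g ψ u b a => (waveletTransform_eq_waveletFn _ _ u b a).symm,
      continuous_waveletMap⟩,
    ⟨synthesisMap, fun Φ ψ u p => (waveletSynthesis_eq_synthesisFn Φ ψ u p).symm,
      continuous_synthesisMap⟩,
    ⟨lizorkinSynthesisMap, fun Φ ψ u p => (waveletSynthesis_eq_synthesisFn Φ ψ u p).symm,
      continuous_lizorkinSynthesisMap⟩⟩
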